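/- Let $1/2\le p_L<p_H<1$ and $N\ge 2$. A set $\mathcal E$ of evaluation dates has positive lower density, $\liminf_n |\mathcal E\cap[0,n)|/n>0$. A score $S(Q,x)$ is strictly proper on a class of laws if $S(Q,\cdot)$ is $P$-integrable and $E_{P}S(Q,\cdot)<E_P S(P,\cdot)$ for all $P\ne Q$ in the class. **Binary model.** A state $\theta\in\{0,1\}$, $\Pr(\theta=1)\in(0,1)$, and independent expert types $p_i\in\{p_L,p_H\}$, $\Pr(p_i=p_H)=\varpi\in(0,1)$, are drawn once. At each date, given $\theta$, the types and the public history of reports, the signals $s^i_t\in\{0,1\}$ have a joint law (with arbitrary cross-expert dependence) under which $\Pr(s^i_t=\theta)=p_i$; given the signals, expert $i$ draws a report $y^i_t\in\{0,1\}$, independently across experts, from a kernel depending on his type, his signal and the public history, so that his report has full support in both states. Put $\lambda_t=\Pr(\theta=1\mid Y_{1:t})$ and $\rho^i_t=\Pr(p_i=p_H\mid Y_{1:t})$; write $\ell_p(y\mid k)$ for the report likelihood of type $p$ in state $k$ and $$z_{it}=\log\frac{\rho^i_{t-1}\ell_{p_H}(y^i_t\mid 1)+(1-\rho^i_{t-1})\ell_{p_L}(y^i_t\mid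 1)}{\rho^i_{t-1}\ell_{p_H}(y^i_t\mid 0)+(1-\rho^i_{t-1})\ell_{p_L}(y^i_t\mid 0)} .$$ Assume common shocks: given $\theta$, the types and the public history, $z_t$ has covariance $\Sigma_t=D_t+\tau_t^2\mathbf 1\mathbf 1^\top$ with $D_t=\mathrm{diag}(v_{1t},\dots,v_{Nt})$, $v_{it}>0$, $\tau_t^2\ge0$, and pairwise correlations at most some $\rho_c<1$, uniformly in $t$. On evaluation dates, for each realised state $k$ a score $S_k$, strictly proper on the full-support laws on $\{0,1\}$, is applied: the reporting kernel of each type maximises, in each state $k$ and among kernels whose report laws have full support in both states, the expected score $E_{x\sim P_k}S_k(\tilde P_k,x)$ of the induced report law $\tilde P_k$, where $P_k$ is the law of the expert's signal in state $k$. Then: (i) There is $c>0$, depending only on $p_L,p_H$, such that at every $t\in\mathcal E$, after every history and for every type profile with some $p_i>1/2$, the Kullback–Leibler divergence between the joint laws of the date-$t$ reports in the two states (in either order) is at least $c$. If $p_L>1/2$, the same bound holds for the laws of $y_t$ given $\theta$ and the history alone, after every history that has positive probability in both states. Almost surely, if some $p_i>1/2$, then $\lambda_t\to\mathbf 1\{\theta=1\}$.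 Moreover, almost surely, if all $p_i>1/2$, then the beliefs defined by $\operatorname{logit}\lambda^{G}_t=\operatorname{logit}\lambda^{G}_{t-1}+w_t^\top z_t$, $\lambda^G_0=\Pr(\theta=1)$, with the GLS weights $w_t=\Sigma_t^{-1}\mathbf 1/(\mathbf 1^\top\Sigma_t^{-1}\mathbf 1)$, converge to $\mathbf 1\{\theta=1\}$. (ii) Almost surely, for every $i$, $\rho^i_t\to\mathbf 1\{p_i=p_H\}$. The same holds for the reputations computed from scored rounds only, in which type $p$ has weight proportional to its prior probability times $\exp\sum_{s\in\mathcal E,\,s\le t}S_\theta(P_{p,\theta},y^i_s)$, where $P_{p,\theta}$ is the truthful report law of type $p$ in state $\theta$. **Gaussian model.** Let $\theta\sim\mathcal N(m_0,V_0)$, $V_0>0$, and $y_t=h_t\theta+c_t+\varepsilon_t\in\mathbb R^N$. Here the tilt $a_{t-1}\in(0,1]$ and the reputations $\rho^i_{t-1}\in[0,1]$ are determined before date $t$, $h^i_t=\rho^i_{t-1}+(1-\rho^i_{t-1})a_{t-1}$, $c^i_t=(1-\rho^i_{t-1})(1-a_{t-1})m_{t-1}$. Given $\theta$ and the past, $\varepsilon_t\sim\mathcal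 N(0,\Sigma_t)$, realised as $\varepsilon^i_t=\sqrt{v_{it}}\,\xi_{it}+\tau_t\eta_t$ with standard normal $\xi_{it},\eta_t$ that are independent of each other and of $\theta$ and the past; $\Sigma_t=D_t+\tau_t^2\mathbf 1\mathbf 1^\top$ is determined before date $t$, with $D_t=\mathrm{diag}(v_{it})$, $0<v_{it}\le\rho^i_{t-1}/p_H+(1-\rho^i_{t-1})a_{t-1}^2/p_L$, $\tau_t^2\ge 0$, and pairwise correlations at most $\rho_c<1$. The filter is $V_t^{-1}=V_{t-1}^{-1}+h_t^\top\Sigma_t^{-1}h_t$, $m_t=m_{t-1}+V_th_t^\top\Sigma_t^{-1}(y_t-c_t-h_tm_{t-1})$. On evaluation dates, for each state $\theta$ a score strictly proper on nondegenerate Gaussian laws is applied, and in each state the tilt $a_{t-1}$ maximises over $a\in(0,1]$ the expected score, at draws from $\mathcal N(\theta,1/p_L)$, of the induced report law $\mathcal N(m_{t-1}+a(\theta-m_{t-1}),a^2/p_L)$. Then: (iii) There is $\kappa>0$, depending only on $p_L,p_H,N,\rho_c$, such that on every evaluation date $h_t^\top\Sigma_t^{-1}h_t\ge\kappa$ and $\mathrm{diag}(h_t)\Sigma_t^{-1}\mathrm{diag}(h_t)\succeq\kappa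 I$. The sequence $V_t$ is nonincreasing with limit $0$, and $m_t\to\theta$ almost surely. -/

import Mathlib

open MeasureTheory ProbabilityTheory Filter Topology Matrix

noncomputable section

namespace ExpertPanel

/-! ### Evaluation dates, scoring rules, intraclass covariance

Dates are indexed from `0`: the profile `y t` is published at date `t`, and objects with index `t`
are computed from the profiles `y 0, …, y (t - 1)`. -/

/-- Lower asymptotic density of a set of dates. -/
def lowerDensity (E : Set ℕ) : ℝ :=
  liminf (fun n : ℕ => ((E ∩ Set.Iio n).ncard : ℝ) / n) atTop

/-- `S Q x` is the score of the announced law `Q` at the outcome `x`. The rule is strictly proper on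
a class of laws if, for outcomes drawn from a law `P` of the class, announcing `P` is the unique
maximiser of the expected score. -/
def StrictlyProperOn {α : Type*} [MeasurableSpace α] (C : Set (Measure α))
    (S : Measure α → α → ℝ) : Prop :=
  ∀ P ∈ C, ∀ Q ∈ C, Integrable (S Q) P ∧ (Q ≠ P → ∫ x, S Q x ∂P < ∫ x, S P x ∂P)

/-- The matrix `D + τ² 1 1ᵀ` with `D = diag v`. -/
def intraclass {N : ℕ} (v : Fin N → ℝ) (tauSq : ℝ) : Matrix (Fin N) (Fin N) ℝ :=
  Matrix.diagonal v + Matrix.of fun _ _ => tauSq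

/-- All pairwise correlations of a covariance matrix are at most `r`. -/
def CorrLE {N : ℕ} (A : Matrix (Fin N) (Fin N) ℝ) (r : ℝ) : Prop :=
  ∀ i j, i ≠ j → A i j / (√(A i i) * √(A j j)) ≤ r

/-- The weights `Σ⁻¹ 1 / (1ᵀ Σ⁻¹ 1)`. -/
def glsWeight {N : ℕ} (A : Matrix (Fin N) (Fin N) ℝ) : Fin N → ℝ :=
  fun i => (A⁻¹ *ᵥ 1) i / (1 ⬝ᵥ (A⁻¹ *ᵥ 1))

/-! ### The binary model

`true` stands for the state `1`, the signal `1`, the report `1` and the high type. -/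

/-- One entry in `{0, 1}` per expert. -/
abbrev Profile (N : ℕ) := Fin N → Bool

/-- Public history before date `t`. -/
abbrev Hist (N t : ℕ) := Fin t → Profile N

/-- Precision of a type. -/
def precision (pL pH : ℝ) (x : Bool) : ℝ := if x then pH else pL

/-- Law of the signal of an expert of precision `p` in state `k`: correct with probability `p`. -/
def signalLaw (p : ℝ) (k : Bool) : Measure Bool :=
  ENNReal.ofReal p • Measure.dirac k + ENNReal.ofReal (1 - p) • Measure.dirac (!k)

/-- Law of the report when the signal has law `ν` and the reporting kernel is `κ`. -/
def garble (κ : Bool → PMF Bool) (ν : Measure Bool) : Measure Bool :=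
  ∑ s, ν {s} • (κ s).toMeasure

/-- Probability laws on `{0, 1}` with full support. -/
def fullSupportLaws : Set (Measure Bool) :=
  {ν | IsProbabilityMeasure ν ∧ ∀ b, ν {b} ≠ 0}

/-- Primitives of the binary panel: the prior of the state, the prior of the high type, the joint law
of the signals of a date given state, types and public history (any cross-expert dependence, the
marginals being fixed by the precisions), and the reporting kernel of each type of each expert
after each public history. Reports have full support in both states. -/
structure BinaryPanel (N : ℕ) (pL pH : ℝ) where
  prior : ℝ
  prior_mem : prior ∈ Set.Ioo (0 : ℝ) 1
  highPrior : ℝ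
  highPrior_mem : highPrior ∈ Set.Ioo (0 : ℝ) 1
  signals : (t : ℕ) → (k : Bool) → (x : Profile N) → Hist N t → PMF (Profile N)
  signals_marginal : ∀ t k x h i,
    (signals t k x h).toMeasure.map (fun s => s i) = signalLaw (precision pL pH (x i)) k
  report : (t : ℕ) → (i : Fin N) → (type : Bool) → Hist N t → (signal : Bool) → PMF Bool
  report_full : ∀ t i x h k,
    garble (report t i x h) (signalLaw (precision pL pH x) k) ∈ fullSupportLaws

namespace BinaryPanel

variable {N : ℕ} {pL pH : ℝ} (M : BinaryPanel N pL pH)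

/-- Law of the date-`t` report of expert `i` given his type, the state and the public history. -/
def reportLaw (t : ℕ) (i : Fin N) (type k : Bool) (h : Hist N t) : Measure Bool :=
  garble (M.report t i type h) (signalLaw (precision pL pH type) k)

/-- Joint law of the date-`t` reports given the state, the types and the public history. -/
def jointReportLaw (t : ℕ) (k : Bool) (x : Profile N) (h : Hist N t) : Measure (Profile N) :=
  ∑ s, M.signals t k x h s • Measure.pi fun i => (M.report t i (x i) h (s i)).toMeasure

/-- Log-likelihood increment `log r_i(b)` of report `b` of expert `i` with current reputation `r`. -/
def logRatio (t : ℕ) (h : Hist N t) (i : Fin N) (r : ℝ) (b : Bool) : ℝ :=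
  Real.log
    ((r * (M.reportLaw t i true true h).real {b} + (1 - r) * (M.reportLaw t i false true h).real {b}) /
     (r * (M.reportLaw t i true false h).real {b} +
        (1 - r) * (M.reportLaw t i false false h).real {b}))

end BinaryPanel

/-- The history of reports before date `t`. -/
def hist {N : ℕ} {Ω : Type*} (y : ℕ → Ω → Profile N) (t : ℕ) (ω : Ω) : Hist N t :=
  fun j => y j ω

/-- Conditional probability of the event `A` given that the reports before date `t` are `h`. -/
def posterior {N : ℕ} {Ω : Type*} [MeasurableSpace Ω] (P : Measure Ω) (y : ℕ → Ω → Profile N)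
    (A : Set Ω) (t : ℕ) (h : Hist N t) : ℝ :=
  (ProbabilityTheory.cond P {ω | hist y t ω = h}).real A

/-- Public belief `λ_t = Pr(θ = 1 | Y_{1:t})`. -/
def belief {N : ℕ} {Ω : Type*} [MeasurableSpace Ω] (P : Measure Ω) (θ : Ω → Bool)
    (y : ℕ → Ω → Profile N) (t : ℕ) (ω : Ω) : ℝ :=
  posterior P y {ω' | θ ω' = true} t (hist y t ω)

/-- Reputation `ρ^i_t = Pr(p_i = p_H | Y_{1:t})`. -/
def reputation {N : ℕ} {Ω : Type*} [MeasurableSpace Ω] (P : Measure Ω) (types : Ω → Profile N)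
    (y : ℕ → Ω → Profile N) (i : Fin N) (t : ℕ) (ω : Ω) : ℝ :=
  posterior P y {ω' | types ω' i = true} t (hist y t ω)

namespace BinaryPanel

variable {N : ℕ} {pL pH : ℝ} (M : BinaryPanel N pL pH)

/-- `(θ, types, y)` has the law described by `M`: the state and the types are drawn independently
from their priors once and for all, and given them and the past reports the date-`t` reports
have law `jointReportLaw`. -/
structure IsPath {Ω : Type*} [MeasurableSpace Ω] (P : Measure Ω) (θ : Ω → Bool)
    (types : Ω → Profile N) (y : ℕ → Ω → Profile N) : Prop where
  measurable_state : Measurable θ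
  measurable_types : Measurable types
  measurable_reports : ∀ t, Measurable (y t)
  initial : ∀ k x, P.real {ω | θ ω = k ∧ types ω = x} =
    (if k then M.prior else 1 - M.prior) *
      ∏ i, (if x i then M.highPrior else 1 - M.highPrior)
  step : ∀ t k x h b, P.real {ω | θ ω = k ∧ types ω = x ∧ hist y t ω = h ∧ y t ω = b} =
    P.real {ω | θ ω = k ∧ types ω = x ∧ hist y t ω = h} * (M.jointReportLaw t k x h).real {b}

/-- At every date of `E` and after every history, the reporting kernel of each type of each expert
attains, in each state `k`, the maximal expected score: the report law induced by the kernel is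
scored by `S k` at draws from the law of the signal, and is compared with the report laws
of full support induced by all other reporting kernels. -/
def ScoreOptimal (S : Bool → Measure Bool → Bool → ℝ) (E : Set ℕ) : Prop :=
  ∀ t ∈ E, ∀ i x h, ∀ κ : Bool → PMF Bool,
    (∀ k, garble κ (signalLaw (precision pL pH x) k) ∈ fullSupportLaws) →
    ∀ k, ∫ b, S k (garble κ (signalLaw (precision pL pH x) k)) b ∂signalLaw (precision pL pH x) k ≤
      ∫ b, S k (M.reportLaw t i x k h) b ∂signalLaw (precision pL pH x) k

/-- Vector `z_t` of individual log-likelihood increments when the reports `b` follow history `h`. -/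
def increments {Ω : Type*} [MeasurableSpace Ω] (P : Measure Ω) (types : Ω → Profile N)
    (y : ℕ → Ω → Profile N) (t : ℕ) (h : Hist N t) (b : Profile N) : Fin N → ℝ :=
  fun i => M.logRatio t h i (posterior P y {ω' | types ω' i = true} t h) (b i)

/-- Common shocks: given the state, the types and the past, `z_t` has covariance matrix
`D_t + τ_t² 1 1ᵀ`, with correlations bounded by `rhoC`. -/
structure CommonShocks {Ω : Type*} [MeasurableSpace Ω] (P : Measure Ω) (θ : Ω → Bool)
    (types : Ω → Profile N) (y : ℕ → Ω → Profile N)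
    (v : (t : ℕ) → Bool → Profile N → Hist N t → Fin N → ℝ)
    (tauSq : (t : ℕ) → Bool → Profile N → Hist N t → ℝ) (rhoC : ℝ) : Prop where
  v_pos : ∀ t k x h i, 0 < v t k x h i
  tauSq_nonneg : ∀ t k x h, 0 ≤ tauSq t k x h
  covariance_eq : ∀ t k x h, P {ω | θ ω = k ∧ types ω = x ∧ hist y t ω = h} ≠ 0 →
    ∀ i j, ProbabilityTheory.covariance (fun b => M.increments P types y t h b i)
      (fun b => M.increments P types y t h b j) (M.jointReportLaw t k x h) =
      intraclass (v t k x h) (tauSq t k x h) i j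
  corr_le : ∀ t k x h, P {ω | θ ω = k ∧ types ω = x ∧ hist y t ω = h} ≠ 0 →
    CorrLE (intraclass (v t k x h) (tauSq t k x h)) rhoC

/-- All standing assumptions of the binary model with common shocks and evaluation dates `E` of
positive lower density, scored by a strictly proper rule `S` (one rule per realised state). -/
structure Assumptions {Ω : Type*} [MeasurableSpace Ω] (P : Measure Ω) (θ : Ω → Bool)
    (types : Ω → Profile N) (y : ℕ → Ω → Profile N)
    (v : (t : ℕ) → Bool → Profile N → Hist N t → Fin N → ℝ)
    (tauSq : (t : ℕ) → Bool → Profile N → Hist N t → ℝ) (rhoC : ℝ)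
    (S : Bool → Measure Bool → Bool → ℝ) (E : Set ℕ) : Prop where
  path : M.IsPath P θ types y
  shocks : M.CommonShocks P θ types y v tauSq rhoC
  rhoC_lt : rhoC < 1
  density : 0 < lowerDensity E
  proper : ∀ k, StrictlyProperOn fullSupportLaws (S k)
  optimal : M.ScoreOptimal S E

/-- Log-odds of the GLS pool: `logit λ_{t+1} = logit λ_t + w_tᵀ z_t`, started at the prior. -/
def glsLogit {Ω : Type*} [MeasurableSpace Ω] (P : Measure Ω) (θ : Ω → Bool)
    (types : Ω → Profile N) (y : ℕ → Ω → Profile N)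
    (v : (t : ℕ) → Bool → Profile N → Hist N t → Fin N → ℝ)
    (tauSq : (t : ℕ) → Bool → Profile N → Hist N t → ℝ) : ℕ → Ω → ℝ
  | 0, _ => Real.log (M.prior / (1 - M.prior))
  | t + 1, ω => glsLogit P θ types y v tauSq t ω +
      glsWeight (intraclass (v t (θ ω) (types ω) (hist y t ω))
        (tauSq t (θ ω) (types ω) (hist y t ω))) ⬝ᵥ
        M.increments P types y t (hist y t ω) (y t ω)

/-- Reputation of expert `i` before date `t` computed from the scored rounds only: the weight of a
type is proportional to its prior weight times the exponential of the total score, in the realised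
state, of the truthful report law of that type at the reports published on evaluation dates. -/
def scoredReputation {Ω : Type*} (θ : Ω → Bool) (y : ℕ → Ω → Profile N)
    (S : Bool → Measure Bool → Bool → ℝ) (E : Set ℕ) (i : Fin N) (t : ℕ) (ω : Ω) : ℝ :=
  let total (p : ℝ) : ℝ := ∑ s ∈ Finset.range t,
    E.indicator (fun s => S (θ ω) (signalLaw p (θ ω)) (y s ω i)) s
  M.highPrior * Real.exp (total pH) /
    (M.highPrior * Real.exp (total pH) + (1 - M.highPrior) * Real.exp (total pL))

end BinaryPanel

/-! ### The Gaussian model -/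

/-- Data of the Gaussian panel: state, reports, low-type tilt `a`, reputations `rep`, variances of the
idiosyncratic noise `v` and of the common factor `tauSq`, standardised idiosyncratic
noises and common factor, and the prior mean and variance. The values `a t`, `rep t`, `v t`,
`tauSq t` are those in force when the date-`t` reports are made. -/
structure GaussianPanel (N : ℕ) (Ω : Type*) where
  state : Ω → ℝ
  y : ℕ → Ω → Fin N → ℝ
  a : ℕ → Ω → ℝ
  rep : ℕ → Ω → Fin N → ℝ
  v : ℕ → Ω → Fin N → ℝ
  tauSq : ℕ → Ω → ℝ
  idio : ℕ → Ω → Fin N → ℝ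
  common : ℕ → Ω → ℝ
  m0 : ℝ
  V0 : ℝ

namespace GaussianPanel

variable {N : ℕ} {Ω : Type*} (G : GaussianPanel N Ω)

/-- Effective loading `h = ρ + (1 - ρ) a`. -/
def loading (t : ℕ) (ω : Ω) : Fin N → ℝ :=
  fun i => G.rep t ω i + (1 - G.rep t ω i) * G.a t ω

/-- Effective variance `ρ / p_H + (1 - ρ) a² / p_L`. -/
def effVar (pL pH : ℝ) (t : ℕ) (ω : Ω) (i : Fin N) : ℝ :=
  G.rep t ω i * (1 / pH) + (1 - G.rep t ω i) * (G.a t ω ^ 2 / pL)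

/-- Intercept `c = (1 - ρ) (1 - a) m` at public mean `m`. -/
def intercept (t : ℕ) (ω : Ω) (m : ℝ) : Fin N → ℝ :=
  fun i => (1 - G.rep t ω i) * (1 - G.a t ω) * m

/-- Noise covariance `Σ_t`. -/
def noiseCov (t : ℕ) (ω : Ω) : Matrix (Fin N) (Fin N) ℝ := intraclass (G.v t ω) (G.tauSq t ω)

/-- The information increment `H_tᵀ Σ_t⁻¹ H_t` for the scalar state, `H_t` the vector of loadings. -/
def info (t : ℕ) (ω : Ω) : ℝ :=
  G.loading t ω ⬝ᵥ ((G.noiseCov t ω)⁻¹ *ᵥ G.loading t ω)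

/-- Filter variance. -/
def V : ℕ → Ω → ℝ
  | 0, _ => G.V0
  | t + 1, ω => ((V t ω)⁻¹ + G.info t ω)⁻¹

/-- Filter mean. -/
def m : ℕ → Ω → ℝ
  | 0, _ => G.m0
  | t + 1, ω => m t ω + G.V (t + 1) ω * (G.loading t ω ⬝ᵥ ((G.noiseCov t ω)⁻¹ *ᵥ
      (G.y t ω - G.intercept t ω (m t ω) - m t ω • G.loading t ω)))

/-- Law of the low type's report in state `θ` when the tilt is `a` and the public mean is `m`. -/
def tiltLaw (pL m θ a : ℝ) : Measure ℝ :=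
  gaussianReal (m + a * (θ - m)) (a ^ 2 / pL).toNNReal

/-- Nondegenerate Gaussian laws on the line. -/
def gaussianLaws : Set (Measure ℝ) :=
  {ν | ∃ (μ : ℝ) (s : NNReal), s ≠ 0 ∧ ν = gaussianReal μ s}

/-- At every date of `E` the low type's tilt attains, in each state `θ`, the maximal expected score
over all tilts in `(0, 1]`: the induced report law is scored at draws from the law
`N(θ, 1 / p_L)` of his signal. -/
def ScoreOptimal (pL : ℝ) (S : ℝ → Measure ℝ → ℝ → ℝ) (E : Set ℕ) : Prop :=
  ∀ t ∈ E, ∀ ω, ∀ a ∈ Set.Ioc (0 : ℝ) 1, ∀ θ,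
    ∫ x, S θ (tiltLaw pL (G.m t ω) θ a) x ∂gaussianReal θ (1 / pL).toNNReal ≤
      ∫ x, S θ (tiltLaw pL (G.m t ω) θ (G.a t ω)) x ∂gaussianReal θ (1 / pL).toNNReal

/-- All standing assumptions of the Gaussian model: the observation equation
`y_t = H_t θ + c_t + ε_t` where, given the state and the past (collected in the filtration `𝓖`), the noise
`ε_t = √v_t ξ_t + τ_t η_t 1` is `N(0, D_t + τ_t² 1 1ᵀ)`; correlations at most `rhoC < 1`;
evaluation dates `E` of positive lower density scored by a strictly proper rule. -/
structure Assumptions [mΩ : MeasurableSpace Ω] (P : Measure Ω) (𝓖 : Filtration ℕ mΩ)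
    (pL pH rhoC : ℝ) (S : ℝ → Measure ℝ → ℝ → ℝ) (E : Set ℕ) : Prop where
  V0_pos : 0 < G.V0
  state_measurable : Measurable[𝓖 0] G.state
  state_law : P.map G.state = gaussianReal G.m0 G.V0.toNNReal
  a_measurable : ∀ t, Measurable[𝓖 t] (G.a t)
  rep_measurable : ∀ t, Measurable[𝓖 t] (G.rep t)
  v_measurable : ∀ t, Measurable[𝓖 t] (G.v t)
  tauSq_measurable : ∀ t, Measurable[𝓖 t] (G.tauSq t)
  a_mem : ∀ t ω, G.a t ω ∈ Set.Ioc (0 : ℝ) 1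
  rep_mem : ∀ t ω i, G.rep t ω i ∈ Set.Icc (0 : ℝ) 1
  v_pos : ∀ t ω i, 0 < G.v t ω i
  v_le : ∀ t ω i, G.v t ω i ≤ G.effVar pL pH t ω i
  tauSq_nonneg : ∀ t ω, 0 ≤ G.tauSq t ω
  corr_le : ∀ t ω, CorrLE (G.noiseCov t ω) rhoC
  shock_measurable : ∀ t, Measurable[𝓖 (t + 1)] fun ω => (G.common t ω, G.idio t ω)
  shock_indep : ∀ t,
    Indep (MeasurableSpace.comap (fun ω => (G.common t ω, G.idio t ω)) inferInstance) (𝓖 t) P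
  shock_law : ∀ t, P.map (fun ω => (G.common t ω, G.idio t ω)) =
    (gaussianReal 0 1).prod (Measure.pi fun _ => gaussianReal 0 1)
  observation : ∀ t ω i, G.y t ω i = G.loading t ω i * G.state ω + G.intercept t ω (G.m t ω) i +
    (√(G.v t ω i) * G.idio t ω i + √(G.tauSq t ω) * G.common t ω)
  density : 0 < lowerDensity E
  proper : ∀ θ, StrictlyProperOn gaussianLaws (S θ)
  optimal : G.ScoreOptimal pL S E

end GaussianPanel

end ExpertPanel

end

open MeasureTheory ProbabilityTheory Filter Topology Matrix

noncomputable section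

namespace ExpertPanel

/-! ### Divergence bounds from a test set -/

/-! Scoring enters only through truthfulness. Reporting the signal unchanged is an admissible
kernel, so strict propriety forces the report law of every maximising kernel on an evaluation date
to equal the law of the signal (`ScoreOptimal.reportLaw_eq`). Hence on scored dates expert `i`
reports the realised state with probability exactly `p_i`. For an expert with `p_i > 1/2` the event
that he reports `k` has probabilities in the two states that differ by `2 p_i - 1`, whatever the
dependence across experts, and a Pinsker inequality (`ofReal_sq_le_klDiv`) turns this gap into the
divergence bound.

Learning by the Bayesian observer needs no analysis of likelihoods off the evaluation dates. If
tests based on the history separate two events with summable error probabilities, the posteriors of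
the wrong event are summable in expectation on the right one, and so tend to zero almost surely
(`ae_tendsto_posterior_zero`). The tests count scored reports of one expert against a threshold. A
Chernoff bound for adapted sums together with the positive lower density of evaluation dates makes
their errors exponentially small (`IsPath.chernoff`, `IsPath.exists_summable_drift`). The scored
reputations use the same drift lemma, applied to the score difference, whose mean has a definite
sign by strict propriety.

For the GLS pool the common factor cancels from the normalised weights, which are therefore positive
and sum to one. Once reputations are nearly correct, each log-likelihood increment has conditional
drift towards the true state of at least a divergence minus a small error
(`le_sum_stateSign_mul_logRatio`). The divergence term is uniformly positive on scored dates, and a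
law of large numbers for the bounded increments finishes.

In the Gaussian model the same propriety argument gives tilt and loading `1` on evaluation dates.
The correlation bound caps the common variance, so every scored date adds at least a fixed amount of
information and `V` tends to zero. The filter error contracts by `V (t + 1) / V t` and receives a
martingale difference. The squared coefficients of these differences are dominated by the decrements
of `V`, so the noise sums converge (`ae_tendsto_sum_whiteNoise`), and an averaging argument sends
the error itself to zero (`tendsto_of_averaging`). -/

/-- The left side is the tangent line at `u` of the convex function `klFun`. Integrating it with `u`
constant on the pieces of a partition is what yields the Pinsker-type bounds. -/
lemma mul_log_add_le_klFun {x u : ℝ} (hx : 0 ≤ x) (hu : 0 < u) :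
    x * Real.log u + (1 - u) ≤ InformationTheory.klFun x := by
  rw [InformationTheory.klFun_apply]
  rcases hx.eq_or_lt with rfl | hx
  · simp; linarith
  · have h := Real.log_le_sub_one_of_pos (div_pos hu hx)
    rw [Real.log_div hu.ne' hx.ne'] at h
    have h2 := mul_le_mul_of_nonneg_left h hx.le
    have h3 : x * (u / x - 1) = u - x := by field_simp
    rw [h3] at h2
    linarith

lemma le_log_one_add {s : ℝ} (hs : 0 ≤ s) : s - s ^ 2 ≤ Real.log (1 + s) := by
  have h := Real.one_sub_inv_le_log_of_pos (show 0 < 1 + s by linarith)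
  refine le_trans ?_ h
  have : 1 - (1 + s)⁻¹ = s / (1 + s) := by field_simp; ring
  rw [this, le_div_iff₀ (by linarith)]
  nlinarith [pow_nonneg hs 3]

lemma le_log_one_sub {s : ℝ} (hs' : s ≤ 1 / 2) :
    -s - 2 * s ^ 2 ≤ Real.log (1 - s) := by
  have h := Real.one_sub_inv_le_log_of_pos (show 0 < 1 - s by linarith)
  refine le_trans ?_ h
  have : 1 - (1 - s)⁻¹ = -s / (1 - s) := by
    have : (1 - s) ≠ 0 := by linarith
    field_simp; ring
  rw [this, le_div_iff₀ (by linarith)]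
  nlinarith [mul_nonneg (sq_nonneg s) (show 0 ≤ 1 - 2 * s by linarith)]

/-- A Pinsker-type lower bound for the Kullback–Leibler divergence. -/
lemma ofReal_sq_le_klDiv {α : Type*} [MeasurableSpace α] (μ ν : Measure α)
    [IsProbabilityMeasure μ] [IsProbabilityMeasure ν] {A : Set α} (hA : MeasurableSet A) {d : ℝ}
    (hd : 0 ≤ d) (h : d ≤ μ.real A - ν.real A) :
    ENNReal.ofReal (d ^ 2 / 2) ≤ InformationTheory.klDiv μ ν := by
  by_cases htop : InformationTheory.klDiv μ ν = ⊤
  · simp [htop]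
  obtain ⟨hac, hint⟩ := InformationTheory.klDiv_ne_top_iff.1 htop
  refine (ENNReal.ofReal_le_iff_le_toReal htop).2 ?_
  rw [InformationTheory.toReal_klDiv_eq_integral_klFun hac]
  have hint' := (InformationTheory.integrable_klFun_rnDeriv_iff hac).2 hint
  have hf : Integrable (fun x => (μ.rnDeriv ν x).toReal) ν := Measure.integrable_toReal_rnDeriv
  -- The tangent points are `1 + s` on the test set and `1 - s` off it. With `s = d / 2` the linear
  -- terms contribute at least `4 s²` and the quadratic losses at most `2 s²`, which leaves `d² /
  -- 2`.
  obtain ⟨s, rfl⟩ : ∃ s, d = 2 * s := ⟨d / 2, by ring⟩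
  have hd1 : 2 * s ≤ 1 := by
    have := measureReal_le_one (μ := μ) (s := A)
    have := measureReal_nonneg (μ := ν) (s := A)
    linarith
  have hs0 : 0 ≤ s := by linarith
  have hs1 : s ≤ 1 / 2 := by linarith
  have key : ∀ (B : Set α) (u : ℝ), MeasurableSet B → 0 < u →
      μ.real B * Real.log u + ν.real B * (1 - u) ≤
        ∫ x in B, InformationTheory.klFun (μ.rnDeriv ν x).toReal ∂ν := by
    intro B u hB hu
    have e : ∫ x in B, ((μ.rnDeriv ν x).toReal * Real.log u + (1 - u)) ∂ν =
        μ.real B * Real.log u + ν.real B * (1 - u) := by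
      rw [integral_add (hf.integrableOn.mul_const _) (by simp), integral_mul_const,
        Measure.setIntegral_toReal_rnDeriv hac]
      simp
    rw [← e]
    refine setIntegral_mono ((hf.integrableOn.mul_const _).add (by simp))
      hint'.integrableOn fun x => ?_
    exact mul_log_add_le_klFun ENNReal.toReal_nonneg hu
  rw [← integral_add_compl hA hint']
  have h1 := key A (1 + s) hA (by linarith)
  have h2 := key Aᶜ (1 - s) hA.compl (by linarith)
  have eμ : μ.real Aᶜ = 1 - μ.real A := probReal_compl_eq_one_sub hA
  have eν : ν.real Aᶜ = 1 - ν.real A := probReal_compl_eq_one_sub hA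
  rw [eμ, eν] at h2
  have b1 := mul_le_mul_of_nonneg_left (le_log_one_add hs0) (measureReal_nonneg (μ := μ) (s := A))
  have b2 := mul_le_mul_of_nonneg_left (le_log_one_sub hs1)
    (show 0 ≤ 1 - μ.real A by linarith [measureReal_le_one (μ := μ) (s := A)])
  have b3 := mul_le_mul_of_nonneg_left h hs0
  have b4 : 0 ≤ μ.real A * s ^ 2 := mul_nonneg measureReal_nonneg (sq_nonneg _)
  nlinarith

/-- A Pinsker-type lower bound for two laws on `{0, 1}`. -/
lemma sq_le_sum_mul_log {p q : Bool → ℝ} (hp : ∀ b, 0 < p b) (hq : ∀ b, 0 < q b)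
    (hp1 : p true + p false = 1) (hq1 : q true + q false = 1) (k : Bool) {d : ℝ} (hd : 0 ≤ d)
    (h : d ≤ p k - q k) : d ^ 2 / 2 ≤ ∑ b, p b * Real.log (p b / q b) := by
  -- The tangent inequality at `x = p b / q b`, multiplied by `q b`.
  have key : ∀ b u, 0 < u → p b * Real.log u + p b - u * q b ≤ p b * Real.log (p b / q b) := by
    intro b u hu
    have h := mul_log_add_le_klFun (x := p b / q b) (div_pos (hp b) (hq b)).le hu
    rw [InformationTheory.klFun_apply] at h
    have h2 := mul_le_mul_of_nonneg_left h (hq b).le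
    have e : q b * (p b / q b) = p b := by field_simp [(hq b).ne']
    have e1 : q b * (p b / q b * Real.log u + (1 - u)) = p b * Real.log u + q b - q b * u := by
      rw [mul_add, ← mul_assoc, e]; ring
    have e2 : q b * (p b / q b * Real.log (p b / q b) + 1 - p b / q b) =
        p b * Real.log (p b / q b) + q b - p b := by
      rw [mul_sub, mul_add, ← mul_assoc, e]; ring
    rw [e1, e2] at h2
    linarith
  obtain ⟨s, rfl⟩ : ∃ s, d = 2 * s := ⟨d / 2, by ring⟩
  have hsum : ∀ f : Bool → ℝ, ∑ b, f b = f k + f (!k) := by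
    intro f; cases k <;> simp [add_comm]
  have hp1' : p k + p (!k) = 1 := by cases k <;> simp <;> linarith
  have hq1' : q k + q (!k) = 1 := by cases k <;> simp <;> linarith
  have hd1 : 2 * s ≤ 1 := by linarith [hq k, hp (!k)]
  have hs0 : 0 ≤ s := by linarith
  have hs1 : s ≤ 1 / 2 := by linarith
  have h1 := key k (1 + s) (by linarith)
  have h2 := key (!k) (1 - s) (by linarith)
  have b1 := mul_le_mul_of_nonneg_left (le_log_one_add hs0) (hp k).le
  have b2 := mul_le_mul_of_nonneg_left (le_log_one_sub hs1) (hp (!k)).le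
  have b3 := mul_le_mul_of_nonneg_left h hs0
  have b4 : 0 ≤ p k * s ^ 2 := mul_nonneg (hp k).le (sq_nonneg _)
  rw [hsum]
  have e1 : p (!k) = 1 - p k := by linarith
  have e2 : q (!k) = 1 - q k := by linarith
  rw [e1, e2] at h2
  rw [e1] at b2 ⊢
  rw [e2]
  nlinarith

/-! ### Lower density -/

/-- Number of dates of `E` before `n`. -/
def dateCount (E : Set ℕ) (n : ℕ) : ℝ := ∑ t ∈ Finset.range n, E.indicator (fun _ => (1 : ℝ)) t

lemma dateCount_eq_ncard (E : Set ℕ) (n : ℕ) : dateCount E n = ((E ∩ Set.Iio n).ncard : ℝ) := by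
  classical
  have : E ∩ Set.Iio n = ((Finset.range n).filter (· ∈ E) : Finset ℕ) := by
    ext t; simp [and_comm]
  rw [this, Set.ncard_coe_finset, dateCount, Finset.card_filter]
  push_cast
  exact Finset.sum_congr rfl fun t _ => by simp [Set.indicator_apply]

lemma exists_mul_le_dateCount {E : Set ℕ} (hE : 0 < lowerDensity E) :
    ∃ d : ℝ, 0 < d ∧ ∀ᶠ n : ℕ in atTop, d * n ≤ dateCount E n := by
  -- Half the lower density lies strictly below the liminf, hence eventually below the frequencies.
  refine ⟨lowerDensity E / 2, by positivity, ?_⟩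
  have hb : IsBoundedUnder (· ≥ ·) atTop (fun n : ℕ => ((E ∩ Set.Iio n).ncard : ℝ) / n) :=
    isBoundedUnder_of ⟨0, fun n => by positivity⟩
  have := eventually_lt_of_lt_liminf (f := atTop)
    (show lowerDensity E / 2 < liminf (fun n : ℕ => ((E ∩ Set.Iio n).ncard : ℝ) / n) atTop by
      change _ < lowerDensity E; linarith) hb
  filter_upwards [this, eventually_gt_atTop 0] with n hn hn0
  rw [dateCount_eq_ncard]
  have : (0 : ℝ) < n := by exact_mod_cast hn0
  exact ((lt_div_iff₀ this).1 hn).le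

lemma tendsto_dateCount {E : Set ℕ} (hE : 0 < lowerDensity E) :
    Tendsto (dateCount E) atTop atTop := by
  obtain ⟨d, hd, h⟩ := exists_mul_le_dateCount hE
  exact tendsto_atTop_mono' _ h (tendsto_natCast_atTop_atTop.const_mul_atTop hd)

/-! ### The intraclass covariance matrix -/

section Intraclass

variable {N : ℕ} {v : Fin N → ℝ} {tauSq : ℝ}

/-- The solution of `(D + τ² 1 1ᵀ) g = x` given by the Sherman–Morrison formula. -/
def intraclassSolve (v : Fin N → ℝ) (tauSq : ℝ) (x : Fin N → ℝ) : Fin N → ℝ :=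
  fun i => x i / v i - tauSq * (∑ j, x j / v j) / (1 + tauSq * ∑ j, 1 / v j) / v i

lemma intraclass_mulVec (x : Fin N → ℝ) (i : Fin N) :
    (intraclass v tauSq *ᵥ x) i = v i * x i + tauSq * ∑ j, x j := by
  rw [intraclass, Matrix.add_mulVec, Pi.add_apply, Matrix.mulVec_diagonal]
  simp [Matrix.mulVec, dotProduct, Finset.mul_sum]

lemma one_add_mul_sum_pos (hv : ∀ i, 0 < v i) (ht : 0 ≤ tauSq) :
    0 < 1 + tauSq * ∑ j, 1 / v j := by
  have : 0 ≤ ∑ j, 1 / v j := Finset.sum_nonneg fun j _ => (one_div_pos.2 (hv j)).le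
  positivity

lemma intraclass_mulVec_solve (hv : ∀ i, 0 < v i) (ht : 0 ≤ tauSq) (x : Fin N → ℝ) :
    intraclass v tauSq *ᵥ intraclassSolve v tauSq x = x := by
  ext i
  have hp := (one_add_mul_sum_pos hv ht).ne'
  rw [intraclass_mulVec]
  have hs : ∑ j, intraclassSolve v tauSq x j =
      (∑ j, x j / v j) / (1 + tauSq * ∑ j, 1 / v j) := by
    simp only [intraclassSolve, Finset.sum_sub_distrib]
    have : ∀ c : ℝ, ∑ j, c / v j = c * ∑ j, 1 / v j := fun c => by
      rw [Finset.mul_sum]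
      exact Finset.sum_congr rfl fun j _ => (mul_one_div _ _).symm
    rw [this]
    field_simp
    ring
  rw [hs, intraclassSolve]
  have := (hv i).ne'
  field_simp
  ring

lemma intraclass_posDef (hv : ∀ i, 0 < v i) (ht : 0 ≤ tauSq) : (intraclass v tauSq).PosDef := by
  refine (Matrix.PosDef.diagonal hv).add_posSemidef ?_
  have : (Matrix.of fun _ _ => tauSq : Matrix (Fin N) (Fin N) ℝ) =
      tauSq • Matrix.vecMulVec 1 (star 1) := by
    ext i j; simp
  rw [this]
  exact (Matrix.posSemidef_vecMulVec_self_star _).smul ht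

lemma isUnit_det_intraclass (hv : ∀ i, 0 < v i) (ht : 0 ≤ tauSq) :
    IsUnit (intraclass v tauSq).det :=
  (intraclass_posDef hv ht).det_pos.ne'.isUnit

lemma intraclass_inv_mulVec (hv : ∀ i, 0 < v i) (ht : 0 ≤ tauSq) (x : Fin N → ℝ) :
    (intraclass v tauSq)⁻¹ *ᵥ x = intraclassSolve v tauSq x := by
  conv_lhs => rw [← intraclass_mulVec_solve hv ht x]
  rw [Matrix.mulVec_mulVec, Matrix.nonsing_inv_mul _ (isUnit_det_intraclass hv ht),
    Matrix.one_mulVec]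

lemma intraclassSolve_one (hv : ∀ i, 0 < v i) (ht : 0 ≤ tauSq) (i : Fin N) :
    intraclassSolve v tauSq 1 i = 1 / v i / (1 + tauSq * ∑ j, 1 / v j) := by
  have hp := (one_add_mul_sum_pos hv ht).ne'
  simp only [intraclassSolve, Pi.one_apply]
  have := (hv i).ne'
  field_simp
  ring

/-- The common factor rescales all entries of `Σ⁻¹ 1` by one scalar, which the normalisation
removes. What remains is inverse-variance weighting by the idiosyncratic parts, so no weight can be
negative. -/
lemma glsWeight_intraclass (hv : ∀ i, 0 < v i) (ht : 0 ≤ tauSq) (i : Fin N) :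
    glsWeight (intraclass v tauSq) i = 1 / v i / ∑ j, 1 / v j := by
  have hp := (one_add_mul_sum_pos hv ht).ne'
  have hs : 0 < ∑ j, 1 / v j :=
    Finset.sum_pos (fun j _ => one_div_pos.2 (hv j)) ⟨i, Finset.mem_univ i⟩
  rw [glsWeight, intraclass_inv_mulVec hv ht, intraclassSolve_one hv ht, dotProduct]
  simp only [Pi.one_apply, one_mul, intraclassSolve_one hv ht]
  rw [← Finset.sum_div]
  field_simp

lemma glsWeight_pos (hv : ∀ i, 0 < v i) (ht : 0 ≤ tauSq) (i : Fin N) :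
    0 < glsWeight (intraclass v tauSq) i := by
  rw [glsWeight_intraclass hv ht]
  exact div_pos (one_div_pos.2 (hv i))
    (Finset.sum_pos (fun j _ => one_div_pos.2 (hv j)) ⟨i, Finset.mem_univ i⟩)

lemma sum_glsWeight (hN : 0 < N) (hv : ∀ i, 0 < v i) (ht : 0 ≤ tauSq) :
    ∑ i, glsWeight (intraclass v tauSq) i = 1 := by
  have hs : 0 < ∑ j, 1 / v j :=
    Finset.sum_pos (fun j _ => one_div_pos.2 (hv j)) ⟨⟨0, hN⟩, Finset.mem_univ _⟩
  simp only [glsWeight_intraclass hv ht]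
  rw [← Finset.sum_div, div_self hs.ne']

end Intraclass

/-! ### Convergence of martingale transforms of white noise -/

section WhiteNoise

variable {Ω : Type*} {mΩ : MeasurableSpace Ω} {P : Measure Ω}

lemma integral_mul_eq_zero_of_indep {m' : MeasurableSpace Ω} (hm : m' ≤ mΩ) {X Z : Ω → ℝ}
    (hX : Measurable[m'] X) (hZ : Measurable[mΩ] Z)
    (hind : Indep (MeasurableSpace.comap Z inferInstance) m' P) (hZ0 : ∫ ω, Z ω ∂P = 0) :
    ∫ ω, X ω * Z ω ∂P = 0 := by
  have hi : IndepFun X Z P := by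
    rw [IndepFun_iff_Indep]
    exact (indep_of_indep_of_le_right hind hX.comap_le).symm
  rw [hi.integral_fun_mul_eq_mul_integral (hX.mono hm le_rfl).aestronglyMeasurable
    hZ.aestronglyMeasurable, hZ0, mul_zero]

/-- Square-summable transforms of white noise converge almost surely. -/
lemma ae_tendsto_sum_whiteNoise [IsProbabilityMeasure P] {ι : Type*} [Fintype ι] (𝓖 : Filtration ℕ mΩ)
    (A Z : ℕ → ι → Ω → ℝ) {C R : ℝ}
    (hA : ∀ t j, Measurable[𝓖 t] (A t j)) (hAC : ∀ t j ω, |A t j ω| ≤ C)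
    (hZ : ∀ t j, Measurable[𝓖 (t + 1)] (Z t j)) (hZ2 : ∀ t j, MemLp (Z t j) 2 P)
    (hind : ∀ t j, Indep (MeasurableSpace.comap (Z t j) inferInstance) (𝓖 t) P)
    (hind2 : ∀ t j k, Indep (MeasurableSpace.comap (fun ω => Z t j ω * Z t k ω) inferInstance)
      (𝓖 t) P)
    (hZ0 : ∀ t j, ∫ ω, Z t j ω ∂P = 0)
    (hZZ : ∀ t j k, j ≠ k → ∫ ω, Z t j ω * Z t k ω ∂P = 0)
    (hZZ1 : ∀ t j, ∫ ω, Z t j ω * Z t j ω ∂P = 1)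
    (hR : ∀ n ω, ∑ t ∈ Finset.range n, ∑ j, A t j ω ^ 2 ≤ R) :
    ∀ᵐ ω ∂P, ∃ l, Tendsto (fun n => ∑ t ∈ Finset.range n, ∑ j, A t j ω * Z t j ω) atTop (𝓝 l) := by
  set D : ℕ → Ω → ℝ := fun t ω => ∑ j, A t j ω * Z t j ω with hD
  set S : ℕ → Ω → ℝ := fun n ω => ∑ t ∈ Finset.range n, D t ω with hS
  have hle : ∀ t, 𝓖 t ≤ mΩ := 𝓖.le
  have hA' : ∀ t j, Measurable (A t j) := fun t j => (hA t j).mono (hle t) le_rfl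
  have hZ' : ∀ t j, Measurable (Z t j) := fun t j => (hZ t j).mono (hle _) le_rfl
  have hAb : ∀ t j, MemLp (A t j) ⊤ P := fun t j =>
    memLp_top_of_bound (hA' t j).aestronglyMeasurable C (ae_of_all _ fun ω => hAC t j ω)
  have hAZ : ∀ t j, MemLp (fun ω => A t j ω * Z t j ω) 2 P := fun t j =>
    (hZ2 t j).mul (hAb t j)
  have hD2 : ∀ t, MemLp (D t) 2 P := fun t => memLp_finsetSum _ fun j _ => hAZ t j
  have hS2 : ∀ n, MemLp (S n) 2 P := fun n => memLp_finsetSum _ fun t _ => hD2 t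
  have hDm : ∀ t, Measurable[𝓖 (t + 1)] (D t) := fun t =>
    Finset.measurable_fun_sum _ fun j _ =>
      ((hA t j).mono (𝓖.mono (Nat.le_succ t)) le_rfl).mul (hZ t j)
  have hSm : ∀ n, Measurable[𝓖 n] (S n) := fun n =>
    Finset.measurable_fun_sum _ fun t ht =>
      (hDm t).mono (𝓖.mono (Finset.mem_range.1 ht)) le_rfl
  -- Orthogonality of an increment to the square-integrable past serves twice: with the partial sum
  -- it gives Pythagoras for the second moments, and with indicators of past events it gives the
  -- martingale property.
  have orth : ∀ t (X : Ω → ℝ), Measurable[𝓖 t] X → MemLp X 2 P → ∫ ω, X ω * D t ω ∂P = 0 := by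
    intro t X hX hX2
    simp only [hD, Finset.mul_sum]
    rw [integral_finsetSum]
    · refine Finset.sum_eq_zero fun j _ => ?_
      simp only [← mul_assoc]
      exact integral_mul_eq_zero_of_indep (hle t) (hX.mul (hA t j)) (hZ' t j) (hind t j) (hZ0 t j)
    · exact fun j _ => hX2.integrable_mul (hAZ t j)
  have hDD : ∀ t, ∫ ω, D t ω ^ 2 ∂P = ∫ ω, ∑ j, A t j ω ^ 2 ∂P := by
    intro t
    have e : ∀ ω, D t ω ^ 2 = ∑ j, ∑ k, (A t j ω * A t k ω) * (Z t j ω * Z t k ω) := by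
      intro ω
      rw [sq, hD, Finset.sum_mul_sum]
      exact Finset.sum_congr rfl fun j _ => Finset.sum_congr rfl fun k _ => by ring
    have hint : ∀ j k, Integrable (fun ω => (A t j ω * A t k ω) * (Z t j ω * Z t k ω)) P := by
      intro j k
      refine ((hAZ t j).integrable_mul (hAZ t k)).congr (ae_of_all _ fun ω => ?_)
      simp only [Pi.mul_apply]; ring
    have hAA : ∀ j, Integrable (fun ω => A t j ω ^ 2) P := fun j =>
      ((hAb t j).mono_exponent le_top : MemLp _ 2 P).integrable_sq
    simp only [e]
    rw [integral_finsetSum _ fun j _ => integrable_finsetSum _ fun k _ => hint j k,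
      integral_finsetSum _ fun j _ => hAA j]
    refine Finset.sum_congr rfl fun j _ => ?_
    rw [integral_finsetSum _ fun k _ => hint j k, Finset.sum_eq_single j]
    · have hi : IndepFun (fun ω => A t j ω * A t j ω) (fun ω => Z t j ω * Z t j ω) P := by
        rw [IndepFun_iff_Indep]
        exact (indep_of_indep_of_le_right (hind2 t j j) ((hA t j).mul (hA t j)).comap_le).symm
      rw [hi.integral_fun_mul_eq_mul_integral ((hA' t j).mul (hA' t j)).aestronglyMeasurable
        ((hZ' t j).mul (hZ' t j)).aestronglyMeasurable, hZZ1, mul_one]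
      simp only [sq]
    · intro k _ hk
      exact integral_mul_eq_zero_of_indep (hle t) ((hA t j).mul (hA t k))
        ((hZ' t j).mul (hZ' t k)) (hind2 t j k) (hZZ t j k hk.symm)
    · exact fun h => absurd (Finset.mem_univ j) h
  have hAAi : ∀ t, Integrable (fun ω => ∑ j, A t j ω ^ 2) P := fun t =>
    integrable_finsetSum _ fun j _ =>
      ((hAb t j).mono_exponent le_top : MemLp _ 2 P).integrable_sq
  have hSS : ∀ n, ∫ ω, S n ω ^ 2 ∂P = ∫ ω, ∑ t ∈ Finset.range n, ∑ j, A t j ω ^ 2 ∂P := by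
    intro n
    induction n with
    | zero => simp [hS]
    | succ n ih =>
      have e : ∀ ω, S (n + 1) ω ^ 2 = S n ω ^ 2 + 2 * (S n ω * D n ω) + D n ω ^ 2 := by
        intro ω
        simp only [hS, Finset.sum_range_succ]; ring
      have i1 := (hS2 n).integrable_sq
      have i2 : Integrable (fun ω => 2 * (S n ω * D n ω)) P :=
        ((hS2 n).integrable_mul (hD2 n)).const_mul 2
      have i3 := (hD2 n).integrable_sq
      simp only [e]
      have i12 : Integrable (fun ω => S n ω ^ 2 + 2 * (S n ω * D n ω)) P := i1.add i2
      rw [integral_add i12 i3, integral_add i1 i2, integral_const_mul,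
        orth n _ (hSm n) (hS2 n), ih, hDD]
      simp only [Finset.sum_range_succ]
      rw [integral_add (integrable_finsetSum _ fun t _ => hAAi t) (hAAi n)]
      ring
  have hmart : Martingale S 𝓖 P := by
    refine martingale_of_setIntegral_eq_succ (fun n => (hSm n).stronglyMeasurable)
      (fun n => (hS2 n).integrable (by norm_num)) fun n s hs => ?_
    have e : ∀ ω, S (n + 1) ω = S n ω + D n ω := fun ω => by
      simp only [hS, Finset.sum_range_succ]
    simp only [e]
    rw [integral_add ((hS2 n).integrable (by norm_num)).integrableOn
      ((hD2 n).integrable (by norm_num)).integrableOn]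
    have hs' := hle n s hs
    have h0 := orth n (s.indicator fun _ => (1 : ℝ)) (measurable_const.indicator hs)
      ((memLp_const 1).indicator hs')
    have : ∫ ω in s, D n ω ∂P = 0 := by
      rw [← integral_indicator hs', ← h0]
      refine integral_congr_ae (ae_of_all _ fun ω => ?_)
      by_cases h : ω ∈ s <;> simp [h]
    rw [this, add_zero]
  -- Martingale convergence needs only an `L¹` bound, obtained from the second moment through `|x| ≤
  -- 1 + x²`.
  have hbdd : ∀ n, eLpNorm (S n) 1 P ≤ (1 + R).toNNReal := by
    intro n
    rw [eLpNorm_one_eq_lintegral_enorm,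
      ← ofReal_integral_norm_eq_lintegral_enorm ((hS2 n).integrable (by norm_num))]
    refine ENNReal.ofReal_le_ofReal ?_
    have h1 : ∫ ω, ‖S n ω‖ ∂P ≤ ∫ ω, (1 + S n ω ^ 2) ∂P := by
      refine integral_mono ((hS2 n).integrable (by norm_num)).norm
        ((integrable_const 1).add (hS2 n).integrable_sq) fun ω => ?_
      simp only [Real.norm_eq_abs]
      rw [← sq_abs (S n ω)]
      nlinarith [sq_nonneg (|S n ω| - 1), abs_nonneg (S n ω)]
    have h2 : ∫ ω, S n ω ^ 2 ∂P ≤ R := by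
      rw [hSS]
      calc _ ≤ ∫ _, R ∂P := integral_mono (integrable_finsetSum _ fun t _ => hAAi t)
            (integrable_const R) fun ω => hR n ω
        _ = R := by simp
    rw [integral_add (integrable_const 1) (hS2 n).integrable_sq] at h1
    simp only [integral_const, probReal_univ, smul_eq_mul, mul_one] at h1
    linarith
  filter_upwards [hmart.submartingale.ae_tendsto_limitProcess hbdd] with ω hω
  exact ⟨_, hω⟩

/-- Iterated averages with vanishing weight products of a convergent sequence converge to its
limit. -/
lemma tendsto_of_averaging {V x c : ℕ → ℝ} {l : ℝ} (hV : ∀ t, 0 < V t) (hanti : Antitone V)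
    (hV0 : Tendsto V atTop (𝓝 0)) (hc : Tendsto c atTop (𝓝 l))
    (hx : ∀ t, x (t + 1) = V (t + 1) / V t * x t + (1 - V (t + 1) / V t) * c t) :
    Tendsto x atTop (𝓝 l) := by
  rw [Metric.tendsto_atTop]
  intro ε hε
  obtain ⟨T, hT⟩ := Metric.tendsto_atTop.1 hc (ε / 2) (by positivity)
  -- From time `T` on, the averaged inputs are within `ε / 2` of the limit, and the weight left on
  -- `x T` is the telescoping product `V t / V T`.
  have hb : ∀ t ≥ T, |x t - l| ≤ ε / 2 + V t / V T * |x T - l| := by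
    intro t ht
    induction t, ht using Nat.le_induction with
    | base => rw [div_self (hV T).ne']; linarith
    | succ t ht ih =>
      have hq0 : 0 ≤ V (t + 1) / V t := (div_pos (hV _) (hV _)).le
      have hq1 : V (t + 1) / V t ≤ 1 := (div_le_one (hV t)).2 (hanti (Nat.le_succ t))
      have e : x (t + 1) - l =
          V (t + 1) / V t * (x t - l) + (1 - V (t + 1) / V t) * (c t - l) := by
        rw [hx]; ring
      have hcl : |c t - l| ≤ ε / 2 := by
        have := hT t ht; rw [Real.dist_eq] at this; exact this.le
      calc |x (t + 1) - l| ≤ V (t + 1) / V t * |x t - l| + (1 - V (t + 1) / V t) * |c t - l| := by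
            rw [e]
            refine (abs_add_le _ _).trans ?_
            rw [abs_mul, abs_mul, abs_of_nonneg hq0, abs_of_nonneg (sub_nonneg.2 hq1)]
        _ ≤ V (t + 1) / V t * (ε / 2 + V t / V T * |x T - l|)
            + (1 - V (t + 1) / V t) * (ε / 2) := by
          have := sub_nonneg.2 hq1
          gcongr
        _ = ε / 2 + V (t + 1) / V T * |x T - l| := by
          have := (hV t).ne'
          field_simp
          ring
  have hlim : Tendsto (fun t => V t / V T * |x T - l|) atTop (𝓝 0) := by
    simpa using (hV0.div_const (V T)).mul_const |x T - l|
  obtain ⟨T', hT'⟩ := Metric.tendsto_atTop.1 hlim (ε / 2) (by positivity)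
  refine ⟨max T T', fun n hn => ?_⟩
  have h1 := hb n (le_trans (le_max_left _ _) hn)
  have h2 := hT' n (le_trans (le_max_right _ _) hn)
  rw [Real.dist_eq, sub_zero] at h2
  rw [Real.dist_eq]
  linarith [le_abs_self (V n / V T * |x T - l|)]

end WhiteNoise

/-! ### Bounds for the intraclass covariance matrix -/

section IntraclassBounds

variable {N : ℕ} {v : Fin N → ℝ} {tauSq : ℝ}

/-- With `g = Σ⁻¹ x` one has `xᵀ g = gᵀ Σ g`. Split into idiosyncratic and common parts, this is
also the variance of the noise filtered through `g`, the form needed for the filter error. -/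
lemma dotProduct_intraclassSolve (hv : ∀ i, 0 < v i) (ht : 0 ≤ tauSq) (x : Fin N → ℝ) :
    x ⬝ᵥ intraclassSolve v tauSq x = ∑ i, v i * intraclassSolve v tauSq x i ^ 2 +
      tauSq * (∑ i, intraclassSolve v tauSq x i) ^ 2 := by
  set g := intraclassSolve v tauSq x with hg
  have hx : ∀ i, x i = v i * g i + tauSq * ∑ j, g j := fun i => by
    rw [← intraclass_mulVec, hg, intraclass_mulVec_solve hv ht]
  rw [dotProduct]
  calc ∑ i, x i * g i = ∑ i, (v i * g i ^ 2 + (tauSq * ∑ j, g j) * g i) :=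
        Finset.sum_congr rfl fun i _ => by rw [hx i]; ring
    _ = _ := by rw [Finset.sum_add_distrib, ← Finset.mul_sum]; ring

lemma dotProduct_intraclassSolve_nonneg (hv : ∀ i, 0 < v i) (ht : 0 ≤ tauSq) (x : Fin N → ℝ) :
    0 ≤ x ⬝ᵥ intraclassSolve v tauSq x := by
  rw [dotProduct_intraclassSolve hv ht]
  exact add_nonneg (Finset.sum_nonneg fun i _ => mul_nonneg (hv i).le (sq_nonneg _))
    (mul_nonneg ht (sq_nonneg _))

/-- A single pair of experts suffices: its correlation is at least `τ² / (b + τ²)`, so a bound below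
one prevents the common variance from dominating. -/
lemma tauSq_le_of_corrLE (hN : 2 ≤ N) (hv : ∀ i, 0 < v i) (ht : 0 ≤ tauSq) {r b : ℝ} (hr : r < 1)
    (hvb : ∀ i, v i ≤ b) (h : CorrLE (intraclass v tauSq) r) : tauSq ≤ b / (1 - r) := by
  have hij : (⟨0, by omega⟩ : Fin N) ≠ ⟨1, by omega⟩ := by simp
  have h := h _ _ hij
  set i : Fin N := ⟨0, by omega⟩
  set j : Fin N := ⟨1, by omega⟩
  have eij : intraclass v tauSq i j = tauSq := by simp [intraclass, Matrix.diagonal_apply_ne _ hij]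
  have eii : ∀ k, intraclass v tauSq k k = v k + tauSq := fun k => by simp [intraclass]
  rw [eij, eii, eii] at h
  have hb : 0 < b := (hv i).trans_le (hvb i)
  have hle : √(v i + tauSq) * √(v j + tauSq) ≤ b + tauSq := by
    calc √(v i + tauSq) * √(v j + tauSq) ≤ √(b + tauSq) * √(b + tauSq) := by
          gcongr <;> exact hvb _
      _ = b + tauSq := Real.mul_self_sqrt (by linarith)
  have hpos : 0 < √(v i + tauSq) * √(v j + tauSq) :=
    mul_pos (Real.sqrt_pos.2 (by linarith [hv i])) (Real.sqrt_pos.2 (by linarith [hv j]))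
  have hr0 : 0 ≤ r := (div_nonneg ht hpos.le).trans h
  rw [div_le_iff₀ hpos] at h
  have h2 := h.trans (mul_le_mul_of_nonneg_left hle hr0)
  rw [le_div_iff₀ (by linarith)]
  nlinarith

lemma sq_sum_le_card_mul (x : Fin N → ℝ) : (∑ i, x i) ^ 2 ≤ N * ∑ i, x i ^ 2 := by
  simpa using sq_sum_le_card_mul_sum_sq (s := Finset.univ) (f := x)

/-- By Cauchy–Schwarz on the common part, `Σ ≼ K I` with `K = b + N T`, and inversion reverses the
order. Inversion is carried out by expanding a square rather than by spectral theory. -/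
lemma le_dotProduct_intraclassSolve (hv : ∀ i, 0 < v i) (ht : 0 ≤ tauSq) {b T : ℝ} (hb : 0 < b)
    (hvb : ∀ i, v i ≤ b) (hT : tauSq ≤ T) (x : Fin N → ℝ) :
    (b + N * T)⁻¹ * ∑ i, x i ^ 2 ≤ x ⬝ᵥ intraclassSolve v tauSq x := by
  set g := intraclassSolve v tauSq x with hg
  set K := b + N * T with hK
  have hKpos : 0 < K := by
    have : 0 ≤ T := ht.trans hT
    positivity
  have hx : ∀ i, x i = v i * g i + tauSq * ∑ j, g j := fun i => by
    rw [← intraclass_mulVec, hg, intraclass_mulVec_solve hv ht]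
  have e1 : ∑ i, g i * x i = ∑ i, v i * g i ^ 2 + tauSq * (∑ i, g i) ^ 2 := by
    rw [hg, ← dotProduct_intraclassSolve hv ht, dotProduct_comm, dotProduct]
  -- the quadratic form of the covariance at `g - x / K` is nonnegative
  have h0 : 0 ≤ ∑ i, v i * (g i - x i / K) ^ 2 + tauSq * (∑ i, (g i - x i / K)) ^ 2 :=
    add_nonneg (Finset.sum_nonneg fun i _ => mul_nonneg (hv i).le (sq_nonneg _))
      (mul_nonneg ht (sq_nonneg _))
  have e2 : ∑ i, v i * (g i - x i / K) ^ 2 + tauSq * (∑ i, (g i - x i / K)) ^ 2 =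
      (∑ i, v i * g i ^ 2 + tauSq * (∑ i, g i) ^ 2) - 2 / K * ∑ i, x i ^ 2 +
        (1 / K) ^ 2 * (∑ i, v i * x i ^ 2 + tauSq * (∑ i, x i) ^ 2) := by
    have a1 : ∑ i, v i * (g i - x i / K) ^ 2 = ∑ i, v i * g i ^ 2 - 2 / K * ∑ i, v i * g i * x i
        + (1 / K) ^ 2 * ∑ i, v i * x i ^ 2 := by
      rw [Finset.mul_sum, Finset.mul_sum, ← Finset.sum_sub_distrib, ← Finset.sum_add_distrib]
      exact Finset.sum_congr rfl fun i _ => by ring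
    have a2 : ∑ i, (g i - x i / K) = ∑ i, g i - 1 / K * ∑ i, x i := by
      rw [Finset.mul_sum, ← Finset.sum_sub_distrib]
      exact Finset.sum_congr rfl fun i _ => by ring
    have a3 : ∑ i, x i ^ 2 = ∑ i, v i * g i * x i + tauSq * (∑ i, g i) * ∑ i, x i := by
      rw [Finset.mul_sum, ← Finset.sum_add_distrib]
      refine Finset.sum_congr rfl fun i _ => ?_
      rw [sq]; nth_rewrite 1 [hx i]; ring
    rw [a1, a2, a3]; ring
  have h1 : ∑ i, v i * x i ^ 2 + tauSq * (∑ i, x i) ^ 2 ≤ K * ∑ i, x i ^ 2 := by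
    have b1 : ∑ i, v i * x i ^ 2 ≤ b * ∑ i, x i ^ 2 := by
      rw [Finset.mul_sum]
      exact Finset.sum_le_sum fun i _ => mul_le_mul_of_nonneg_right (hvb i) (sq_nonneg _)
    have b2 : tauSq * (∑ i, x i) ^ 2 ≤ T * (N * ∑ i, x i ^ 2) :=
      mul_le_mul hT (sq_sum_le_card_mul x) (sq_nonneg _) (ht.trans hT)
    rw [hK]; linarith
  have h2 : (1 / K) ^ 2 * (∑ i, v i * x i ^ 2 + tauSq * (∑ i, x i) ^ 2) ≤ 1 / K * ∑ i, x i ^ 2 := by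
    calc _ ≤ (1 / K) ^ 2 * (K * ∑ i, x i ^ 2) := by gcongr
      _ = _ := by field_simp
  rw [e2] at h0
  rw [dotProduct_comm, dotProduct, e1]
  have e3 : 2 / K * ∑ i, x i ^ 2 = 2 * (K⁻¹ * ∑ i, x i ^ 2) := by ring
  have e4 : 1 / K * ∑ i, x i ^ 2 = K⁻¹ * ∑ i, x i ^ 2 := by ring
  rw [e3] at h0
  rw [e4] at h2
  linarith

end IntraclassBounds

/-! ### The Gaussian model -/

namespace GaussianPanel

variable {N : ℕ} {Ω : Type*} {mΩ : MeasurableSpace Ω} {P : Measure Ω}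
  {𝓖 : Filtration ℕ mΩ} {G : GaussianPanel N Ω} {pL pH rhoC : ℝ}
  {S : ℝ → Measure ℝ → ℝ → ℝ} {E : Set ℕ}

lemma tiltLaw_mem {pL m θ a : ℝ} (hL : 0 < pL) (ha : 0 < a) : tiltLaw pL m θ a ∈ gaussianLaws := by
  refine ⟨_, _, ?_, rfl⟩
  simp only [ne_eq, Real.toNNReal_eq_zero, not_le]
  positivity

/-- Tilt `1` induces exactly the law of the signal, so strict propriety makes it beat any tilt
inducing another law. Tilts in `(0, 1]` are told apart by the variance `a² / pL` alone, whatever the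
public mean. -/
lemma Assumptions.tilt_eq_one (h : G.Assumptions P 𝓖 pL pH rhoC S E) (hL : 0 < pL) {t : ℕ}
    (ht : t ∈ E) (ω : Ω) : G.a t ω = 1 := by
  by_contra hne
  obtain ⟨ha0, ha1⟩ := h.a_mem t ω
  have e : tiltLaw pL (G.m t ω) 0 1 = gaussianReal 0 (1 / pL).toNNReal := by
    simp [tiltLaw]
  -- One state is enough for the comparison; `0` is an arbitrary choice.
  have hopt := h.optimal t ht ω 1 ⟨one_pos, le_rfl⟩ 0
  have hlt := (h.proper 0 _ (tiltLaw_mem (m := G.m t ω) (θ := 0) hL one_pos) _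
    (tiltLaw_mem (m := G.m t ω) (θ := 0) hL ha0)).2 ?_
  · rw [e] at hlt hopt
    exact absurd hopt (not_le.2 hlt)
  · intro heq
    have hv := (gaussianReal_ext_iff.1 heq).2
    have h1 : G.a t ω ^ 2 / pL = 1 ^ 2 / pL := by
      rwa [Real.toNNReal_eq_toNNReal_iff (by positivity) (by positivity)] at hv
    have h2 : G.a t ω ^ 2 = 1 := by
      rw [div_left_inj' hL.ne'] at h1; simpa using h1
    exact hne (by nlinarith)

lemma Assumptions.loading_eq_one (h : G.Assumptions P 𝓖 pL pH rhoC S E) (hL : 0 < pL) {t : ℕ}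
    (ht : t ∈ E) (ω : Ω) : G.loading t ω = 1 := by
  ext i
  simp [loading, h.tilt_eq_one hL ht ω]

lemma Assumptions.v_le_two (h : G.Assumptions P 𝓖 pL pH rhoC S E) (hL : 1 / 2 ≤ pL)
    (hLH : pL < pH) (t : ℕ) (ω : Ω) (i : Fin N) : G.v t ω i ≤ 2 := by
  refine (h.v_le t ω i).trans ?_
  obtain ⟨hr0, hr1⟩ := h.rep_mem t ω i
  obtain ⟨ha0, ha1⟩ := h.a_mem t ω
  have h1 : 1 / pH ≤ 2 := by rw [div_le_iff₀ (by linarith)]; linarith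
  have h2 : G.a t ω ^ 2 / pL ≤ 2 := by rw [div_le_iff₀ (by linarith)]; nlinarith
  rw [effVar]
  nlinarith [mul_le_mul_of_nonneg_left h1 hr0, mul_le_mul_of_nonneg_left h2 (sub_nonneg.2 hr1)]

/-- Uniform lower bound for the information of a scored round. -/
def infoBound (N : ℕ) (r : ℝ) : ℝ := (2 + N * (2 / (1 - r)))⁻¹

lemma infoBound_pos (N : ℕ) {r : ℝ} (hr : r < 1) : 0 < infoBound N r := by
  have : 0 < 1 - r := by linarith
  rw [infoBound]; positivity

lemma Assumptions.infoBound_le (h : G.Assumptions P 𝓖 pL pH rhoC S E) (hL : 1 / 2 ≤ pL)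
    (hLH : pL < pH) (hN : 2 ≤ N) (hr : rhoC < 1) (t : ℕ) (ω : Ω) (x : Fin N → ℝ) :
    infoBound N rhoC * ∑ i, x i ^ 2 ≤ x ⬝ᵥ ((G.noiseCov t ω)⁻¹ *ᵥ x) := by
  rw [noiseCov, intraclass_inv_mulVec (h.v_pos t ω) (h.tauSq_nonneg t ω)]
  exact le_dotProduct_intraclassSolve (h.v_pos t ω) (h.tauSq_nonneg t ω) two_pos
    (h.v_le_two hL hLH t ω)
    (tauSq_le_of_corrLE hN (h.v_pos t ω) (h.tauSq_nonneg t ω) hr (h.v_le_two hL hLH t ω)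
      (h.corr_le t ω)) x

lemma Assumptions.le_info (h : G.Assumptions P 𝓖 pL pH rhoC S E) (hL : 1 / 2 ≤ pL)
    (hLH : pL < pH) (hN : 2 ≤ N) (hr : rhoC < 1) {t : ℕ} (ht : t ∈ E) (ω : Ω) :
    infoBound N rhoC ≤ G.info t ω := by
  have h1 := h.infoBound_le hL hLH hN hr t ω (G.loading t ω)
  refine le_trans ?_ h1
  rw [h.loading_eq_one (by linarith) ht]
  have : (1 : ℝ) ≤ N := by exact_mod_cast (by omega : 1 ≤ N)
  have := infoBound_pos N hr
  simp only [Pi.one_apply, one_pow, Finset.sum_const, Finset.card_univ, Fintype.card_fin,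
    nsmul_eq_mul, mul_one]
  nlinarith

lemma Assumptions.posSemidef_info (h : G.Assumptions P 𝓖 pL pH rhoC S E) (hL : 1 / 2 ≤ pL)
    (hLH : pL < pH) (hN : 2 ≤ N) (hr : rhoC < 1) {t : ℕ} (ht : t ∈ E) (ω : Ω) :
    ((Matrix.diagonal (G.loading t ω))ᵀ * (G.noiseCov t ω)⁻¹ * Matrix.diagonal (G.loading t ω) -
      infoBound N rhoC • (1 : Matrix (Fin N) (Fin N) ℝ)).PosSemidef := by
  rw [h.loading_eq_one (by linarith) ht]
  have e1 : Matrix.diagonal (1 : Fin N → ℝ) = 1 := Matrix.diagonal_one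
  rw [e1, Matrix.transpose_one, one_mul, mul_one]
  refine .of_dotProduct_mulVec_nonneg ?_ fun x => ?_
  · refine Matrix.IsHermitian.sub
      (intraclass_posDef (h.v_pos t ω) (h.tauSq_nonneg t ω)).inv.isHermitian ?_
    rw [Matrix.IsHermitian, Matrix.conjTranspose_smul]
    simp
  · rw [Matrix.sub_mulVec, dotProduct_sub, Matrix.smul_mulVec, Matrix.one_mulVec, dotProduct_smul]
    have h1 := h.infoBound_le hL hLH hN hr t ω x
    have e : star x = x := by ext i; simp
    have e2 : x ⬝ᵥ x = ∑ i, x i ^ 2 := by simp [dotProduct, sq]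
    rw [e, e2, smul_eq_mul]
    linarith

lemma Assumptions.info_nonneg (h : G.Assumptions P 𝓖 pL pH rhoC S E) (t : ℕ) (ω : Ω) :
    0 ≤ G.info t ω := by
  rw [info, noiseCov, intraclass_inv_mulVec (h.v_pos t ω) (h.tauSq_nonneg t ω)]
  exact dotProduct_intraclassSolve_nonneg (h.v_pos t ω) (h.tauSq_nonneg t ω) _

lemma Assumptions.V_pos (h : G.Assumptions P 𝓖 pL pH rhoC S E) (t : ℕ) (ω : Ω) :
    0 < G.V t ω := by
  induction t with
  | zero => exact h.V0_pos
  | succ t ih =>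
    rw [V]
    have := h.info_nonneg t ω
    positivity

lemma inv_V_succ (G : GaussianPanel N Ω) (t : ℕ) (ω : Ω) :
    (G.V (t + 1) ω)⁻¹ = (G.V t ω)⁻¹ + G.info t ω := by
  rw [V, inv_inv]

lemma Assumptions.antitone_V (h : G.Assumptions P 𝓖 pL pH rhoC S E) (ω : Ω) :
    Antitone fun t => G.V t ω := by
  refine antitone_nat_of_succ_le fun t => ?_
  rw [← inv_le_inv₀ (h.V_pos t ω) (h.V_pos (t + 1) ω), G.inv_V_succ]
  linarith [h.info_nonneg t ω]

/-- The precision `V⁻¹` never decreases and grows by a fixed amount on each evaluation date; there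
are infinitely many of these. -/
lemma Assumptions.tendsto_V (h : G.Assumptions P 𝓖 pL pH rhoC S E) (hL : 1 / 2 ≤ pL)
    (hLH : pL < pH) (hN : 2 ≤ N) (hr : rhoC < 1) (ω : Ω) :
    Tendsto (fun t => G.V t ω) atTop (𝓝 0) := by
  have hb : ∀ t, infoBound N rhoC * dateCount E t ≤ (G.V t ω)⁻¹ := by
    intro t
    induction t with
    | zero => simpa [dateCount] using (h.V_pos 0 ω).le
    | succ t ih =>
      rw [G.inv_V_succ, dateCount, Finset.sum_range_succ, mul_add]
      refine add_le_add ih ?_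
      by_cases ht : t ∈ E
      · simpa [ht] using h.le_info hL hLH hN hr ht ω
      · simpa [ht] using h.info_nonneg t ω
  have h1 : Tendsto (fun t => (G.V t ω)⁻¹) atTop atTop :=
    tendsto_atTop_mono hb ((tendsto_dateCount h.density).const_mul_atTop (infoBound_pos N hr))
  exact h1.inv_tendsto_atTop.congr fun t => inv_inv _

end GaussianPanel

/-! ### Standardised shocks, the filter error and consistency of the filter mean -/

namespace GaussianPanel

/-- Coordinate of a shock vector: the common factor or the idiosyncratic noise of an expert. -/
def shockCoord {N : ℕ} : Option (Fin N) → ℝ × (Fin N → ℝ) → ℝ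
  | none, z => z.1
  | some i, z => z.2 i

/-- Law of a shock vector. -/
abbrev shockLaw (N : ℕ) : Measure (ℝ × (Fin N → ℝ)) :=
  (gaussianReal 0 1).prod (Measure.pi fun _ => gaussianReal 0 1)

lemma measurable_shockCoord {N : ℕ} (j : Option (Fin N)) : Measurable (shockCoord j) := by
  cases j with
  | none => exact measurable_fst
  | some i => exact (measurable_pi_apply i).comp measurable_snd

lemma measurePreserving_shockCoord {N : ℕ} (j : Option (Fin N)) :
    MeasurePreserving (shockCoord j) (shockLaw N) (gaussianReal 0 1) := by
  cases j with
  | none => exact measurePreserving_fst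
  | some i =>
    exact (measurePreserving_eval (fun _ : Fin N => gaussianReal 0 1) i).comp
      measurePreserving_snd

lemma integral_shockCoord {N : ℕ} (j : Option (Fin N)) :
    ∫ z, shockCoord j z ∂shockLaw N = 0 := by
  have h := integral_map (measurable_shockCoord j).aemeasurable (μ := shockLaw N)
    (f := fun x : ℝ => x) (by fun_prop)
  rw [(measurePreserving_shockCoord j).map_eq, integral_id_gaussianReal] at h
  exact h.symm

lemma integral_shockCoord_mul_self {N : ℕ} (j : Option (Fin N)) :
    ∫ z, shockCoord j z * shockCoord j z ∂shockLaw N = 1 := by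
  have h := integral_map (measurable_shockCoord j).aemeasurable (μ := shockLaw N)
    (f := fun x : ℝ => x * x) (by fun_prop)
  rw [(measurePreserving_shockCoord j).map_eq] at h
  rw [← h]
  have hv := variance_fun_id_gaussianReal (μ := 0) (v := 1)
  rw [variance_of_integral_eq_zero aemeasurable_id' integral_id_gaussianReal] at hv
  simpa [sq] using hv

lemma integral_shockCoord_mul {N : ℕ} {j k : Option (Fin N)} (hjk : j ≠ k) :
    ∫ z, shockCoord j z * shockCoord k z ∂shockLaw N = 0 := by
  have hfst : ∀ i : Fin N, ∫ z, z.1 * z.2 i ∂shockLaw N = 0 := by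
    intro i
    rw [integral_prod_mul (f := fun x : ℝ => x) (g := fun z : Fin N → ℝ => z i),
      integral_id_gaussianReal, zero_mul]
  match j, k with
  | none, none => exact absurd rfl hjk
  | none, some i => exact hfst i
  | some i, none =>
    simp only [shockCoord, mul_comm]
    exact hfst i
  | some i, some l =>
    have hil : i ≠ l := fun h => hjk (by rw [h])
    have hind : IndepFun (fun z : ℝ × (Fin N → ℝ) => shockCoord (some i) z)
        (fun z => shockCoord (some l) z) (shockLaw N) := by
      have h1 := (iIndepFun_pi (μ := fun _ : Fin N => gaussianReal 0 1)
        (X := fun _ x => x) fun _ => aemeasurable_id').indepFun hil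
      have h2 : IndepFun (fun z : Fin N → ℝ => z i) (fun z => z l)
          (Measure.map Prod.snd (shockLaw N)) := by
        rw [(measurePreserving_snd (μ := gaussianReal 0 1)
          (ν := Measure.pi fun _ : Fin N => gaussianReal 0 1)).map_eq]
        exact h1
      rw [indepFun_iff_measure_inter_preimage_eq_mul] at h2 ⊢
      intro s t hs ht
      have h3 := h2 s t hs ht
      rw [Measure.map_apply measurable_snd (((measurable_pi_apply i) hs).inter
        ((measurable_pi_apply l) ht)), Measure.map_apply measurable_snd ((measurable_pi_apply i) hs),
        Measure.map_apply measurable_snd ((measurable_pi_apply l) ht)] at h3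
      exact h3
    rw [hind.integral_fun_mul_eq_mul_integral (measurable_shockCoord _).aestronglyMeasurable
      (measurable_shockCoord _).aestronglyMeasurable, integral_shockCoord, zero_mul]

variable {N : ℕ} {Ω : Type*} {mΩ : MeasurableSpace Ω} {P : Measure Ω}
  {𝓖 : Filtration ℕ mΩ} {G : GaussianPanel N Ω} {pL pH rhoC : ℝ}
  {S : ℝ → Measure ℝ → ℝ → ℝ} {E : Set ℕ}

/-- The vector `Σ_t⁻¹ h_t`. -/
def gain (G : GaussianPanel N Ω) (t : ℕ) (ω : Ω) : Fin N → ℝ :=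
  intraclassSolve (G.v t ω) (G.tauSq t ω) (G.loading t ω)

/-- Coefficients of the standardised shocks in the filter error. -/
def errorCoeff (G : GaussianPanel N Ω) (t : ℕ) : Option (Fin N) → Ω → ℝ
  | none, ω => G.V (t + 1) ω * (√(G.tauSq t ω) * ∑ i, G.gain t ω i)
  | some i, ω => G.V (t + 1) ω * (√(G.v t ω i) * G.gain t ω i)

/-- The standardised shocks. -/
def shock (G : GaussianPanel N Ω) (t : ℕ) (j : Option (Fin N)) (ω : Ω) : ℝ :=
  shockCoord j (G.common t ω, G.idio t ω)

lemma Assumptions.info_eq (h : G.Assumptions P 𝓖 pL pH rhoC S E) (t : ℕ) (ω : Ω) :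
    G.info t ω = G.loading t ω ⬝ᵥ G.gain t ω := by
  rw [info, noiseCov, intraclass_inv_mulVec (h.v_pos t ω) (h.tauSq_nonneg t ω), gain]

lemma Assumptions.measurable_loading (h : G.Assumptions P 𝓖 pL pH rhoC S E) (t : ℕ) (i : Fin N) :
    Measurable[𝓖 t] fun ω => G.loading t ω i := by
  have hr : Measurable[𝓖 t] fun ω => G.rep t ω i := (measurable_pi_apply i).comp (h.rep_measurable t)
  exact hr.add ((measurable_const.sub hr).mul (h.a_measurable t))

/-- The Sherman–Morrison form of the gain reduces measurability of a matrix inverse to sums and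
quotients. -/
lemma Assumptions.measurable_gain (h : G.Assumptions P 𝓖 pL pH rhoC S E) (t : ℕ) (i : Fin N) :
    Measurable[𝓖 t] fun ω => G.gain t ω i := by
  have hv : ∀ j, Measurable[𝓖 t] fun ω => G.v t ω j := fun j =>
    (measurable_pi_apply j).comp (h.v_measurable t)
  have hl := h.measurable_loading t
  have ht := h.tauSq_measurable t
  have h1 : Measurable[𝓖 t] fun ω => ∑ j, G.loading t ω j / G.v t ω j :=
    Finset.measurable_fun_sum _ fun j _ => (hl j).div (hv j)
  have h2 : Measurable[𝓖 t] fun ω => ∑ j, 1 / G.v t ω j :=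
    Finset.measurable_fun_sum _ fun j _ => measurable_const.div (hv j)
  exact ((hl i).div (hv i)).sub
    (((ht.mul h1).div (measurable_const.add (ht.mul h2))).div (hv i))

lemma Assumptions.measurable_info (h : G.Assumptions P 𝓖 pL pH rhoC S E) (t : ℕ) :
    Measurable[𝓖 t] (G.info t) := by
  have e : G.info t = fun ω => ∑ i, G.loading t ω i * G.gain t ω i := funext fun ω => h.info_eq t ω
  rw [e]
  exact Finset.measurable_fun_sum _ fun i _ => (h.measurable_loading t i).mul (h.measurable_gain t i)

/-- The next variance is already known at date `t`, since it does not involve the reports. This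
makes the coefficients of the shocks predictable. -/
lemma Assumptions.measurable_V (h : G.Assumptions P 𝓖 pL pH rhoC S E) (t : ℕ) :
    Measurable[𝓖 t] (G.V t) ∧ Measurable[𝓖 t] (G.V (t + 1)) := by
  have step : ∀ t, Measurable[𝓖 t] (G.V t) → Measurable[𝓖 t] (G.V (t + 1)) := fun t ht =>
    (ht.inv.add (h.measurable_info t)).inv
  induction t with
  | zero => exact ⟨measurable_const, step 0 measurable_const⟩
  | succ t ih =>
    have := ih.2.mono (𝓖.mono (Nat.le_succ t)) le_rfl
    exact ⟨this, step _ this⟩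

lemma Assumptions.measurable_errorCoeff (h : G.Assumptions P 𝓖 pL pH rhoC S E) (t : ℕ)
    (j : Option (Fin N)) : Measurable[𝓖 t] (G.errorCoeff t j) := by
  cases j with
  | none =>
    exact (h.measurable_V t).2.mul ((h.tauSq_measurable t).sqrt.mul
      (Finset.measurable_fun_sum _ fun i _ => h.measurable_gain t i))
  | some i =>
    have hv : Measurable[𝓖 t] fun ω => G.v t ω i :=
      (measurable_pi_apply i).comp (h.v_measurable t)
    exact (h.measurable_V t).2.mul (hv.sqrt.mul (h.measurable_gain t i))

lemma Assumptions.V_succ_mul_info (h : G.Assumptions P 𝓖 pL pH rhoC S E) (t : ℕ) (ω : Ω) :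
    G.V (t + 1) ω * G.info t ω = 1 - G.V (t + 1) ω / G.V t ω := by
  have h1 := G.inv_V_succ t ω
  have e : G.info t ω = (G.V (t + 1) ω)⁻¹ - (G.V t ω)⁻¹ := by linarith
  rw [e, mul_sub, mul_inv_cancel₀ (h.V_pos _ ω).ne', div_eq_mul_inv]

/-- The sum of squares equals `V (t + 1)² * info t = (V (t + 1) / V t) * (V t - V (t + 1))`. The
bound telescopes over dates, so the noise entering the filter has total variance at most `V0`. -/
lemma Assumptions.sum_errorCoeff_sq (h : G.Assumptions P 𝓖 pL pH rhoC S E) (t : ℕ) (ω : Ω) :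
    ∑ j, G.errorCoeff t j ω ^ 2 ≤ G.V t ω - G.V (t + 1) ω := by
  have e : ∑ j, G.errorCoeff t j ω ^ 2 = G.V (t + 1) ω * (G.V (t + 1) ω * G.info t ω) := by
    rw [h.info_eq, gain, dotProduct_intraclassSolve (h.v_pos t ω) (h.tauSq_nonneg t ω),
      Fintype.sum_option]
    simp only [errorCoeff, mul_pow, Real.sq_sqrt (h.tauSq_nonneg t ω),
      Real.sq_sqrt (h.v_pos t ω _).le, ← Finset.mul_sum, gain]
    ring
  have hV := h.V_pos t ω
  have hV' := h.V_pos (t + 1) ω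
  have hle := h.antitone_V ω (Nat.le_succ t)
  rw [e, h.V_succ_mul_info]
  have e2 : G.V (t + 1) ω * (1 - G.V (t + 1) ω / G.V t ω) =
      G.V (t + 1) ω / G.V t ω * (G.V t ω - G.V (t + 1) ω) := by field_simp
  rw [e2]
  exact mul_le_of_le_one_left (sub_nonneg.2 hle) ((div_le_one hV).2 hle)

lemma Assumptions.sum_sum_errorCoeff_sq (h : G.Assumptions P 𝓖 pL pH rhoC S E) (n : ℕ) (ω : Ω) :
    ∑ t ∈ Finset.range n, ∑ j, G.errorCoeff t j ω ^ 2 ≤ G.V0 := by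
  have h1 : ∑ t ∈ Finset.range n, ∑ j, G.errorCoeff t j ω ^ 2 ≤ G.V 0 ω - G.V n ω := by
    rw [← Finset.sum_range_sub' (fun t => G.V t ω)]
    exact Finset.sum_le_sum fun t _ => h.sum_errorCoeff_sq t ω
  exact h1.trans (by linarith [h.V_pos n ω, show G.V 0 ω = G.V0 from rfl])

/-- The intercept built into the reports is the one the filter subtracts, so the innovation is `(θ -
m) h + ε`. Its signal part contracts the error by `1 - V (t + 1) * info t = V (t + 1) / V t`. -/
lemma Assumptions.error_succ (h : G.Assumptions P 𝓖 pL pH rhoC S E) (t : ℕ) (ω : Ω) :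
    G.m (t + 1) ω - G.state ω = G.V (t + 1) ω / G.V t ω * (G.m t ω - G.state ω) +
      ∑ j, G.errorCoeff t j ω * G.shock t j ω := by
  set ε : Fin N → ℝ := fun i => √(G.v t ω i) * G.idio t ω i + √(G.tauSq t ω) * G.common t ω with hε
  have hy : G.y t ω - G.intercept t ω (G.m t ω) - G.m t ω • G.loading t ω =
      (G.state ω - G.m t ω) • G.loading t ω + ε := by
    ext i
    simp only [Pi.sub_apply, Pi.add_apply, Pi.smul_apply, smul_eq_mul, h.observation t ω i, hε]
    ring
  have hsymm : (G.noiseCov t ω)⁻¹ᵀ = (G.noiseCov t ω)⁻¹ := by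
    have := (intraclass_posDef (h.v_pos t ω) (h.tauSq_nonneg t ω)).inv.isHermitian
    rw [Matrix.IsHermitian, Matrix.conjTranspose_eq_transpose_of_trivial] at this
    exact this
  have hgε : G.loading t ω ⬝ᵥ ((G.noiseCov t ω)⁻¹ *ᵥ ε) = G.gain t ω ⬝ᵥ ε := by
    rw [dotProduct_mulVec, ← Matrix.mulVec_transpose, hsymm, noiseCov,
      intraclass_inv_mulVec (h.v_pos t ω) (h.tauSq_nonneg t ω), gain]
  have hsum : ∑ j, G.errorCoeff t j ω * G.shock t j ω = G.V (t + 1) ω * (G.gain t ω ⬝ᵥ ε) := by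
    rw [Fintype.sum_option, dotProduct]
    simp only [errorCoeff, shock, shockCoord, hε, mul_add, Finset.sum_add_distrib, Finset.mul_sum,
      Finset.sum_mul]
    rw [add_comm]
    congr 1 <;> exact Finset.sum_congr rfl fun i _ => by ring
  have hm : G.m (t + 1) ω = G.m t ω + G.V (t + 1) ω * (G.loading t ω ⬝ᵥ
      ((G.noiseCov t ω)⁻¹ *ᵥ
        (G.y t ω - G.intercept t ω (G.m t ω) - G.m t ω • G.loading t ω))) := rfl
  have hi : G.loading t ω ⬝ᵥ ((G.noiseCov t ω)⁻¹ *ᵥ G.loading t ω) = G.info t ω := rfl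
  rw [hm, hy, Matrix.mulVec_add, Matrix.mulVec_smul, dotProduct_add, dotProduct_smul, hi, hgε, hsum,
    smul_eq_mul]
  linear_combination (G.state ω - G.m t ω) * h.V_succ_mul_info t ω

/-- The filter mean is consistent. -/
lemma Assumptions.ae_tendsto_m [IsProbabilityMeasure P] (h : G.Assumptions P 𝓖 pL pH rhoC S E)
    (hL : 1 / 2 ≤ pL) (hLH : pL < pH) (hN : 2 ≤ N) (hr : rhoC < 1) :
    ∀ᵐ ω ∂P, Tendsto (fun t => G.m t ω) atTop (𝓝 (G.state ω)) := by
  have hW : ∀ t, Measurable fun ω => (G.common t ω, G.idio t ω) := fun t =>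
    (h.shock_measurable t).mono (𝓖.le _) le_rfl
  have hlaw : ∀ t, P.map (fun ω => (G.common t ω, G.idio t ω)) = shockLaw N := h.shock_law
  have hcomap : ∀ t (f : ℝ × (Fin N → ℝ) → ℝ), Measurable f →
      Indep (MeasurableSpace.comap (fun ω => f (G.common t ω, G.idio t ω)) inferInstance)
        (𝓖 t) P := by
    intro t f hf
    refine indep_of_indep_of_le_left (h.shock_indep t) ?_
    rw [show (fun ω => f (G.common t ω, G.idio t ω)) = f ∘ fun ω => (G.common t ω, G.idio t ω)
      from rfl, ← MeasurableSpace.comap_comp]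
    exact MeasurableSpace.comap_mono hf.comap_le
  have hint : ∀ t (f : ℝ × (Fin N → ℝ) → ℝ), Measurable f →
      ∫ ω, f (G.common t ω, G.idio t ω) ∂P = ∫ z, f z ∂shockLaw N := by
    intro t f hf
    rw [← hlaw t, integral_map (hW t).aemeasurable hf.aestronglyMeasurable]
  have hf := @measurable_shockCoord N
  have key := ae_tendsto_sum_whiteNoise (P := P) 𝓖 (fun t j => G.errorCoeff t j)
    (fun t j => G.shock t j) (C := √G.V0) (R := G.V0)
    h.measurable_errorCoeff
    (fun t j ω => by
      refine Real.abs_le_sqrt ?_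
      have h1 : G.errorCoeff t j ω ^ 2 ≤ ∑ j, G.errorCoeff t j ω ^ 2 :=
        Finset.single_le_sum (f := fun j => G.errorCoeff t j ω ^ 2)
          (fun _ _ => sq_nonneg _) (Finset.mem_univ j)
      have h2 := h.sum_errorCoeff_sq t ω
      have h3 := h.antitone_V ω (Nat.zero_le t)
      have h4 := h.V_pos (t + 1) ω
      have h5 : G.V 0 ω = G.V0 := rfl
      simp only at h3
      linarith)
    (fun t j => (hf j).comp (h.shock_measurable t))
    (fun t j => by
      have h1 : MemLp (shockCoord j) 2 (shockLaw N) :=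
        (memLp_id_gaussianReal 2).comp_measurePreserving (measurePreserving_shockCoord j)
      rw [← hlaw t] at h1
      exact (memLp_map_measure_iff (hf j).aestronglyMeasurable (hW t).aemeasurable).1 h1)
    (fun t j => hcomap t _ (hf j))
    (fun t j k => hcomap t (fun z => shockCoord j z * shockCoord k z) ((hf j).mul (hf k)))
    (fun t j => (hint t _ (hf j)).trans (integral_shockCoord j))
    (fun t j k hjk => (hint t (fun z => shockCoord j z * shockCoord k z)
      ((hf j).mul (hf k))).trans (integral_shockCoord_mul hjk))
    (fun t j => (hint t (fun z => shockCoord j z * shockCoord j z)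
      ((hf j).mul (hf j))).trans (integral_shockCoord_mul_self j))
    h.sum_sum_errorCoeff_sq
  filter_upwards [key] with ω ⟨l, hl⟩
  set s : ℕ → ℝ := fun n => ∑ t ∈ Finset.range n, ∑ j, G.errorCoeff t j ω * G.shock t j ω with hs
  -- Subtracting the accumulated noise `s` from the error leaves an exact average of its previous
  -- value and `-s t`. If `s` tends to `l`, this difference tends to `-l`, and adding `s` back gives
  -- error zero.
  have hlim := tendsto_of_averaging (V := fun t => G.V t ω)
    (x := fun t => G.m t ω - G.state ω - s t) (c := fun t => -s t) (fun t => h.V_pos t ω)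
    (h.antitone_V ω) (h.tendsto_V hL hLH hN hr ω) hl.neg (fun t => by
      have e : s (t + 1) = s t + ∑ j, G.errorCoeff t j ω * G.shock t j ω := by
        simp only [hs, Finset.sum_range_succ]
      simp only [h.error_succ t ω, e]
      ring)
  have := (hlim.add hl).add_const (G.state ω)
  simpa using this

end GaussianPanel

/-! ### Report laws of the binary model -/

lemma signalLaw_real {p : ℝ} (h0 : 0 ≤ p) (h1 : p ≤ 1) (k b : Bool) :
    (signalLaw p k).real {b} = if b = k then p else 1 - p := by
  have : 0 ≤ 1 - p := by linarith
  cases b <;> cases k <;>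
    simp [signalLaw, measureReal_def, h0, this]

lemma isProbabilityMeasure_signalLaw {p : ℝ} (h0 : 0 ≤ p) (h1 : p ≤ 1) (k : Bool) :
    IsProbabilityMeasure (signalLaw p k) := by
  constructor
  simp only [signalLaw, Measure.coe_add, Measure.coe_smul, Pi.add_apply, Pi.smul_apply,
    measure_univ, smul_eq_mul, mul_one]
  rw [← ENNReal.ofReal_add h0 (by linarith)]
  simp

lemma garble_real (κ : Bool → PMF Bool) (ν : Measure Bool) [IsFiniteMeasure ν] (b : Bool) :
    (garble κ ν).real {b} = ∑ s, ν.real {s} * (κ s).toMeasure.real {b} := by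
  have h : ∀ s, ν {s} * (κ s) b ≠ ⊤ := fun s =>
    ENNReal.mul_ne_top (measure_ne_top _ _) (PMF.apply_ne_top _ _)
  simp [garble, measureReal_def, ENNReal.toReal_add (h true) (h false)]

/-- The identity kernel is the truthful competitor in the optimality condition. -/
lemma garble_pure (ν : Measure Bool) : garble PMF.pure ν = ν := by
  simp only [garble, PMF.toMeasure_pure]
  rw [← Measure.sum_fintype]
  exact Measure.sum_smul_dirac ν

lemma signalLaw_mem {p : ℝ} (h0 : 0 < p) (h1 : p < 1) (k : Bool) :
    signalLaw p k ∈ fullSupportLaws := by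
  have := isProbabilityMeasure_signalLaw h0.le h1.le k
  refine ⟨this, fun b hb => ?_⟩
  have h := signalLaw_real h0.le h1.le k b
  rw [measureReal_def, hb, ENNReal.toReal_zero] at h
  split_ifs at h <;> linarith

lemma precision_mem {pL pH : ℝ} (hL : 1 / 2 ≤ pL) (hLH : pL < pH) (hH : pH < 1) (x : Bool) :
    1 / 2 ≤ precision pL pH x ∧ pL ≤ precision pL pH x ∧ precision pL pH x ≤ pH ∧
      precision pL pH x < 1 := by
  cases x <;> simp [precision] <;> (try constructor) <;> (try constructor) <;> linarith

namespace BinaryPanel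

variable {N : ℕ} {pL pH : ℝ} (M : BinaryPanel N pL pH)

/-- Under optimal scoring reports are truthful in law. -/
lemma ScoreOptimal.reportLaw_eq {M : BinaryPanel N pL pH} {S : Bool → Measure Bool → Bool → ℝ}
    {E : Set ℕ} (hopt : M.ScoreOptimal S E) (hS : ∀ k, StrictlyProperOn fullSupportLaws (S k))
    (hL : 1 / 2 ≤ pL) (hLH : pL < pH) (hH : pH < 1) {t : ℕ} (ht : t ∈ E) (i : Fin N) (x k : Bool)
    (h : Hist N t) : M.reportLaw t i x k h = signalLaw (precision pL pH x) k := by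
  by_contra hne
  obtain ⟨hp, -, -, hp1⟩ := precision_mem hL hLH hH x
  have hmem : ∀ k, signalLaw (precision pL pH x) k ∈ fullSupportLaws :=
    signalLaw_mem (by linarith) hp1
  have h1 := hopt t ht i x h PMF.pure (fun k => by rw [garble_pure]; exact hmem k) k
  rw [garble_pure] at h1
  exact absurd h1 (not_le.2 ((hS k _ (hmem k) _ (M.report_full t i x h k)).2 hne))

instance (t : ℕ) (i : Fin N) (x k : Bool) (h : Hist N t) :
    IsProbabilityMeasure (M.reportLaw t i x k h) := (M.report_full t i x h k).1

lemma reportLaw_real_pos (t : ℕ) (i : Fin N) (x k : Bool) (h : Hist N t) (b : Bool) :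
    0 < (M.reportLaw t i x k h).real {b} :=
  ENNReal.toReal_pos ((M.report_full t i x h k).2 b) (measure_ne_top _ _)

lemma reportLaw_real_add (t : ℕ) (i : Fin N) (x k : Bool) (h : Hist N t) :
    (M.reportLaw t i x k h).real {true} + (M.reportLaw t i x k h).real {false} = 1 := by
  have := sum_measureReal_singleton (μ := M.reportLaw t i x k h) Finset.univ
  rw [Finset.coe_univ, probReal_univ] at this
  simpa using this

/-- Likelihood ratios of a report are bounded by those of the signal. -/
lemma reportLaw_real_le (hL : 1 / 2 ≤ pL) (hLH : pL < pH) (hH : pH < 1) (t : ℕ) (i : Fin N)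
    (x k k' : Bool) (h : Hist N t) (b : Bool) :
    (M.reportLaw t i x k h).real {b} ≤ pH / (1 - pH) * (M.reportLaw t i x k' h).real {b} := by
  obtain ⟨hp, -, hpH, hp1⟩ := precision_mem hL hLH hH x
  set p := precision pL pH x
  set K := pH / (1 - pH) with hK
  have hpH1 : 0 < 1 - pH := by linarith
  have hK1 : 1 ≤ K := by rw [hK, le_div_iff₀ hpH1]; linarith
  have hpK : p ≤ K * (1 - p) := by
    rw [hK, div_mul_eq_mul_div, le_div_iff₀ hpH1]; nlinarith
  have hp0 : 0 ≤ p := by linarith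
  have hiso : ∀ k, IsProbabilityMeasure (signalLaw p k) :=
    isProbabilityMeasure_signalLaw hp0 hp1.le
  -- The kernel is the same in both states, so a pointwise comparison of signal laws passes to
  -- report laws; garbling cannot raise likelihood ratios.
  have hle : ∀ k k' s, (signalLaw p k).real {s} ≤ K * (signalLaw p k').real {s} := by
    intro k k' s
    rw [signalLaw_real hp0 hp1.le, signalLaw_real hp0 hp1.le]
    split_ifs <;> nlinarith
  have e : ∀ k, M.reportLaw t i x k h = garble (M.report t i x h) (signalLaw p k) := fun _ => rfl
  rw [e, e, garble_real, garble_real, Finset.mul_sum]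
  refine Finset.sum_le_sum fun s _ => ?_
  rw [← mul_assoc]
  exact mul_le_mul_of_nonneg_right (hle k k' s) measureReal_nonneg

instance (t : ℕ) (k : Bool) (x : Profile N) (h : Hist N t) :
    IsProbabilityMeasure (M.jointReportLaw t k x h) := by
  constructor
  have : ∑ s, M.signals t k x h s = 1 := by
    rw [← tsum_fintype (L := SummationFilter.unconditional _)]; exact PMF.tsum_coe _
  simp [jointReportLaw, this]

/-- The marginals of the joint report law. -/
lemma jointReportLaw_map (t : ℕ) (k : Bool) (x : Profile N) (h : Hist N t) (i : Fin N) :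
    (M.jointReportLaw t k x h).map (fun b => b i) = M.reportLaw t i (x i) k h := by
  have hmarg := M.signals_marginal t k x h i
  ext A hA
  rw [Measure.map_apply (by fun_prop) hA]
  simp only [jointReportLaw, reportLaw, garble, Measure.coe_finsetSum, Finset.sum_apply,
    Measure.smul_apply, smul_eq_mul]
  have h1 : ∀ s : Profile N, (Measure.pi fun j => (M.report t j (x j) h (s j)).toMeasure)
      ((fun b : Profile N => b i) ⁻¹' A) = (M.report t i (x i) h (s i)).toMeasure A := by
    intro s
    exact (measurePreserving_eval (fun j => (M.report t j (x j) h (s j)).toMeasure) i).measure_preimage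
      hA.nullMeasurableSet
  simp only [h1]
  have h2 : ∀ u : Bool, signalLaw (precision pL pH (x i)) k {u} =
      ∑ s : Profile N, if s i = u then M.signals t k x h s else 0 := by
    intro u
    rw [← hmarg, Measure.map_apply (by fun_prop) (by measurability),
      PMF.toMeasure_apply_fintype]
    refine Finset.sum_congr rfl fun s _ => ?_
    by_cases hs : s i = u <;> simp [hs]
  simp only [h2, Finset.sum_mul]
  rw [Finset.sum_comm]
  exact Finset.sum_congr rfl fun s _ => by simp

lemma sum_jointReportLaw (t : ℕ) (k : Bool) (x : Profile N) (h : Hist N t) :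
    ∑ b, (M.jointReportLaw t k x h).real {b} = 1 := by
  have := sum_measureReal_singleton (μ := M.jointReportLaw t k x h) Finset.univ
  rwa [Finset.coe_univ, probReal_univ] at this

lemma sum_jointReportLaw_mul (t : ℕ) (k : Bool) (x : Profile N) (h : Hist N t) (i : Fin N)
    (f : Bool → ℝ) :
    ∑ b, (M.jointReportLaw t k x h).real {b} * f (b i) =
      ∑ u, (M.reportLaw t i (x i) k h).real {u} * f u := by
  have h1 := integral_map (μ := M.jointReportLaw t k x h) (φ := fun b : Profile N => b i)
    (measurable_pi_apply i).aemeasurable (f := f)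
    StronglyMeasurable.of_discrete.aestronglyMeasurable
  rw [jointReportLaw_map, integral_fintype .of_finite, integral_fintype .of_finite] at h1
  simpa using h1.symm

lemma jointReportLaw_real_eval (t : ℕ) (k : Bool) (x : Profile N) (h : Hist N t) (i : Fin N)
    (u : Bool) : (M.jointReportLaw t k x h).real {b | b i = u} =
      (M.reportLaw t i (x i) k h).real {u} := by
  rw [← jointReportLaw_map, map_measureReal_apply (by fun_prop) (by measurability)]
  rfl

end BinaryPanel

/-! ### Variables with finitely many values -/

/-- Ensures that conditioning on the realised history is almost surely genuine. On a null history
`cond` is the zero measure and the complement rule for posteriors fails. -/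
lemma ae_measure_fiber_ne_zero {Ω : Type*} [MeasurableSpace Ω] {α : Type*} [Fintype α]
    (Q : Measure Ω) (X : Ω → α) : ∀ᵐ ω ∂Q, Q {ω' | X ω' = X ω} ≠ 0 := by
  rw [ae_iff]
  have : {ω | ¬ Q {ω' | X ω' = X ω} ≠ 0} ⊆ ⋃ z ∈ {z | Q {ω' | X ω' = z} = 0}, {ω | X ω = z} := by
    intro ω hω
    simpa using hω
  exact measure_mono_null this ((measure_biUnion_null_iff (Set.to_countable _)).2 fun z hz => hz)

section Finite

variable {Ω : Type*} [MeasurableSpace Ω] {α : Type*} [Fintype α] [MeasurableSpace α]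
  [DiscreteMeasurableSpace α]

lemma integral_comp_fintype (Q : Measure Ω) [IsFiniteMeasure Q] {X : Ω → α} (hX : Measurable X)
    (F : α → ℝ) : ∫ ω, F (X ω) ∂Q = ∑ z, Q.real {ω | X ω = z} * F z := by
  rw [← integral_map hX.aemeasurable StronglyMeasurable.of_discrete.aestronglyMeasurable,
    integral_fintype .of_finite]
  refine Finset.sum_congr rfl fun z _ => ?_
  rw [map_measureReal_apply hX (MeasurableSet.of_discrete), smul_eq_mul]
  rfl

lemma integrable_comp_fintype (Q : Measure Ω) [IsFiniteMeasure Q] {X : Ω → α} (hX : Measurable X)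
    (F : α → ℝ) : Integrable (fun ω => F (X ω)) Q :=
  (Integrable.of_finite (f := F) (μ := Q.map X)).comp_measurable hX

end Finite

/-! ### Posterior probabilities and tests -/

section Posterior

variable {N : ℕ} {Ω : Type*} [MeasurableSpace Ω] {P : Measure Ω}
  {y : ℕ → Ω → Profile N}

lemma measurable_hist (hy : ∀ t, Measurable (y t)) (n : ℕ) : Measurable (hist y n) :=
  measurable_pi_lambda _ fun j => hy j

lemma measurableSet_hist_eq (hy : ∀ t, Measurable (y t)) (n : ℕ) (h : Hist N n) :
    MeasurableSet {ω | hist y n ω = h} :=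
  measurable_hist hy n (measurableSet_singleton h)

lemma posterior_eq (hy : ∀ t, Measurable (y t)) (A : Set Ω) (n : ℕ) (h : Hist N n) :
    posterior P y A n h = P.real (A ∩ {ω | hist y n ω = h}) / P.real {ω | hist y n ω = h} := by
  rw [posterior, measureReal_def, cond_apply (measurableSet_hist_eq hy n h), ENNReal.toReal_mul,
    ENNReal.toReal_inv, Set.inter_comm, div_eq_inv_mul]
  rfl

lemma posterior_nonneg (A : Set Ω) (n : ℕ) (h : Hist N n) : 0 ≤ posterior P y A n h :=
  measureReal_nonneg

variable [IsProbabilityMeasure P]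

lemma posterior_le_one (hy : ∀ t, Measurable (y t)) (A : Set Ω) (n : ℕ) (h : Hist N n) :
    posterior P y A n h ≤ 1 := by
  rw [posterior_eq hy]
  exact div_le_one_of_le₀ (measureReal_mono Set.inter_subset_right) measureReal_nonneg

lemma posterior_compl {A : Set Ω} (hA : MeasurableSet A) (n : ℕ)
    (h : Hist N n) (hh : P {ω | hist y n ω = h} ≠ 0) :
    posterior P y Aᶜ n h = 1 - posterior P y A n h := by
  have := cond_isProbabilityMeasure hh
  exact probReal_compl_eq_one_sub hA

/-- The integral is the sum over histories `h` of `P(A ∩ h) P(B ∩ h) / P(h)`. Each term is at most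
`P(A ∩ h)` and at most `P(B ∩ h)`; the first bound is used on `T`, the second off it. The posterior
thus errs in the mean no more than any test. -/
lemma setIntegral_posterior_le (hy : ∀ t, Measurable (y t)) {A B : Set Ω} (hA : MeasurableSet A)
    (hB : MeasurableSet B) (n : ℕ) (T : Set (Hist N n)) :
    ∫ ω in B, posterior P y A n (hist y n ω) ∂P ≤
      P.real (A ∩ {ω | hist y n ω ∈ T}) + P.real (B ∩ {ω | hist y n ω ∉ T}) := by
  have hm := measurable_hist hy n
  have e : ∀ (C : Set Ω) (U : Set (Hist N n)), MeasurableSet C →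
      P.real (C ∩ {ω | hist y n ω ∈ U}) =
        ∑ h, P.real (C ∩ {ω | hist y n ω = h}) * U.indicator (fun _ => (1 : ℝ)) h := by
    intro C U hC
    have hU : MeasurableSet {ω | hist y n ω ∈ U} := hm (Set.toFinite U).measurableSet
    have h1 := integral_comp_fintype (P.restrict C) hm (U.indicator fun _ => (1 : ℝ))
    have h2 : ∫ ω in C, U.indicator (fun _ => (1 : ℝ)) (hist y n ω) ∂P =
        P.real (C ∩ {ω | hist y n ω ∈ U}) := by
      have : (fun ω => U.indicator (fun _ => (1 : ℝ)) (hist y n ω)) =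
          {ω | hist y n ω ∈ U}.indicator 1 := by
        ext ω; by_cases h : hist y n ω ∈ U <;> simp [h]
      rw [this, integral_indicator_one hU, measureReal_restrict_apply hU, Set.inter_comm]
    rw [← h2, h1]
    refine Finset.sum_congr rfl fun h _ => ?_
    rw [measureReal_restrict_apply (measurableSet_hist_eq hy n h), Set.inter_comm]
  rw [integral_comp_fintype _ hm (posterior P y A n), e A T hA]
  have e2 : P.real (B ∩ {ω | hist y n ω ∉ T}) =
      ∑ h, P.real (B ∩ {ω | hist y n ω = h}) * Tᶜ.indicator (fun _ => (1 : ℝ)) h := e B Tᶜ hB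
  rw [e2, ← Finset.sum_add_distrib]
  refine Finset.sum_le_sum fun h _ => ?_
  rw [measureReal_restrict_apply (measurableSet_hist_eq hy n h), Set.inter_comm, posterior_eq hy]
  set a := P.real (A ∩ {ω | hist y n ω = h})
  set b := P.real (B ∩ {ω | hist y n ω = h})
  set p := P.real {ω | hist y n ω = h}
  have ha : 0 ≤ a := measureReal_nonneg
  have hb : 0 ≤ b := measureReal_nonneg
  have hp : 0 ≤ p := measureReal_nonneg
  have hap : a ≤ p := measureReal_mono Set.inter_subset_right
  have hbp : b ≤ p := measureReal_mono Set.inter_subset_right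
  by_cases hT : h ∈ T
  · simp only [hT, Set.indicator_of_mem, mul_one, Set.mem_compl_iff, not_true_eq_false,
      not_false_eq_true, Set.indicator_of_notMem, mul_zero, add_zero]
    rw [mul_div_left_comm]
    exact mul_le_of_le_one_right ha (div_le_one_of_le₀ hbp hp)
  · simp only [hT, Set.indicator_of_mem, mul_one, Set.mem_compl_iff,
      not_false_eq_true, Set.indicator_of_notMem, mul_zero, zero_add]
    exact mul_le_of_le_one_right hb (div_le_one_of_le₀ hap hp)

/-- If a sequence of tests separates two events with summable error probabilities, then on the
second event the posterior probability of the first one tends to zero. -/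
lemma ae_tendsto_posterior_zero (hy : ∀ t, Measurable (y t)) {A B : Set Ω} (hA : MeasurableSet A)
    (hB : MeasurableSet B) (T : ∀ n, Set (Hist N n))
    (h1 : Summable fun n => P.real (A ∩ {ω | hist y n ω ∈ T n}))
    (h2 : Summable fun n => P.real (B ∩ {ω | hist y n ω ∉ T n})) :
    ∀ᵐ ω ∂P, ω ∈ B → Tendsto (fun n => posterior P y A n (hist y n ω)) atTop (𝓝 0) := by
  rw [← ae_restrict_iff' hB]
  have hint : ∀ n, Integrable (fun ω => posterior P y A n (hist y n ω)) (P.restrict B) := fun n =>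
    integrable_comp_fintype _ (measurable_hist hy n) (posterior P y A n)
  have hmeas : ∀ n, AEMeasurable (fun ω => ENNReal.ofReal (posterior P y A n (hist y n ω)))
      (P.restrict B) := fun n => (hint n).aestronglyMeasurable.aemeasurable.ennreal_ofReal
  -- Exchanging sum and integral makes the series of posteriors almost surely finite on `B`, so its
  -- terms vanish.
  have hsum : ∫⁻ ω in B, ∑' n, ENNReal.ofReal (posterior P y A n (hist y n ω)) ∂P ≠ ⊤ := by
    rw [lintegral_tsum hmeas]
    have hs : Summable fun n => ∫ ω in B, posterior P y A n (hist y n ω) ∂P :=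
      Summable.of_nonneg_of_le (fun n => integral_nonneg fun ω => posterior_nonneg _ _ _)
        (fun n => setIntegral_posterior_le hy hA hB n (T n)) (h1.add h2)
    have e : ∀ n, ∫⁻ ω in B, ENNReal.ofReal (posterior P y A n (hist y n ω)) ∂P =
        ENNReal.ofReal (∫ ω in B, posterior P y A n (hist y n ω) ∂P) := fun n =>
      (ofReal_integral_eq_lintegral_ofReal (hint n)
        (ae_of_all _ fun ω => posterior_nonneg _ _ _)).symm
    simp only [e]
    exact hs.tsum_ofReal_ne_top
  filter_upwards [ae_lt_top' (AEMeasurable.tsum hmeas) hsum] with ω hω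
  have h3 := ENNReal.tendsto_atTop_zero_of_tsum_ne_top hω.ne
  have h4 := (ENNReal.tendsto_toReal ENNReal.zero_ne_top).comp h3
  refine h4.congr fun n => ?_
  simp [ENNReal.toReal_ofReal (posterior_nonneg _ _ _)]

end Posterior

/-! ### Sums along the report process -/

lemma summable_exp_neg_mul {c : ℝ} (hc : 0 < c) : Summable fun n : ℕ => Real.exp (-c * n) := by
  have : ∀ n : ℕ, Real.exp (-c * n) = Real.exp (-c) ^ n := fun n => by
    rw [← Real.exp_nat_mul, mul_comm]
  simp only [this]
  exact summable_geometric_of_lt_one (Real.exp_pos _).le (by simpa using hc)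

lemma ae_eventually_not_of_summable {Ω : Type*} [MeasurableSpace Ω] {P : Measure Ω}
    [IsFiniteMeasure P] {s : ℕ → Set Ω} (h : Summable fun n => P.real (s n)) :
    ∀ᵐ ω ∂P, ∀ᶠ n in atTop, ω ∉ s n := by
  refine ae_eventually_notMem ?_
  have := h.tsum_ofReal_ne_top
  simpa [ofReal_measureReal] using this

/-- Functions of the state, the types, the history before a date and the reports of that date. -/
abbrev Increment (N : ℕ) := (t : ℕ) → Bool → Profile N → Hist N t → Profile N → ℝ

/-- The sum over the dates before `n` of an increment as a function of the history. -/
def histSum {N : ℕ} (g : Increment N) (n : ℕ) (k : Bool) (x : Profile N) (h : Hist N n) : ℝ :=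
  ∑ j : Fin n, g j k x (fun i => h ⟨i, i.2.trans j.2⟩) (h j)

/-- The sum over the dates before `n` of an increment. -/
def pathSum {N : ℕ} {Ω : Type*} (g : Increment N) (θ : Ω → Bool) (types : Ω → Profile N)
    (y : ℕ → Ω → Profile N) (n : ℕ) (ω : Ω) : ℝ :=
  ∑ t ∈ Finset.range n, g t (θ ω) (types ω) (hist y t ω) (y t ω)

/-- Exhibits the sum as a function of a variable with finitely many values, which makes
integrability automatic and allows the next report to be integrated out. -/
lemma pathSum_eq_histSum {N : ℕ} {Ω : Type*} (g : Increment N) (θ : Ω → Bool)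
    (types : Ω → Profile N) (y : ℕ → Ω → Profile N) (n : ℕ) (ω : Ω) :
    pathSum g θ types y n ω = histSum g n (θ ω) (types ω) (hist y n ω) := by
  rw [pathSum, Finset.sum_range]
  rfl

namespace BinaryPanel

variable {N : ℕ} {pL pH : ℝ} {M : BinaryPanel N pL pH} {Ω : Type*} [MeasurableSpace Ω]
  {P : Measure Ω} {θ : Ω → Bool} {types : Ω → Profile N} {y : ℕ → Ω → Profile N}

/-- Conditional mean of an increment given the state, the types and the history. -/
def mean (M : BinaryPanel N pL pH) (g : Increment N) (t : ℕ) (k : Bool) (x : Profile N)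
    (h : Hist N t) : ℝ := ∑ b, (M.jointReportLaw t k x h).real {b} * g t k x h b

variable (hM : M.IsPath P θ types y)

include hM

lemma IsPath.measurable_past (n : ℕ) : Measurable fun ω => (θ ω, types ω, hist y n ω) :=
  hM.measurable_state.prodMk
    (hM.measurable_types.prodMk (measurable_hist hM.measurable_reports n))

lemma IsPath.measurable_past_and_report (n : ℕ) :
    Measurable fun ω => ((θ ω, types ω, hist y n ω), y n ω) :=
  (hM.measurable_past n).prodMk (hM.measurable_reports n)

variable [IsProbabilityMeasure P]

/-- The date-`n` reports are integrated out given the past. -/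
lemma IsPath.integral_mul_report (n : ℕ) (Φ : Bool → Profile N → Hist N n → ℝ)
    (ψ : Bool → Profile N → Hist N n → Profile N → ℝ) :
    ∫ ω, Φ (θ ω) (types ω) (hist y n ω) * ψ (θ ω) (types ω) (hist y n ω) (y n ω) ∂P =
      ∫ ω, Φ (θ ω) (types ω) (hist y n ω) *
        ∑ b, (M.jointReportLaw n (θ ω) (types ω) (hist y n ω)).real {b} *
          ψ (θ ω) (types ω) (hist y n ω) b ∂P := by
  rw [integral_comp_fintype P (hM.measurable_past_and_report n)
      (fun z => Φ z.1.1 z.1.2.1 z.1.2.2 * ψ z.1.1 z.1.2.1 z.1.2.2 z.2),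
    integral_comp_fintype P (hM.measurable_past n)
      (fun z => Φ z.1 z.2.1 z.2.2 * ∑ b, (M.jointReportLaw n z.1 z.2.1 z.2.2).real {b} *
        ψ z.1 z.2.1 z.2.2 b), Fintype.sum_prod_type]
  refine Finset.sum_congr rfl fun z _ => ?_
  rw [Finset.mul_sum, Finset.mul_sum]
  refine Finset.sum_congr rfl fun b _ => ?_
  have e1 : {ω | ((θ ω, types ω, hist y n ω), y n ω) = (z, b)} =
      {ω | θ ω = z.1 ∧ types ω = z.2.1 ∧ hist y n ω = z.2.2 ∧ y n ω = b} := by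
    ext ω; simp [Prod.ext_iff, and_assoc]
  have e2 : {ω | (θ ω, types ω, hist y n ω) = z} =
      {ω | θ ω = z.1 ∧ types ω = z.2.1 ∧ hist y n ω = z.2.2} := by
    ext ω; simp [Prod.ext_iff]
  rw [e1, e2, hM.step]
  ring

/-- Chernoff bound for sums of bounded increments with nonpositive conditional means. -/
lemma IsPath.chernoff {g : Increment N} {C ε : ℝ} (hC : 1 ≤ C)
    (hg : ∀ t k x h b, |g t k x h b| ≤ C) (hmean : ∀ t k x h, M.mean g t k x h ≤ 0)
    (hε : 0 < ε) (hε1 : ε ≤ 1) (n : ℕ) :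
    P.real {ω | ε * n ≤ pathSum g θ types y n ω} ≤ Real.exp (-(ε ^ 2 / (4 * C ^ 2)) * n) := by
  -- Minimiser of the exponent `s² C² - s ε`, with value `-ε² / (4 C²)`. The normalisations `ε ≤ 1 ≤
  -- C` keep `s C ≤ 1`, the range where `exp x ≤ 1 + x + x²` is applied.
  set s := ε / (2 * C ^ 2) with hs
  have hs0 : 0 < s := by positivity
  have hsC : s * C ≤ 1 := by
    rw [hs, div_mul_eq_mul_div, div_le_one (by positivity)]; nlinarith
  have hmom : ∀ t k x h, ∑ b, (M.jointReportLaw t k x h).real {b} * Real.exp (s * g t k x h b) ≤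
      Real.exp (s ^ 2 * C ^ 2) := by
    intro t k x h
    have hb : ∀ b, Real.exp (s * g t k x h b) ≤ 1 + s * g t k x h b + s ^ 2 * C ^ 2 := by
      intro b
      have habs : |s * g t k x h b| ≤ s * C := by
        rw [abs_mul, abs_of_pos hs0]; exact mul_le_mul_of_nonneg_left (hg _ _ _ _ _) hs0.le
      have h1 := (abs_le.1 (Real.abs_exp_sub_one_sub_id_le (habs.trans hsC))).2
      have h2 : (s * g t k x h b) ^ 2 ≤ (s * C) ^ 2 := sq_le_sq' (abs_le.1 habs).1 (abs_le.1 habs).2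
      rw [mul_pow s C] at h2
      linarith
    calc _ ≤ ∑ b, (M.jointReportLaw t k x h).real {b} *
          (1 + s * g t k x h b + s ^ 2 * C ^ 2) :=
          Finset.sum_le_sum fun b _ => mul_le_mul_of_nonneg_left (hb b) measureReal_nonneg
      _ = (1 + s ^ 2 * C ^ 2) * (∑ b, (M.jointReportLaw t k x h).real {b}) +
          s * M.mean g t k x h := by
          rw [mean, Finset.mul_sum, Finset.mul_sum, ← Finset.sum_add_distrib]
          exact Finset.sum_congr rfl fun b _ => by ring
      _ ≤ 1 + s ^ 2 * C ^ 2 := by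
          rw [M.sum_jointReportLaw, mul_one]
          linarith [mul_nonpos_of_nonneg_of_nonpos hs0.le (hmean t k x h)]
      _ ≤ _ := by linarith [Real.add_one_le_exp (s ^ 2 * C ^ 2)]
  have hexp : ∀ n : ℕ, ∫ ω, Real.exp (s * pathSum g θ types y n ω) ∂P ≤
      Real.exp (s ^ 2 * C ^ 2 * n) := by
    intro n
    induction n with
    | zero => simp [pathSum]
    | succ n ih =>
      have hi := hM.integral_mul_report n (fun k x h => Real.exp (s * histSum g n k x h))
        (fun k x h b => Real.exp (s * g n k x h b))
      have e : ∀ ω, Real.exp (s * pathSum g θ types y (n + 1) ω) =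
          Real.exp (s * histSum g n (θ ω) (types ω) (hist y n ω)) *
            Real.exp (s * g n (θ ω) (types ω) (hist y n ω) (y n ω)) := by
        intro ω
        rw [← Real.exp_add, ← mul_add, ← pathSum_eq_histSum, pathSum, pathSum,
          Finset.sum_range_succ]
      simp only [e]
      rw [hi]
      calc _ ≤ ∫ ω, Real.exp (s * pathSum g θ types y n ω) * Real.exp (s ^ 2 * C ^ 2) ∂P := by
            simp only [pathSum_eq_histSum]
            refine integral_mono ?_ ?_ fun ω => ?_
            · exact integrable_comp_fintype P (hM.measurable_past n) fun z =>
                Real.exp (s * histSum g n z.1 z.2.1 z.2.2) *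
                  ∑ b, (M.jointReportLaw n z.1 z.2.1 z.2.2).real {b} *
                    Real.exp (s * g n z.1 z.2.1 z.2.2 b)
            · exact integrable_comp_fintype P (hM.measurable_past n) fun z =>
                Real.exp (s * histSum g n z.1 z.2.1 z.2.2) * Real.exp (s ^ 2 * C ^ 2)
            · exact mul_le_mul_of_nonneg_left (hmom _ _ _ _) (Real.exp_pos _).le
        _ ≤ Real.exp (s ^ 2 * C ^ 2 * n) * Real.exp (s ^ 2 * C ^ 2) := by
            rw [integral_mul_const]
            exact mul_le_mul_of_nonneg_right ih (Real.exp_pos _).le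
        _ = _ := by rw [← Real.exp_add]; push_cast; ring_nf
  have hint : Integrable (fun ω => Real.exp (s * pathSum g θ types y n ω)) P := by
    simp only [pathSum_eq_histSum]
    exact integrable_comp_fintype P (hM.measurable_past n) fun z =>
      Real.exp (s * histSum g n z.1 z.2.1 z.2.2)
  have hmarkov := mul_meas_ge_le_integral_of_nonneg (ae_of_all P fun ω =>
    (Real.exp_pos (s * pathSum g θ types y n ω)).le) hint (Real.exp (s * (ε * n)))
  have hset : {ω | Real.exp (s * (ε * n)) ≤ Real.exp (s * pathSum g θ types y n ω)} =
      {ω | ε * n ≤ pathSum g θ types y n ω} := by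
    ext ω
    simp [Real.exp_le_exp, mul_le_mul_iff_right₀ hs0]
  rw [hset] at hmarkov
  have h2 := hmarkov.trans (hexp n)
  have e : Real.exp (-(ε ^ 2 / (4 * C ^ 2)) * n) =
      Real.exp (s ^ 2 * C ^ 2 * n) / Real.exp (s * (ε * n)) := by
    rw [← Real.exp_sub]
    congr 1
    rw [hs]
    have : C ≠ 0 := by positivity
    field_simp
    ring
  rw [e, le_div_iff₀ (Real.exp_pos _), mul_comm]
  exact h2

/-- Law of large numbers, one-sided. -/
lemma IsPath.ae_eventually_pathSum_lt {g : Increment N} {C ε : ℝ}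
    (hg : ∀ t k x h b, |g t k x h b| ≤ C) (hmean : ∀ t k x h, M.mean g t k x h ≤ 0)
    (hε : 0 < ε) : ∀ᵐ ω ∂P, ∀ᶠ n : ℕ in atTop, pathSum g θ types y n ω < ε * n := by
  have hC : (1 : ℝ) ≤ max C 1 := le_max_right _ _
  have hε' : 0 < min ε 1 := lt_min hε one_pos
  have hs : Summable fun n : ℕ => P.real {ω | min ε 1 * n ≤ pathSum g θ types y n ω} :=
    Summable.of_nonneg_of_le (fun n => measureReal_nonneg)
      (fun n => hM.chernoff hC (fun t k x h b => (hg t k x h b).trans (le_max_left _ _)) hmean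
        hε' (min_le_right _ _) n) (summable_exp_neg_mul (by positivity))
  filter_upwards [ae_eventually_not_of_summable hs] with ω hω
  filter_upwards [hω] with n hn
  simp only [not_le] at hn
  exact hn.trans_le (mul_le_mul_of_nonneg_right (min_le_left _ _) (Nat.cast_nonneg n))

/-- Increments that live on a set of dates of positive lower density and have uniformly negative
conditional means there have linearly decreasing sums, outside events of summable probability. -/
lemma IsPath.exists_summable_drift {E : Set ℕ} (hE : 0 < lowerDensity E) {g : Increment N}
    {C δ : ℝ} (hδ : 0 < δ) (A : Bool → Profile N → Prop) (hg : ∀ t k x h b, |g t k x h b| ≤ C)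
    (hoff : ∀ t ∉ E, ∀ k x h b, g t k x h b = 0)
    (hon : ∀ t ∈ E, ∀ k x h, A k x → M.mean g t k x h ≤ -δ) :
    ∃ η : ℝ, 0 < η ∧ Summable fun n : ℕ =>
      P.real {ω | A (θ ω) (types ω) ∧ -(η * n) ≤ pathSum g θ types y n ω} := by
  classical
  obtain ⟨d, hd, hcount⟩ := exists_mul_le_dateCount hE
  -- Adding `δ` on dates of `E` leaves a nonpositive conditional mean. Outside `A`, where no drift
  -- is assumed, the increment is switched off so that the Chernoff bound applies globally.
  set g' : Increment N := fun t k x h b =>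
    if A k x then g t k x h b + δ * E.indicator (fun _ => (1 : ℝ)) t else 0 with hg'
  set C' := max (C + δ) 1
  set ε := min (δ * d / 2) 1
  have hε : 0 < ε := lt_min (by positivity) one_pos
  have hC0 : 0 ≤ C + δ := by
    have := (abs_nonneg _).trans (hg 0 true (fun _ => true) (fun _ _ => true) fun _ => true)
    linarith
  have hbound : ∀ t k x h b, |g' t k x h b| ≤ C' := by
    intro t k x h b
    refine le_trans ?_ (le_max_left _ _)
    simp only [hg']
    split_ifs with hA
    · refine (abs_add_le _ _).trans (add_le_add (hg t k x h b) ?_)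
      by_cases ht : t ∈ E
      · simp [ht, abs_of_pos hδ]
      · simp [ht, hδ.le]
    · simpa using hC0
  have hmean : ∀ t k x h, M.mean g' t k x h ≤ 0 := by
    intro t k x h
    by_cases hA : A k x
    · by_cases ht : t ∈ E
      · have e : M.mean g' t k x h = M.mean g t k x h +
            δ * ∑ b, (M.jointReportLaw t k x h).real {b} := by
          simp only [mean, hg', hA, if_true, ht, Set.indicator_of_mem]
          rw [Finset.mul_sum, ← Finset.sum_add_distrib]
          exact Finset.sum_congr rfl fun b _ => by ring
        rw [e, M.sum_jointReportLaw]
        linarith [hon t ht k x h hA]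
      · simp [mean, hg', hA, ht, hoff t ht]
    · simp [mean, hg', hA]
  -- Evaluation dates eventually contribute at least `δ d n` to the compensator. Half of it is the
  -- claimed decrease, the other half the deviation in the Chernoff bound.
  refine ⟨δ * d / 2, by positivity, ?_⟩
  have hs := summable_exp_neg_mul (c := ε ^ 2 / (4 * C' ^ 2)) (by
    have : 1 ≤ C' := le_max_right _ _
    positivity)
  refine Summable.of_norm_bounded_eventually_nat hs ?_
  filter_upwards [hcount] with n hn
  rw [Real.norm_of_nonneg measureReal_nonneg]
  refine le_trans (measureReal_mono fun ω hω => ?_)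
    (hM.chernoff (le_max_right _ _) hbound hmean hε (min_le_right _ _) n)
  obtain ⟨hA, hω⟩ := hω
  have e : pathSum g' θ types y n ω = pathSum g θ types y n ω + δ * dateCount E n := by
    simp only [pathSum, hg', hA, if_true, dateCount, Finset.sum_add_distrib, Finset.mul_sum]
  have h1 : ε * n ≤ δ * d / 2 * n := mul_le_mul_of_nonneg_right (min_le_left _ _) (Nat.cast_nonneg n)
  have h2 := mul_le_mul_of_nonneg_left hn hδ.le
  change ε * n ≤ pathSum g' θ types y n ω
  linarith

end BinaryPanel

namespace BinaryPanel

variable {N : ℕ} {pL pH : ℝ} {M : BinaryPanel N pL pH} {Ω : Type*} [MeasurableSpace Ω]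
  {P : Measure Ω} {θ : Ω → Bool} {types : Ω → Profile N} {y : ℕ → Ω → Profile N}
  {v : (t : ℕ) → Bool → Profile N → Hist N t → Fin N → ℝ}
  {tauSq : (t : ℕ) → Bool → Profile N → Hist N t → ℝ} {rhoC : ℝ}
  {S : Bool → Measure Bool → Bool → ℝ} {E : Set ℕ}

lemma Assumptions.reportLaw_eq (hM : M.Assumptions P θ types y v tauSq rhoC S E)
    (hL : 1 / 2 ≤ pL) (hLH : pL < pH) (hH : pH < 1) {t : ℕ} (ht : t ∈ E) (i : Fin N) (x k : Bool)
    (h : Hist N t) : M.reportLaw t i x k h = signalLaw (precision pL pH x) k :=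
  hM.optimal.reportLaw_eq hM.proper hL hLH hH ht i x k h

/-! ### Frequencies of scored reports -/

/-- On scored dates, the excess of the indicator of the report `k` of expert `i` over `q`. -/
def reportExcess (E : Set ℕ) (i : Fin N) (k : Bool) (q : ℝ) : Increment N :=
  fun t _ _ _ b => E.indicator (fun _ => (if b i = k then 1 else 0) - q) t

/-- The total excess of the scored reports `k` of expert `i` before date `n`. -/
def totalExcess (E : Set ℕ) (i : Fin N) (k : Bool) (q : ℝ) (n : ℕ) (h : Hist N n) : ℝ :=
  -- The excess ignores state and types, so these arguments are placeholders. The total is a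
  -- function of the public history alone and can serve as a test.
  histSum (reportExcess E i k q) n true (fun _ => true) h

/-- The total excess has the sign of its conditional means, outside events of summable
probability. -/
lemma Assumptions.summable_totalExcess [IsProbabilityMeasure P]
    (hM : M.Assumptions P θ types y v tauSq rhoC S E)
    (hL : 1 / 2 ≤ pL) (hLH : pL < pH) (hH : pH < 1) (i : Fin N) (k : Bool) (q c : ℝ) {δ : ℝ}
    (hδ : 0 < δ) (A : Bool → Profile N → Prop)
    (hA : ∀ k' x, A k' x → c * ((if k = k' then precision pL pH (x i)
      else 1 - precision pL pH (x i)) - q) ≤ -δ) :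
    Summable fun n => P.real {ω | A (θ ω) (types ω) ∧
      0 ≤ c * totalExcess E i k q n (hist y n ω)} := by
  obtain ⟨η, hη, hs⟩ := hM.path.exists_summable_drift hM.density
    (g := fun t k' x h b => c * reportExcess E i k q t k' x h b) (C := |c| * (1 + |q|)) hδ A
    (fun t k' x h b => by
      rw [abs_mul]
      refine mul_le_mul_of_nonneg_left ?_ (abs_nonneg c)
      by_cases ht : t ∈ E
      · simp only [reportExcess, ht, Set.indicator_of_mem]
        refine (abs_sub _ _).trans (add_le_add_left ?_ _)
        split_ifs <;> simp
      · simp only [reportExcess, ht, not_false_eq_true, Set.indicator_of_notMem, abs_zero]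
        positivity)
    (fun t ht k' x h b => by simp [reportExcess, ht])
    (fun t ht k' x h hA' => by
      obtain ⟨hp, -, -, hp1⟩ := precision_mem hL hLH hH (x i)
      have e := M.sum_jointReportLaw_mul t k' x h i
        (fun u => c * ((if u = k then 1 else 0) - q))
      simp only [mean, reportExcess, ht, Set.indicator_of_mem]
      rw [e, hM.reportLaw_eq hL hLH hH ht]
      simp only [Fintype.sum_bool, signalLaw_real (by linarith : 0 ≤ precision pL pH (x i)) hp1.le]
      refine le_trans (le_of_eq ?_) (hA k' x hA')
      cases k <;> cases k' <;> simp <;> ring)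
  refine Summable.of_nonneg_of_le (fun n => measureReal_nonneg) (fun n => ?_) hs
  refine measureReal_mono fun ω hω => ⟨hω.1, ?_⟩
  have e : pathSum (fun t k' x h b => c * reportExcess E i k q t k' x h b) θ types y n ω =
      c * totalExcess E i k q n (hist y n ω) := by
    simp only [pathSum, ← Finset.mul_sum, totalExcess]
    congr 1
    exact pathSum_eq_histSum (reportExcess E i k q) (fun _ => true) (fun _ _ => true) y n ω
  rw [e]
  have : 0 ≤ η * n := by positivity
  linarith [hω.2]

lemma ae_hist_ne_zero (n : ℕ) :
    ∀ᵐ ω ∂P, P {ω' | hist y n ω' = hist y n ω} ≠ 0 :=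
  ae_measure_fiber_ne_zero P (hist y n)

lemma Assumptions.measurableSet_type (hM : M.Assumptions P θ types y v tauSq rhoC S E)
    (i : Fin N) (u : Bool) : MeasurableSet {ω | types ω i = u} :=
  ((measurable_pi_apply i).comp hM.path.measurable_types) (measurableSet_singleton u)

lemma Assumptions.measurableSet_state (hM : M.Assumptions P θ types y v tauSq rhoC S E)
    (k : Bool) : MeasurableSet {ω | θ ω = k} :=
  hM.path.measurable_state (measurableSet_singleton k)

variable [IsProbabilityMeasure P]

/-! ### Reputations -/

/-- The test of the type of expert `i`: both reports are rare among his scored reports. -/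
def lowTest (pL pH : ℝ) (E : Set ℕ) (i : Fin N) (n : ℕ) : Set (Hist N n) :=
  {h | ∀ k, totalExcess E i k ((pL + pH) / 2) n h ≤ 0}

/-- The report that matches the state has frequency `pH` and exceeds the midpoint. The test cannot
know which report that is, which is why it requires both to be rare. -/
lemma Assumptions.summable_high_lowTest (hM : M.Assumptions P θ types y v tauSq rhoC S E)
    (hL : 1 / 2 ≤ pL) (hLH : pL < pH) (hH : pH < 1) (i : Fin N) :
    Summable fun n => P.real ({ω | types ω i = true} ∩ {ω | hist y n ω ∈ lowTest pL pH E i n}) := by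
  have h := fun k => hM.summable_totalExcess hL hLH hH i k ((pL + pH) / 2) (-1)
    (δ := (pH - pL) / 2) (by linarith) (fun k' x => k' = k ∧ x i = true) (by
      rintro k' x ⟨rfl, hx⟩
      simp only [hx, if_true, precision]
      linarith)
  refine Summable.of_nonneg_of_le (fun n => measureReal_nonneg) (fun n => ?_)
    ((h true).add (h false))
  refine le_trans (measureReal_mono (fun ω hω => ?_)) (measureReal_union_le _ _)
  obtain ⟨h1, h2⟩ := hω
  have h3 := h2 (θ ω)
  cases hθ : θ ω
  · rw [hθ] at h3
    exact Or.inr ⟨⟨hθ, h1⟩, by linarith⟩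
  · rw [hθ] at h3
    exact Or.inl ⟨⟨hθ, h1⟩, by linarith⟩

/-- For a low type each report has frequency `pL` or `1 - pL`, and both are at most `pL` because `pL
≥ 1 / 2`. -/
lemma Assumptions.summable_low_not_lowTest (hM : M.Assumptions P θ types y v tauSq rhoC S E)
    (hL : 1 / 2 ≤ pL) (hLH : pL < pH) (hH : pH < 1) (i : Fin N) :
    Summable fun n =>
      P.real ({ω | types ω i = false} ∩ {ω | hist y n ω ∉ lowTest pL pH E i n}) := by
  have h := fun k => hM.summable_totalExcess hL hLH hH i k ((pL + pH) / 2) 1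
    (δ := (pH - pL) / 2) (by linarith) (fun _ x => x i = false) (by
      rintro k' x hx
      simp only [hx, precision]
      split_ifs <;> simp_all <;> linarith)
  refine Summable.of_nonneg_of_le (fun n => measureReal_nonneg) (fun n => ?_)
    ((h true).add (h false))
  refine le_trans (measureReal_mono (fun ω hω => ?_)) (measureReal_union_le _ _)
  obtain ⟨h1, h2⟩ := hω
  have h3 : ∃ k, 0 < totalExcess E i k ((pL + pH) / 2) n (hist y n ω) := by
    by_contra! hc
    exact h2 hc
  obtain ⟨k, hk⟩ := h3
  cases k
  · exact Or.inr ⟨h1, by linarith⟩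
  · exact Or.inl ⟨h1, by linarith⟩

/-- The public history identifies the types: the posterior probability of the true type of an
expert tends to one. -/
lemma Assumptions.ae_tendsto_posterior_type (hM : M.Assumptions P θ types y v tauSq rhoC S E)
    (hL : 1 / 2 ≤ pL) (hLH : pL < pH) (hH : pH < 1) :
    ∀ᵐ ω ∂P, ∀ i, Tendsto (fun n => posterior P y {ω' | types ω' i = types ω i} n (hist y n ω))
      atTop (𝓝 1) := by
  rw [ae_all_iff]
  intro i
  have hy := hM.path.measurable_reports
  have hm := hM.measurableSet_type i
  have h1 := ae_tendsto_posterior_zero hy (hm true) (hm false) (lowTest pL pH E i)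
    (hM.summable_high_lowTest hL hLH hH i) (hM.summable_low_not_lowTest hL hLH hH i)
  have h2 := ae_tendsto_posterior_zero hy (hm false) (hm true) (fun n => (lowTest pL pH E i n)ᶜ)
    (hM.summable_low_not_lowTest hL hLH hH i)
    (by simpa using hM.summable_high_lowTest hL hLH hH i)
  have key : ∀ (u : Bool) (ω : Ω), (∀ n, P {ω' | hist y n ω' = hist y n ω} ≠ 0) →
      Tendsto (fun n => posterior P y {ω' | types ω' i = !u} n (hist y n ω)) atTop (𝓝 0) →
      Tendsto (fun n => posterior P y {ω' | types ω' i = u} n (hist y n ω)) atTop (𝓝 1) := by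
    intro u ω hne hlim
    have e : {ω' | types ω' i = u} = {ω' | types ω' i = !u}ᶜ := by
      ext ω'
      change types ω' i = u ↔ ¬ types ω' i = !u
      cases u <;> cases types ω' i <;> simp
    have h3 := hlim.const_sub 1
    rw [sub_zero] at h3
    refine h3.congr fun n => ?_
    rw [e, posterior_compl (hm (!u)) n _ (hne n)]
  filter_upwards [h1, h2, ae_all_iff.2 (ae_hist_ne_zero (P := P) (y := y))]
    with ω h1 h2 h3
  cases hu : types ω i
  · exact key false ω h3 (h1 hu)
  · exact key true ω h3 (h2 hu)

lemma Assumptions.ae_tendsto_reputation (hM : M.Assumptions P θ types y v tauSq rhoC S E)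
    (hL : 1 / 2 ≤ pL) (hLH : pL < pH) (hH : pH < 1) :
    ∀ᵐ ω ∂P, ∀ i, Tendsto (fun t => reputation P types y i t ω) atTop
      (𝓝 (if types ω i then 1 else 0)) := by
  filter_upwards [hM.ae_tendsto_posterior_type hL hLH hH,
    ae_all_iff.2 (ae_hist_ne_zero (P := P) (y := y))] with ω hω hne i
  cases hu : types ω i
  · have h1 := (hω i).const_sub 1
    rw [sub_self] at h1
    simp only [Bool.false_eq_true, if_false]
    refine h1.congr fun n => ?_
    have e : {ω' | types ω' i = true} = {ω' | types ω' i = types ω i}ᶜ := by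
      rw [hu]
      ext ω'
      change types ω' i = true ↔ ¬ types ω' i = false
      simp
    rw [reputation, e, posterior_compl (hM.measurableSet_type i _) n _ (hne n)]
  · have h1 := hω i
    rw [hu] at h1
    exact h1

/-! ### The public belief -/

/-- One threshold must work without knowledge of the type. If `pL = 1 / 2`, the uninformative type
makes wrong reports with frequency `1 / 2`, so the threshold moves up to halfway between `1 / 2` and
`pH`. -/
lemma exists_threshold (hL : 1 / 2 ≤ pL) (hLH : pL < pH) : ∃ q δ : ℝ, 0 < δ ∧ ∀ x : Bool,
    1 - precision pL pH x - q ≤ -δ ∧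
      (1 / 2 < precision pL pH x → δ ≤ precision pL pH x - q) := by
  by_cases h : 1 / 2 < pL
  · refine ⟨1 / 2, pL - 1 / 2, by linarith, fun x => ?_⟩
    cases x <;> simp only [precision, Bool.false_eq_true, if_true, if_false] <;>
      exact ⟨by linarith, fun _ => by linarith⟩
  · refine ⟨(1 / 2 + pH) / 2, (pH - 1 / 2) / 2, by linarith, fun x => ?_⟩
    cases x <;> simp only [precision, Bool.false_eq_true, if_true, if_false] <;>
      exact ⟨by linarith, fun _ => by linarith⟩

/-- One informative expert is enough: his scored reports `k` are frequent in state `k`, while in the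
other state they are rare whatever his type. -/
lemma Assumptions.ae_tendsto_posterior_state (hM : M.Assumptions P θ types y v tauSq rhoC S E)
    (hL : 1 / 2 ≤ pL) (hLH : pL < pH) (hH : pH < 1) (k : Bool) (i : Fin N) :
    ∀ᵐ ω ∂P, θ ω = k ∧ 1 / 2 < precision pL pH (types ω i) →
      Tendsto (fun n => posterior P y {ω' | θ ω' = !k} n (hist y n ω)) atTop (𝓝 0) := by
  obtain ⟨q, δ, hδ, hq⟩ := exists_threshold hL hLH
  have h1 := hM.summable_totalExcess hL hLH hH i k q 1 hδ (fun k' _ => k' = !k) (by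
    rintro k' x rfl
    simpa using (hq (x i)).1)
  have h2 := hM.summable_totalExcess hL hLH hH i k q (-1) hδ
    (fun k' x => k' = k ∧ 1 / 2 < precision pL pH (x i)) (by
      rintro k' x ⟨rfl, hx⟩
      have := (hq (x i)).2 hx
      simp only [if_true]
      linarith)
  have hB : MeasurableSet {ω | θ ω = k ∧ 1 / 2 < precision pL pH (types ω i)} :=
    (hM.measurableSet_state k).inter
      (((measurable_pi_apply i).comp hM.path.measurable_types)
        (MeasurableSet.of_discrete (s := {u | 1 / 2 < precision pL pH u})))
  refine ae_tendsto_posterior_zero hM.path.measurable_reports (hM.measurableSet_state (!k)) hB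
    (fun n => {h | 0 < totalExcess E i k q n h}) ?_ ?_
  · refine Summable.of_nonneg_of_le (fun n => measureReal_nonneg) (fun n => ?_) h1
    refine measureReal_mono fun ω hω => ⟨hω.1, ?_⟩
    have h3 : 0 < totalExcess E i k q n (hist y n ω) := hω.2
    linarith
  · refine Summable.of_nonneg_of_le (fun n => measureReal_nonneg) (fun n => ?_) h2
    refine measureReal_mono fun ω hω => ⟨hω.1, ?_⟩
    have h3 : ¬ 0 < totalExcess E i k q n (hist y n ω) := hω.2
    linarith

lemma Assumptions.ae_tendsto_belief (hM : M.Assumptions P θ types y v tauSq rhoC S E)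
    (hL : 1 / 2 ≤ pL) (hLH : pL < pH) (hH : pH < 1) :
    ∀ᵐ ω ∂P, (∃ i, 1 / 2 < precision pL pH (types ω i)) →
      Tendsto (fun t => belief P θ y t ω) atTop (𝓝 (if θ ω then 1 else 0)) := by
  have h := fun k i => hM.ae_tendsto_posterior_state hL hLH hH k i
  filter_upwards [ae_all_iff.2 fun k => ae_all_iff.2 (h k),
    ae_all_iff.2 (ae_hist_ne_zero (P := P) (y := y))] with ω hω hne
  rintro ⟨i, hi⟩
  have h1 := hω (θ ω) i ⟨rfl, hi⟩
  cases hθ : θ ω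
  · rw [hθ] at h1
    exact h1
  · rw [hθ] at h1
    have h2 := h1.const_sub 1
    rw [sub_zero] at h2
    simp only [if_true]
    refine h2.congr fun n => ?_
    have e : {ω' | θ ω' = true} = {ω' | θ ω' = !true}ᶜ := by
      ext ω'
      change θ ω' = true ↔ ¬ θ ω' = false
      simp
    rw [belief, e, posterior_compl (hM.measurableSet_state _) n _ (hne n)]

end BinaryPanel

namespace BinaryPanel

variable {N : ℕ} {pL pH : ℝ} {M : BinaryPanel N pL pH} {Ω : Type*} [MeasurableSpace Ω]
  {P : Measure Ω} {θ : Ω → Bool} {types : Ω → Profile N} {y : ℕ → Ω → Profile N}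
  {v : (t : ℕ) → Bool → Profile N → Hist N t → Fin N → ℝ}
  {tauSq : (t : ℕ) → Bool → Profile N → Hist N t → ℝ} {rhoC : ℝ}
  {S : Bool → Measure Bool → Bool → ℝ} {E : Set ℕ}

/-! ### Reputations from scored rounds -/

/-- The difference of the scores of the truthful laws of the two types on scored dates. -/
def scoreGap (pL pH : ℝ) (S : Bool → Measure Bool → Bool → ℝ) (E : Set ℕ) (i : Fin N) :
    Increment N :=
  fun t k _ _ b => E.indicator (fun _ => S k (signalLaw pH k) (b i) - S k (signalLaw pL k) (b i)) t

lemma signalLaw_ne (hL : 1 / 2 ≤ pL) (hLH : pL < pH) (hH : pH < 1) (k : Bool) :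
    signalLaw pH k ≠ signalLaw pL k := by
  intro h
  have h1 := signalLaw_real (p := pH) (by linarith) hH.le k k
  rw [h, signalLaw_real (by linarith) (by linarith)] at h1
  simp only [if_true] at h1
  linarith

/-- The score gap has positive drift for the high type and negative drift for the low type. -/
lemma Assumptions.exists_mean_scoreGap (hM : M.Assumptions P θ types y v tauSq rhoC S E)
    (hL : 1 / 2 ≤ pL) (hLH : pL < pH) (hH : pH < 1) (i : Fin N) : ∃ δ : ℝ, 0 < δ ∧
      ∀ t ∈ E, ∀ k x h, (if x i then -1 else 1) * M.mean (scoreGap pL pH S E i) t k x h ≤ -δ := by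
  have hmem : ∀ u k, signalLaw (precision pL pH u) k ∈ fullSupportLaws := fun u k => by
    obtain ⟨h1, -, -, h2⟩ := precision_mem hL hLH hH u
    exact signalLaw_mem (by linarith) h2 k
  set Δ : Bool → Bool → ℝ := fun u k =>
    ∫ b, S k (signalLaw (precision pL pH u) k) b ∂signalLaw (precision pL pH u) k -
      ∫ b, S k (signalLaw (precision pL pH (!u)) k) b ∂signalLaw (precision pL pH u) k with hΔ
  have hpos : ∀ u k, 0 < Δ u k := by
    intro u k
    refine sub_pos.2 ((hM.proper k _ (hmem u k) _ (hmem (!u) k)).2 ?_)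
    cases u
    · exact signalLaw_ne hL hLH hH k
    · exact (signalLaw_ne hL hLH hH k).symm
  -- Propriety gives a positive gap for each type and state; finiteness makes it uniform.
  obtain ⟨z, hz⟩ := Finite.exists_min fun z : Bool × Bool => Δ z.1 z.2
  refine ⟨Δ z.1 z.2, hpos _ _, fun t ht k x h => ?_⟩
  have hle := hz (x i, k)
  refine le_trans (le_of_eq ?_) (neg_le_neg hle)
  have hprob := (hmem (x i) k).1
  have e := M.sum_jointReportLaw_mul t k x h i
    (fun u => S k (signalLaw pH k) u - S k (signalLaw pL k) u)
  simp only [mean, scoreGap, ht, Set.indicator_of_mem]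
  rw [e, hM.reportLaw_eq hL hLH hH ht]
  simp only [hΔ]
  rw [integral_fintype .of_finite, integral_fintype .of_finite]
  cases x i <;> simp [precision] <;> ring

lemma Assumptions.ae_tendsto_scoreGap [IsProbabilityMeasure P]
    (hM : M.Assumptions P θ types y v tauSq rhoC S E)
    (hL : 1 / 2 ≤ pL) (hLH : pL < pH) (hH : pH < 1) (i : Fin N) :
    ∀ᵐ ω ∂P, Tendsto (fun n => (if types ω i then 1 else -1) *
      pathSum (scoreGap pL pH S E i) θ types y n ω) atTop atTop := by
  obtain ⟨δ, hδ, hmean⟩ := hM.exists_mean_scoreGap hL hLH hH i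
  set g : Increment N := fun t k x h b => (if x i then -1 else 1) * scoreGap pL pH S E i t k x h b
    with hg
  set f : Bool × Bool → ℝ := fun z => |S z.1 (signalLaw pH z.1) z.2 - S z.1 (signalLaw pL z.1) z.2|
    with hf
  have hbound : ∀ t k x h b, |g t k x h b| ≤ ∑ z, f z := by
    intro t k x h b
    have h1 : |g t k x h b| = |scoreGap pL pH S E i t k x h b| := by
      simp only [hg]; split_ifs <;> simp
    rw [h1]
    by_cases ht : t ∈ E
    · simp only [scoreGap, ht, Set.indicator_of_mem]
      exact Finset.single_le_sum (f := f) (fun _ _ => abs_nonneg _) (Finset.mem_univ (k, b i))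
    · simp only [scoreGap, ht, not_false_eq_true, Set.indicator_of_notMem, abs_zero]
      exact Finset.sum_nonneg fun _ _ => abs_nonneg _
  obtain ⟨η, hη, hs⟩ := hM.path.exists_summable_drift hM.density (g := g) hδ (fun _ _ => True) hbound
    (fun t ht k x h b => by simp [hg, scoreGap, ht])
    (fun t ht k x h _ => by
      refine le_trans (le_of_eq ?_) (hmean t ht k x h)
      simp only [mean, hg]
      rw [Finset.mul_sum]
      exact Finset.sum_congr rfl fun b _ => by ring)
  filter_upwards [ae_eventually_not_of_summable hs] with ω hω
  refine tendsto_atTop_mono' atTop ?_ (tendsto_natCast_atTop_atTop.const_mul_atTop hη)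
  filter_upwards [hω] with n hn
  have e : pathSum g θ types y n ω =
      -((if types ω i then 1 else -1) * pathSum (scoreGap pL pH S E i) θ types y n ω) := by
    simp only [pathSum, hg, ← Finset.mul_sum]
    split_ifs <;> ring
  simp only [true_and] at hn
  rw [e] at hn
  have h2 : ¬ -(η * n) ≤
      -((if types ω i then 1 else -1) * pathSum (scoreGap pL pH S E i) θ types y n ω) := hn
  linarith

lemma tendsto_weighted_exp {a : ℝ} (ha : a ∈ Set.Ioo (0 : ℝ) 1) {f g : ℕ → ℝ}
    (h : Tendsto (fun n => f n - g n) atTop atTop) :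
    Tendsto (fun n => a * Real.exp (f n) / (a * Real.exp (f n) + (1 - a) * Real.exp (g n))) atTop
      (𝓝 1) := by
  obtain ⟨h0, h1⟩ := ha
  have h2 : Tendsto (fun n => Real.exp (-(f n - g n))) atTop (𝓝 0) :=
    Real.tendsto_exp_neg_atTop_nhds_zero.comp h
  have h3 : Tendsto (fun n => a / (a + (1 - a) * Real.exp (-(f n - g n)))) atTop
      (𝓝 (a / (a + (1 - a) * 0))) :=
    tendsto_const_nhds.div (tendsto_const_nhds.add (h2.const_mul _)) (by simpa using h0.ne')
  rw [mul_zero, add_zero, div_self h0.ne'] at h3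
  refine h3.congr fun n => ?_
  have e : Real.exp (g n) = Real.exp (f n) * Real.exp (-(f n - g n)) := by
    rw [← Real.exp_add]; ring_nf
  have hp := (Real.exp_pos (f n)).ne'
  rw [e, show a * Real.exp (f n) + (1 - a) * (Real.exp (f n) * Real.exp (-(f n - g n))) =
    Real.exp (f n) * (a + (1 - a) * Real.exp (-(f n - g n))) by ring, mul_comm a (Real.exp (f n)),
    mul_div_mul_left _ _ hp]

lemma Assumptions.ae_tendsto_scoredReputation [IsProbabilityMeasure P]
    (hM : M.Assumptions P θ types y v tauSq rhoC S E)
    (hL : 1 / 2 ≤ pL) (hLH : pL < pH) (hH : pH < 1) :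
    ∀ᵐ ω ∂P, ∀ i, Tendsto (fun t => M.scoredReputation θ y S E i t ω) atTop
      (𝓝 (if types ω i then 1 else 0)) := by
  filter_upwards [ae_all_iff.2 fun i => hM.ae_tendsto_scoreGap hL hLH hH i] with ω hω i
  set tot : ℝ → ℕ → ℝ := fun p t => ∑ s ∈ Finset.range t,
    E.indicator (fun s => S (θ ω) (signalLaw p (θ ω)) (y s ω i)) s with htot
  have e : ∀ n, pathSum (scoreGap pL pH S E i) θ types y n ω = tot pH n - tot pL n := by
    intro n
    simp only [pathSum, htot, ← Finset.sum_sub_distrib]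
    refine Finset.sum_congr rfl fun t _ => ?_
    by_cases ht : t ∈ E <;> simp [scoreGap, ht]
  have hrep : ∀ n, M.scoredReputation θ y S E i n ω = M.highPrior * Real.exp (tot pH n) /
      (M.highPrior * Real.exp (tot pH n) + (1 - M.highPrior) * Real.exp (tot pL n)) := fun n => rfl
  have h := hω i
  simp only [e] at h
  simp only [hrep]
  obtain ⟨h0, h1⟩ := M.highPrior_mem
  cases hu : types ω i
  · simp only [hu, Bool.false_eq_true, if_false] at h ⊢
    -- For a low type the weight of the low type tends to one; the reputation is its complement.
    have h2 := (tendsto_weighted_exp (a := 1 - M.highPrior) ⟨by linarith, by linarith⟩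
      (f := tot pL) (g := tot pH) (h.congr fun n => by ring)).const_sub 1
    rw [sub_self] at h2
    refine h2.congr fun n => ?_
    have a1 := Real.exp_pos (tot pH n)
    have a2 := Real.exp_pos (tot pL n)
    have a3 : 0 < 1 - M.highPrior := by linarith
    have a4 : 0 < M.highPrior * Real.exp (tot pH n) + (1 - M.highPrior) * Real.exp (tot pL n) := by
      positivity
    rw [sub_sub_cancel, add_comm, eq_div_iff a4.ne', sub_mul, one_mul,
      div_mul_cancel₀ _ a4.ne']
    ring
  · simp only [hu, if_true, one_mul] at h ⊢
    exact tendsto_weighted_exp ⟨h0, h1⟩ h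

/-! ### Divergence of the report laws in the two states -/

/-- The smallest precision above `1 / 2`. -/
def leastPrecision (pL pH : ℝ) : ℝ := if 1 / 2 < pL then pL else pH

lemma half_lt_leastPrecision (hL : 1 / 2 ≤ pL) (hLH : pL < pH) : 1 / 2 < leastPrecision pL pH := by
  rw [leastPrecision]; split_ifs <;> linarith

lemma leastPrecision_le (hLH : pL < pH) {x : Bool} (h : 1 / 2 < precision pL pH x) :
    leastPrecision pL pH ≤ precision pL pH x := by
  rw [leastPrecision]
  cases x <;> simp only [precision, Bool.false_eq_true, if_true, if_false] at h ⊢ <;>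
    split_ifs <;> linarith

/-- The joint laws of scored reports in the two states diverge uniformly. -/
lemma Assumptions.le_klDiv_jointReportLaw (hM : M.Assumptions P θ types y v tauSq rhoC S E)
    (hL : 1 / 2 ≤ pL) (hLH : pL < pH) (hH : pH < 1) {t : ℕ} (ht : t ∈ E) (x : Profile N)
    (h : Hist N t) (hx : ∃ i, 1 / 2 < precision pL pH (x i)) (k : Bool) :
    ENNReal.ofReal ((2 * leastPrecision pL pH - 1) ^ 2 / 2) ≤
      InformationTheory.klDiv (M.jointReportLaw t k x h) (M.jointReportLaw t (!k) x h) := by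
  obtain ⟨i, hi⟩ := hx
  have h1 := leastPrecision_le hLH hi
  have h2 := half_lt_leastPrecision hL hLH
  obtain ⟨h3, -, -, h4⟩ := precision_mem hL hLH hH (x i)
  refine ofReal_sq_le_klDiv _ _ (A := {b | b i = k}) .of_discrete (by linarith) ?_
  rw [M.jointReportLaw_real_eval, M.jointReportLaw_real_eval, hM.reportLaw_eq hL hLH hH ht,
    hM.reportLaw_eq hL hLH hH ht, signalLaw_real (by linarith) h4.le,
    signalLaw_real (by linarith) h4.le]
  simp only [if_true, Bool.eq_not_self, if_false]
  linarith

/-- The joint probability of the state, the history and the next report of an expert. -/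
lemma IsPath.measureReal_state_hist_report [IsProbabilityMeasure P] (hM : M.IsPath P θ types y) (t : ℕ) (k : Bool)
    (h : Hist N t) (i : Fin N) (u : Bool) :
    P.real {ω | (θ ω = k ∧ hist y t ω = h) ∧ y t ω i = u} =
      ∑ x, P.real {ω | θ ω = k ∧ types ω = x ∧ hist y t ω = h} *
        (M.reportLaw t i (x i) k h).real {u} := by
  have e := hM.integral_mul_report t (fun k' _ h' => if k' = k ∧ h' = h then (1 : ℝ) else 0)
    (fun _ _ _ b => if b i = u then (1 : ℝ) else 0)
  have hmeas : MeasurableSet {ω | (θ ω = k ∧ hist y t ω = h) ∧ y t ω i = u} :=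
    ((hM.measurable_state (measurableSet_singleton k)).inter
      (measurableSet_hist_eq hM.measurable_reports t h)).inter
      (((measurable_pi_apply i).comp (hM.measurable_reports t)) (measurableSet_singleton u))
  have e1 : ∫ ω, (if θ ω = k ∧ hist y t ω = h then (1 : ℝ) else 0) *
      (if y t ω i = u then (1 : ℝ) else 0) ∂P =
      P.real {ω | (θ ω = k ∧ hist y t ω = h) ∧ y t ω i = u} := by
    rw [← integral_indicator_one hmeas]
    refine integral_congr_ae (ae_of_all _ fun ω => ?_)
    by_cases h1 : θ ω = k ∧ hist y t ω = h <;> by_cases h2 : y t ω i = u <;>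
      simp [h1, h2]
  rw [← e1, e, integral_comp_fintype P (hM.measurable_past t)
    (fun z => (if z.1 = k ∧ z.2.2 = h then (1 : ℝ) else 0) *
      ∑ b, (M.jointReportLaw t z.1 z.2.1 z.2.2).real {b} * (if b i = u then (1 : ℝ) else 0)),
    Fintype.sum_prod_type, Finset.sum_eq_single k]
  · rw [Fintype.sum_prod_type]
    refine Finset.sum_congr rfl fun x _ => ?_
    rw [Finset.sum_eq_single h]
    · have e2 := M.sum_jointReportLaw_mul t k x h i (fun b => if b = u then (1 : ℝ) else 0)
      simp only [and_self, if_true, one_mul]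
      rw [e2]
      have e3 : {ω | (θ ω, types ω, hist y t ω) = (k, x, h)} =
          {ω | θ ω = k ∧ types ω = x ∧ hist y t ω = h} := by
        ext ω; simp [Prod.ext_iff]
      rw [e3]
      simp
    · intro h' _ hne; simp [hne]
    · exact fun hn => absurd (Finset.mem_univ _) hn
  · intro k' _ hne; simp [hne]
  · exact fun hn => absurd (Finset.mem_univ _) hn

lemma IsPath.measureReal_state_hist [IsProbabilityMeasure P] (hM : M.IsPath P θ types y) (t : ℕ) (k : Bool)
    (h : Hist N t) : P.real {ω | θ ω = k ∧ hist y t ω = h} =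
      ∑ x, P.real {ω | θ ω = k ∧ types ω = x ∧ hist y t ω = h} := by
  have hm : MeasurableSet {ω | θ ω = k ∧ hist y t ω = h} :=
    (hM.measurable_state (measurableSet_singleton k)).inter
      (measurableSet_hist_eq hM.measurable_reports t h)
  have e := integral_comp_fintype (P.restrict {ω | θ ω = k ∧ hist y t ω = h}) hM.measurable_types
    (fun _ => (1 : ℝ))
  simp only [integral_const, smul_eq_mul, mul_one, measureReal_restrict_apply_univ] at e
  rw [e]
  refine Finset.sum_congr rfl fun x _ => ?_
  rw [measureReal_restrict_apply
    (show MeasurableSet {ω | types ω = x} from hM.measurable_types (measurableSet_singleton x))]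
  congr 1
  ext ω
  change types ω = x ∧ θ ω = k ∧ hist y t ω = h ↔ θ ω = k ∧ types ω = x ∧ hist y t ω = h
  tauto

/-- The predictive laws of scored reports in the two states diverge uniformly. -/
lemma Assumptions.le_klDiv_predictive [IsProbabilityMeasure P]
    (hM : M.Assumptions P θ types y v tauSq rhoC S E)
    (hN : 0 < N) (hL : 1 / 2 < pL) (hLH : pL < pH) (hH : pH < 1) {t : ℕ} (ht : t ∈ E)
    (h : Hist N t) (hh : ∀ k, P {ω | θ ω = k ∧ hist y t ω = h} ≠ 0) (k : Bool) :
    ENNReal.ofReal ((2 * leastPrecision pL pH - 1) ^ 2 / 2) ≤ InformationTheory.klDiv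
      ((ProbabilityTheory.cond P {ω | θ ω = k ∧ hist y t ω = h}).map (y t))
      ((ProbabilityTheory.cond P {ω | θ ω = !k ∧ hist y t ω = h}).map (y t)) := by
  set i : Fin N := ⟨0, hN⟩
  have hy := hM.path.measurable_reports
  have hc := fun k => cond_isProbabilityMeasure (hh k)
  have hprob : ∀ k, IsProbabilityMeasure
      ((ProbabilityTheory.cond P {ω | θ ω = k ∧ hist y t ω = h}).map (y t)) := fun k =>
    Measure.isProbabilityMeasure_map (hy t).aemeasurable
  have hp0 : leastPrecision pL pH = pL := if_pos hL
  -- Given the history, the type distribution may differ between the states. In each state the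
  -- frequency of report `k` is still an average over types, at least `pL` in state `k` and at most
  -- `1 - pL` in the other.
  have hval : ∀ k', ((ProbabilityTheory.cond P {ω | θ ω = k' ∧ hist y t ω = h}).map (y t)).real
      {b | b i = k} = (∑ x, P.real {ω | θ ω = k' ∧ types ω = x ∧ hist y t ω = h} *
        (if k = k' then precision pL pH (x i) else 1 - precision pL pH (x i))) /
        ∑ x, P.real {ω | θ ω = k' ∧ types ω = x ∧ hist y t ω = h} := by
    intro k'
    have hm : MeasurableSet {ω | θ ω = k' ∧ hist y t ω = h} :=
      (hM.measurableSet_state k').inter (measurableSet_hist_eq hy t h)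
    rw [map_measureReal_apply (hy t) .of_discrete, measureReal_def, cond_apply hm,
      ENNReal.toReal_mul, ENNReal.toReal_inv, ← hM.path.measureReal_state_hist, div_eq_inv_mul]
    congr 1
    have e := hM.path.measureReal_state_hist_report t k' h i k
    refine Eq.trans e (Finset.sum_congr rfl fun x _ => ?_)
    obtain ⟨h3, -, -, h4⟩ := precision_mem hL.le hLH hH (x i)
    rw [hM.reportLaw_eq hL.le hLH hH ht, signalLaw_real (by linarith) h4.le]
  have hpos : ∀ k', 0 < ∑ x, P.real {ω | θ ω = k' ∧ types ω = x ∧ hist y t ω = h} := by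
    intro k'
    rw [← hM.path.measureReal_state_hist]
    exact ENNReal.toReal_pos (hh k') (measure_ne_top _ _)
  refine ofReal_sq_le_klDiv _ _ (A := {b | b i = k}) .of_discrete (by rw [hp0]; linarith) ?_
  have hlow : pL ≤ ((ProbabilityTheory.cond P {ω | θ ω = k ∧ hist y t ω = h}).map (y t)).real
      {b | b i = k} := by
    rw [hval, le_div_iff₀ (hpos k), Finset.mul_sum]
    refine Finset.sum_le_sum fun x _ => ?_
    rw [mul_comm]
    obtain ⟨-, h3, -, -⟩ := precision_mem hL.le hLH hH (x i)
    simpa using mul_le_mul_of_nonneg_left h3 measureReal_nonneg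
  have hup : ((ProbabilityTheory.cond P {ω | θ ω = !k ∧ hist y t ω = h}).map (y t)).real
      {b | b i = k} ≤ 1 - pL := by
    rw [hval, div_le_iff₀ (hpos _), Finset.mul_sum]
    refine Finset.sum_le_sum fun x _ => ?_
    rw [mul_comm (1 - pL)]
    obtain ⟨-, h3, -, -⟩ := precision_mem hL.le hLH hH (x i)
    have : 1 - precision pL pH (x i) ≤ 1 - pL := by linarith
    simpa using mul_le_mul_of_nonneg_left this measureReal_nonneg
  rw [hp0]
  linarith

end BinaryPanel

namespace BinaryPanel

variable {N : ℕ} {pL pH : ℝ}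

/-! ### Log-likelihood increments -/

/-- Likelihood of the report `b` of expert `i` in state `k` at reputation `r`. -/
def mixedLikelihood (M : BinaryPanel N pL pH) (t : ℕ) (h : Hist N t) (i : Fin N) (r : ℝ)
    (k b : Bool) : ℝ :=
  r * (M.reportLaw t i true k h).real {b} + (1 - r) * (M.reportLaw t i false k h).real {b}

/-- The sign of a state. -/
def stateSign (k : Bool) : ℝ := if k then 1 else -1

section Mixed

variable (M : BinaryPanel N pL pH) (t : ℕ) (h : Hist N t) (i : Fin N) {r : ℝ}

lemma mixedLikelihood_pos (h0 : 0 ≤ r) (h1 : r ≤ 1) (k b : Bool) :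
    0 < M.mixedLikelihood t h i r k b := by
  have a1 := M.reportLaw_real_pos t i true k h b
  have a2 := M.reportLaw_real_pos t i false k h b
  rw [mixedLikelihood]
  rcases h0.eq_or_lt with rfl | h0
  · simpa using a2
  · have := mul_nonneg (sub_nonneg.2 h1) a2.le
    have := mul_pos h0 a1
    linarith

lemma mixedLikelihood_add (r : ℝ) (k : Bool) :
    M.mixedLikelihood t h i r k true + M.mixedLikelihood t h i r k false = 1 := by
  have a1 := M.reportLaw_real_add t i true k h
  have a2 := M.reportLaw_real_add t i false k h
  rw [mixedLikelihood, mixedLikelihood]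
  linear_combination r * a1 + (1 - r) * a2

lemma mixedLikelihood_le (hL : 1 / 2 ≤ pL) (hLH : pL < pH) (hH : pH < 1) (h0 : 0 ≤ r) (h1 : r ≤ 1)
    (k k' b : Bool) : M.mixedLikelihood t h i r k b ≤
      pH / (1 - pH) * M.mixedLikelihood t h i r k' b := by
  have a1 := mul_le_mul_of_nonneg_left (M.reportLaw_real_le hL hLH hH t i true k k' h b) h0
  have a2 := mul_le_mul_of_nonneg_left (M.reportLaw_real_le hL hLH hH t i false k k' h b)
    (sub_nonneg.2 h1)
  rw [mixedLikelihood, mixedLikelihood]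
  linarith

lemma logRatio_eq (r : ℝ) (b : Bool) : M.logRatio t h i r b =
    Real.log (M.mixedLikelihood t h i r true b / M.mixedLikelihood t h i r false b) := rfl

/-- Full support alone would allow arbitrarily small report probabilities; the bound comes from the
signal's likelihood ratio, which neither garbling nor mixing over types can exceed. -/
lemma abs_logRatio_le (hL : 1 / 2 ≤ pL) (hLH : pL < pH) (hH : pH < 1) (h0 : 0 ≤ r) (h1 : r ≤ 1)
    (b : Bool) : |M.logRatio t h i r b| ≤ Real.log (pH / (1 - pH)) := by
  have hp := M.mixedLikelihood_pos t h i h0 h1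
  have hle := M.mixedLikelihood_le t h i hL hLH hH h0 h1
  have key : ∀ k k', Real.log (M.mixedLikelihood t h i r k b / M.mixedLikelihood t h i r k' b) ≤
      Real.log (pH / (1 - pH)) := fun k k' =>
    Real.log_le_log (div_pos (hp k b) (hp k' b)) ((div_le_iff₀ (hp k' b)).2 (hle k k' b))
  rw [logRatio_eq, abs_le]
  refine ⟨?_, key true false⟩
  have := key false true
  rw [← inv_div, Real.log_inv] at this
  linarith

lemma stateSign_mul_logRatio (h0 : 0 ≤ r) (h1 : r ≤ 1) (k b : Bool) :
    stateSign k * M.logRatio t h i r b =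
      Real.log (M.mixedLikelihood t h i r k b / M.mixedLikelihood t h i r (!k) b) := by
  have hp := M.mixedLikelihood_pos t h i h0 h1
  rw [logRatio_eq]
  cases k
  · rw [← inv_div, Real.log_inv]
    simp [stateSign]
  · simp [stateSign]

/-- The drift of a log-likelihood increment under the true state and type is bounded below by the
log-probability of the true type plus a divergence. -/
lemma le_sum_stateSign_mul_logRatio (x k : Bool) (h0 : 0 ≤ r) (h1 : r ≤ 1)
    (hr : 0 < if x then r else 1 - r) (k' : Bool) {d : ℝ} (hd : 0 ≤ d)
    (hk' : d ≤ (M.reportLaw t i x k h).real {k'} - M.mixedLikelihood t h i r (!k) k') :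
    Real.log (if x then r else 1 - r) + d ^ 2 / 2 ≤
      ∑ u, (M.reportLaw t i x k h).real {u} * (stateSign k * M.logRatio t h i r u) := by
  set r' := if x then r else 1 - r
  have hm := M.mixedLikelihood_pos t h i h0 h1
  have hl := M.reportLaw_real_pos t i x k h
  have hs := M.reportLaw_real_add t i x k h
  have hdiv := sq_le_sum_mul_log hl (hm (!k)) hs (M.mixedLikelihood_add t h i r (!k)) k' hd hk'
  -- The mixture in the true state is at least `r'` times its component at the true type. Averaging
  -- under that component leaves `log r'` plus a divergence.
  have hpt : ∀ u, Real.log r' + Real.log ((M.reportLaw t i x k h).real {u} /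
      M.mixedLikelihood t h i r (!k) u) ≤ stateSign k * M.logRatio t h i r u := by
    intro u
    rw [M.stateSign_mul_logRatio t h i h0 h1, ← Real.log_mul hr.ne' (div_pos (hl u) (hm _ u)).ne',
      mul_div_assoc']
    refine Real.log_le_log (div_pos (mul_pos hr (hl u)) (hm _ u)) ?_
    refine div_le_div_of_nonneg_right ?_ (hm _ u).le
    have a1 := mul_nonneg h0 (M.reportLaw_real_pos t i true k h u).le
    have a2 := mul_nonneg (sub_nonneg.2 h1) (M.reportLaw_real_pos t i false k h u).le
    rw [mixedLikelihood]
    cases x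
    · simp only [r', Bool.false_eq_true, if_false]; linarith
    · simp only [r', if_true]; linarith
  calc Real.log r' + d ^ 2 / 2 ≤ Real.log r' * 1 + ∑ u, (M.reportLaw t i x k h).real {u} *
        Real.log ((M.reportLaw t i x k h).real {u} / M.mixedLikelihood t h i r (!k) u) := by
        linarith
    _ = ∑ u, (M.reportLaw t i x k h).real {u} * (Real.log r' +
        Real.log ((M.reportLaw t i x k h).real {u} / M.mixedLikelihood t h i r (!k) u)) := by
        rw [← hs, Fintype.sum_bool, Fintype.sum_bool]; ring
    _ ≤ _ := Finset.sum_le_sum fun u _ => mul_le_mul_of_nonneg_left (hpt u) (hl u).le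

/-- Covers unscored dates, where the kernel is uncontrolled: the divergence is still nonnegative, so
a drift in the wrong direction is at most `-log` of the reputation of the true type. -/
lemma log_le_sum_stateSign_mul_logRatio (x k : Bool) (h0 : 0 ≤ r) (h1 : r ≤ 1)
    (hr : 0 < if x then r else 1 - r) : Real.log (if x then r else 1 - r) ≤
      ∑ u, (M.reportLaw t i x k h).real {u} * (stateSign k * M.logRatio t h i r u) := by
  have hs := M.reportLaw_real_add t i x k h
  have hm := M.mixedLikelihood_add t h i r (!k)
  have hex : ∃ k', (0 : ℝ) ≤ (M.reportLaw t i x k h).real {k'} -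
      M.mixedLikelihood t h i r (!k) k' := by
    by_contra! hc
    linarith [hc true, hc false]
  obtain ⟨k', hk'⟩ := hex
  have := M.le_sum_stateSign_mul_logRatio t h i x k h0 h1 hr k' le_rfl hk'
  simpa using this

end Mixed

variable {M : BinaryPanel N pL pH} {Ω : Type*} [MeasurableSpace Ω]
  {P : Measure Ω} {θ : Ω → Bool} {types : Ω → Profile N} {y : ℕ → Ω → Profile N}
  {v : (t : ℕ) → Bool → Profile N → Hist N t → Fin N → ℝ}
  {tauSq : (t : ℕ) → Bool → Profile N → Hist N t → ℝ} {rhoC : ℝ}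
  {S : Bool → Measure Bool → Bool → ℝ} {E : Set ℕ}

/-! ### The GLS pool -/

/-- The GLS weights at a state, a type profile and a history. -/
def weight (v : (t : ℕ) → Bool → Profile N → Hist N t → Fin N → ℝ)
    (tauSq : (t : ℕ) → Bool → Profile N → Hist N t → ℝ) (t : ℕ) (k : Bool) (x : Profile N)
    (h : Hist N t) : Fin N → ℝ := glsWeight (intraclass (v t k x h) (tauSq t k x h))

/-- The increment of the GLS pool. -/
def glsIncrement (M : BinaryPanel N pL pH) (P : Measure Ω) (types : Ω → Profile N)
    (y : ℕ → Ω → Profile N) (v : (t : ℕ) → Bool → Profile N → Hist N t → Fin N → ℝ)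
    (tauSq : (t : ℕ) → Bool → Profile N → Hist N t → ℝ) : Increment N :=
  fun t k x h b => weight v tauSq t k x h ⬝ᵥ M.increments P types y t h b

lemma glsLogit_eq (M : BinaryPanel N pL pH) (P : Measure Ω) (θ : Ω → Bool)
    (types : Ω → Profile N) (y : ℕ → Ω → Profile N)
    (v : (t : ℕ) → Bool → Profile N → Hist N t → Fin N → ℝ)
    (tauSq : (t : ℕ) → Bool → Profile N → Hist N t → ℝ) (n : ℕ) (ω : Ω) :
    M.glsLogit P θ types y v tauSq n ω = Real.log (M.prior / (1 - M.prior)) +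
      pathSum (M.glsIncrement P types y v tauSq) θ types y n ω := by
  induction n with
  | zero => simp [glsLogit, pathSum]
  | succ n ih =>
    rw [glsLogit, ih, pathSum, pathSum, Finset.sum_range_succ, add_assoc]
    rfl

lemma Assumptions.weight_nonneg (hM : M.Assumptions P θ types y v tauSq rhoC S E) (t : ℕ) (k : Bool)
    (x : Profile N) (h : Hist N t) (i : Fin N) : 0 ≤ weight v tauSq t k x h i :=
  (glsWeight_pos (hM.shocks.v_pos t k x h) (hM.shocks.tauSq_nonneg t k x h) i).le

lemma Assumptions.sum_weight (hM : M.Assumptions P θ types y v tauSq rhoC S E) (hN : 0 < N) (t : ℕ)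
    (k : Bool) (x : Profile N) (h : Hist N t) : ∑ i, weight v tauSq t k x h i = 1 :=
  sum_glsWeight hN (hM.shocks.v_pos t k x h) (hM.shocks.tauSq_nonneg t k x h)

lemma Assumptions.abs_glsIncrement_le [IsProbabilityMeasure P]
    (hM : M.Assumptions P θ types y v tauSq rhoC S E) (hN : 0 < N)
    (hL : 1 / 2 ≤ pL) (hLH : pL < pH) (hH : pH < 1) (t : ℕ) (k : Bool) (x : Profile N)
    (h : Hist N t) (b : Profile N) :
    |M.glsIncrement P types y v tauSq t k x h b| ≤ Real.log (pH / (1 - pH)) := by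
  rw [glsIncrement, dotProduct]
  refine (Finset.abs_sum_le_sum_abs _ _).trans ?_
  calc _ ≤ ∑ i, weight v tauSq t k x h i * Real.log (pH / (1 - pH)) := by
        refine Finset.sum_le_sum fun i _ => ?_
        rw [abs_mul, abs_of_nonneg (hM.weight_nonneg t k x h i)]
        exact mul_le_mul_of_nonneg_left
          (M.abs_logRatio_le t h i hL hLH hH (posterior_nonneg _ _ _)
            (posterior_le_one hM.path.measurable_reports _ _ _) _) (hM.weight_nonneg t k x h i)
    _ = _ := by rw [← Finset.sum_mul, hM.sum_weight hN, one_mul]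

lemma mean_glsIncrement (t : ℕ) (k : Bool) (x : Profile N) (h : Hist N t) :
    M.mean (M.glsIncrement P types y v tauSq) t k x h = ∑ i, weight v tauSq t k x h i *
      ∑ u, (M.reportLaw t i (x i) k h).real {u} *
        M.logRatio t h i (posterior P y {ω' | types ω' i = true} t h) u := by
  simp only [mean, glsIncrement, dotProduct, Finset.mul_sum (s := (Finset.univ : Finset (Fin N))),
    increments]
  rw [Finset.sum_comm]
  refine Finset.sum_congr rfl fun i _ => ?_
  rw [← M.sum_jointReportLaw_mul, Finset.mul_sum]
  exact Finset.sum_congr rfl fun b _ => by ring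

/-- The finitely many dates before reputations settle cost only a constant depending on the path. -/
lemma sum_ge_of_eventually_ge {a b : ℕ → ℝ} (h : ∀ᶠ t in atTop, b t ≤ a t) :
    ∃ C : ℝ, ∀ n, ∑ t ∈ Finset.range n, b t - C ≤ ∑ t ∈ Finset.range n, a t := by
  obtain ⟨T, hT⟩ := eventually_atTop.1 h
  refine ⟨∑ t ∈ Finset.range T, |b t - a t|, fun n => ?_⟩
  have h1 : ∑ t ∈ Finset.range n, (b t - a t) ≤
      ∑ t ∈ Finset.range n, if t < T then |b t - a t| else 0 := by
    refine Finset.sum_le_sum fun t _ => ?_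
    split_ifs with ht
    · exact le_abs_self _
    · linarith [hT t (not_lt.1 ht)]
  have h2 : (∑ t ∈ Finset.range n, if t < T then |b t - a t| else 0) ≤
      ∑ t ∈ Finset.range T, |b t - a t| := by
    rw [← Finset.sum_filter]
    refine Finset.sum_le_sum_of_subset_of_nonneg (fun t ht => ?_) fun _ _ _ => abs_nonneg _
    simpa using (Finset.mem_filter.1 ht).2
  rw [Finset.sum_sub_distrib] at h1
  linarith

/-- The drift of the GLS pool in the direction of the true state. -/
lemma Assumptions.le_mean_glsIncrement [IsProbabilityMeasure P]
    (hM : M.Assumptions P θ types y v tauSq rhoC S E) (hN : 0 < N)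
    (hL : 1 / 2 ≤ pL) (hLH : pL < pH) (hH : pH < 1) {t : ℕ} (k : Bool) {x : Profile N}
    (h : Hist N t) {ε : ℝ} (hx : ∀ i, 1 / 2 < precision pL pH (x i))
    (hh : P {ω' | hist y t ω' = h} ≠ 0)
    (hpos : ∀ i, 0 < posterior P y {ω' | types ω' i = x i} t h)
    (hlog : ∀ i, -ε ≤ Real.log (posterior P y {ω' | types ω' i = x i} t h)) :
    E.indicator (fun _ => (leastPrecision pL pH - 1 / 2) ^ 2 / 2) t - ε ≤
      stateSign k * M.mean (M.glsIncrement P types y v tauSq) t k x h := by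
  set c := E.indicator (fun _ => (leastPrecision pL pH - 1 / 2) ^ 2 / 2) t - ε with hc
  have hterm : ∀ i, c ≤ ∑ u, (M.reportLaw t i (x i) k h).real {u} *
      (stateSign k * M.logRatio t h i (posterior P y {ω' | types ω' i = true} t h) u) := by
    intro i
    set r := posterior P y {ω' | types ω' i = true} t h with hr
    have h0 : 0 ≤ r := posterior_nonneg _ _ _
    have h1 : r ≤ 1 := posterior_le_one hM.path.measurable_reports _ _ _
    have e : posterior P y {ω' | types ω' i = x i} t h = if x i then r else 1 - r := by
      cases hxi : x i
      · have e1 : {ω' | types ω' i = false} = {ω' | types ω' i = true}ᶜ := by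
          ext ω'
          change types ω' i = false ↔ ¬ types ω' i = true
          simp
        rw [e1, posterior_compl (hM.measurableSet_type i true) t h hh]
        simp [hr]
      · simp [hr]
    have hp := hpos i
    have hl := hlog i
    rw [e] at hp hl
    by_cases ht : t ∈ E
    · obtain ⟨h3, h4, -, h5⟩ := precision_mem hL hLH hH (x i)
      have h6 := leastPrecision_le hLH (hx i)
      have h7 := half_lt_leastPrecision hL hLH
      -- Under truthful reports the true type names state `k` with probability at least
      -- `leastPrecision`, whereas the mixture in the opposite state does so with probability at
      -- most `1 / 2`.
      have key := M.le_sum_stateSign_mul_logRatio t h i (x i) k h0 h1 hp k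
        (d := leastPrecision pL pH - 1 / 2) (by linarith) (by
          rw [mixedLikelihood, hM.reportLaw_eq hL hLH hH ht, hM.reportLaw_eq hL hLH hH ht,
            hM.reportLaw_eq hL hLH hH ht, signalLaw_real (by linarith) h5.le,
            signalLaw_real (by simp only [precision, if_true]; linarith)
              (by simp only [precision, if_true]; linarith),
            signalLaw_real (by simp only [precision, Bool.false_eq_true, if_false]; linarith)
              (by simp only [precision, Bool.false_eq_true, if_false]; linarith)]
          simp only [if_true, Bool.eq_not_self, if_false, precision, Bool.false_eq_true] at h6 ⊢
          nlinarith)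
      simp only [hc, ht, Set.indicator_of_mem]
      linarith
    · have key := M.log_le_sum_stateSign_mul_logRatio t h i (x i) k h0 h1 hp
      simp only [hc, ht, not_false_eq_true, Set.indicator_of_notMem]
      linarith
  have e : stateSign k * M.mean (M.glsIncrement P types y v tauSq) t k x h =
      ∑ i, weight v tauSq t k x h i * ∑ u, (M.reportLaw t i (x i) k h).real {u} *
      (stateSign k * M.logRatio t h i (posterior P y {ω' | types ω' i = true} t h) u) := by
    rw [mean_glsIncrement, Finset.mul_sum]
    refine Finset.sum_congr rfl fun i _ => ?_
    rw [mul_left_comm, Finset.mul_sum]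
    congr 1
    exact Finset.sum_congr rfl fun u _ => by ring
  rw [e]
  calc c = ∑ i, weight v tauSq t k x h i * c := by
        rw [← Finset.sum_mul, hM.sum_weight hN, one_mul]
    _ ≤ _ := Finset.sum_le_sum fun i _ =>
        mul_le_mul_of_nonneg_left (hterm i) (hM.weight_nonneg t k x h i)

/-- The sum is split into conditional means and a bounded centred part of size `o(n)`. The means are
eventually almost nonnegative on all dates and uniformly positive on evaluation dates. -/
lemma Assumptions.ae_tendsto_pathSum_glsIncrement [IsProbabilityMeasure P]
    (hM : M.Assumptions P θ types y v tauSq rhoC S E) (hN : 0 < N)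
    (hL : 1 / 2 ≤ pL) (hLH : pL < pH) (hH : pH < 1) :
    ∀ᵐ ω ∂P, (∀ i, 1 / 2 < precision pL pH (types ω i)) →
      Tendsto (fun n => stateSign (θ ω) *
        pathSum (M.glsIncrement P types y v tauSq) θ types y n ω) atTop atTop := by
  obtain ⟨d, hd, hcount⟩ := exists_mul_le_dateCount hM.density
  set g := M.glsIncrement P types y v tauSq with hg
  set δ := (leastPrecision pL pH - 1 / 2) ^ 2 / 2 with hδ
  have hδ0 : 0 < δ := by
    have := half_lt_leastPrecision hL hLH
    have : 0 < leastPrecision pL pH - 1 / 2 := by linarith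
    positivity
  -- Evaluation dates supply `δ d n = 4 ε n`. The reputation error and the fluctuations take `ε n`
  -- each, leaving `2 ε n` up to a constant.
  set ε := δ * d / 4 with hε
  have hε0 : 0 < ε := by positivity
  set K := Real.log (pH / (1 - pH)) with hK
  have hgK := hM.abs_glsIncrement_le hN hL hLH hH
  set gc : Increment N := fun t k x h b => stateSign k * (M.mean g t k x h - g t k x h b) with hgc
  have hmeanK : ∀ t k x h, |M.mean g t k x h| ≤ K := by
    intro t k x h
    refine (Finset.abs_sum_le_sum_abs _ _).trans ?_
    calc _ ≤ ∑ b, (M.jointReportLaw t k x h).real {b} * K := by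
          refine Finset.sum_le_sum fun b _ => ?_
          rw [abs_mul, abs_of_nonneg measureReal_nonneg]
          exact mul_le_mul_of_nonneg_left (hgK t k x h b) measureReal_nonneg
      _ = K := by rw [← Finset.sum_mul, M.sum_jointReportLaw, one_mul]
  have hlln := hM.path.ae_eventually_pathSum_lt (g := gc) (C := 2 * K) (ε := ε)
    (fun t k x h b => by
      have h1 : |gc t k x h b| = |M.mean g t k x h - g t k x h b| := by
        simp only [hgc, abs_mul, stateSign]; split_ifs <;> simp
      rw [h1]
      refine (abs_sub _ _).trans ?_
      linarith [hmeanK t k x h, hgK t k x h b])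
    (fun t k x h => by
      have e : M.mean gc t k x h = stateSign k * (M.mean g t k x h *
          (∑ b, (M.jointReportLaw t k x h).real {b}) - M.mean g t k x h) := by
        simp only [mean, hgc]
        rw [Finset.mul_sum, ← Finset.sum_sub_distrib, Finset.mul_sum]
        exact Finset.sum_congr rfl fun b _ => by ring
      rw [e, M.sum_jointReportLaw]
      simp) hε0
  filter_upwards [hlln, hM.ae_tendsto_posterior_type hL hLH hH,
    ae_all_iff.2 (ae_hist_ne_zero (P := P) (y := y))] with ω hω hrep hne hx
  have hev : ∀ᶠ t in atTop, E.indicator (fun _ => δ) t - ε ≤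
      stateSign (θ ω) * M.mean g t (θ ω) (types ω) (hist y t ω) := by
    have h1 : ∀ᶠ t in atTop, ∀ i,
        0 < posterior P y {ω' | types ω' i = types ω i} t (hist y t ω) ∧
        -ε ≤ Real.log (posterior P y {ω' | types ω' i = types ω i} t (hist y t ω)) := by
      refine eventually_all.2 fun i => ?_
      have h2 := (hrep i).log one_ne_zero
      rw [Real.log_one] at h2
      filter_upwards [(hrep i).eventually_const_lt one_pos,
        h2.eventually_const_lt (show -ε < 0 by linarith)] with t h3 h4
      exact ⟨h3, h4.le⟩
    filter_upwards [h1] with t ht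
    exact hM.le_mean_glsIncrement hN hL hLH hH (θ ω) _ hx (hne t) (fun i => (ht i).1)
      fun i => (ht i).2
  obtain ⟨C, hC⟩ := sum_ge_of_eventually_ge hev
  have hlin : Tendsto (fun n : ℕ => 2 * ε * n - C) atTop atTop :=
    tendsto_atTop_add_const_right _ (-C)
      (tendsto_natCast_atTop_atTop.const_mul_atTop (by positivity))
  refine tendsto_atTop_mono' atTop ?_ hlin
  filter_upwards [hω, hcount] with n hn hcn
  have e1 : pathSum gc θ types y n ω =
      ∑ t ∈ Finset.range n, stateSign (θ ω) * M.mean g t (θ ω) (types ω) (hist y t ω) -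
        stateSign (θ ω) * pathSum g θ types y n ω := by
    simp only [pathSum, hgc]
    rw [Finset.mul_sum, ← Finset.sum_sub_distrib]
    exact Finset.sum_congr rfl fun t _ => by ring
  have e2 : ∑ t ∈ Finset.range n, (E.indicator (fun _ => δ) t - ε) =
      δ * dateCount E n - ε * n := by
    rw [Finset.sum_sub_distrib, dateCount, Finset.mul_sum]
    simp only [Finset.sum_const, Finset.card_range, nsmul_eq_mul]
    congr 1
    · refine Finset.sum_congr rfl fun t _ => ?_
      by_cases ht : t ∈ E <;> simp [ht]
    · ring
  have h3 := hC n
  rw [e2] at h3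
  rw [e1] at hn
  have h4 := mul_le_mul_of_nonneg_left hcn hδ0.le
  have h5 : δ * (d * n) = 4 * ε * n := by rw [hε]; ring
  linarith

lemma Assumptions.ae_tendsto_gls [IsProbabilityMeasure P]
    (hM : M.Assumptions P θ types y v tauSq rhoC S E) (hN : 0 < N)
    (hL : 1 / 2 ≤ pL) (hLH : pL < pH) (hH : pH < 1) :
    ∀ᵐ ω ∂P, (∀ i, 1 / 2 < precision pL pH (types ω i)) →
      Tendsto (fun t => Real.sigmoid (M.glsLogit P θ types y v tauSq t ω)) atTop
        (𝓝 (if θ ω then 1 else 0)) := by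
  filter_upwards [hM.ae_tendsto_pathSum_glsIncrement hN hL hLH hH] with ω hω hx
  have h := hω hx
  simp only [glsLogit_eq]
  cases hθ : θ ω
  · rw [hθ] at h
    have h1 : Tendsto (fun n => pathSum (M.glsIncrement P types y v tauSq) θ types y n ω)
        atTop atBot := by
      rw [← tendsto_neg_atTop_iff]
      exact h.congr fun n => by simp [stateSign]
    exact Real.tendsto_sigmoid_atBot.comp (tendsto_atBot_add_const_left _ _ h1)
  · rw [hθ] at h
    have h1 : Tendsto (fun n => pathSum (M.glsIncrement P types y v tauSq) θ types y n ω)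
        atTop atTop := h.congr fun n => by simp [stateSign]
    exact Real.tendsto_sigmoid_atTop.comp (tendsto_atTop_add_const_left _ _ h1)

end BinaryPanel

end ExpertPanel

end

theorem mainTheorem10 (pL pH : ℝ) (hL : 1 / 2 ≤ pL) (hLH : pL < pH) (hH : pH < 1) :
    -- binary model
    (∃ c : ℝ, 0 < c ∧
      ∀ (N : ℕ), 2 ≤ N → ∀ (M : ExpertPanel.BinaryPanel N pL pH)
        (Ω : Type*) [MeasurableSpace Ω] (P : Measure Ω) [IsProbabilityMeasure P]
        (θ : Ω → Bool) (types : Ω → ExpertPanel.Profile N) (y : ℕ → Ω → ExpertPanel.Profile N)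
        (v : (t : ℕ) → Bool → ExpertPanel.Profile N → ExpertPanel.Hist N t → Fin N → ℝ)
        (tauSq : (t : ℕ) → Bool → ExpertPanel.Profile N → ExpertPanel.Hist N t → ℝ) (rhoC : ℝ)
        (S : Bool → Measure Bool → Bool → ℝ) (E : Set ℕ),
        M.Assumptions P θ types y v tauSq rhoC S E →
        -- uniform divergence of the joint report law between the two states, given the types
        (∀ t ∈ E, ∀ (x : ExpertPanel.Profile N) (h : ExpertPanel.Hist N t),
          (∃ i, 1 / 2 < ExpertPanel.precision pL pH (x i)) → ∀ k : Bool,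
          ENNReal.ofReal c ≤
            InformationTheory.klDiv (M.jointReportLaw t k x h) (M.jointReportLaw t (!k) x h)) ∧
        -- the same for the observer's predictive law, the types being integrated out
        (1 / 2 < pL → ∀ t ∈ E, ∀ h : ExpertPanel.Hist N t,
          (∀ k : Bool, P {ω | θ ω = k ∧ ExpertPanel.hist y t ω = h} ≠ 0) → ∀ k : Bool,
          ENNReal.ofReal c ≤ InformationTheory.klDiv
            ((ProbabilityTheory.cond P {ω | θ ω = k ∧ ExpertPanel.hist y t ω = h}).map (y t))
            ((ProbabilityTheory.cond P {ω | θ ω = !k ∧ ExpertPanel.hist y t ω = h}).map (y t))) ∧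
        -- the public belief learns the state
        (∀ᵐ ω ∂P, (∃ i, 1 / 2 < ExpertPanel.precision pL pH (types ω i)) →
          Tendsto (fun t => ExpertPanel.belief P θ y t ω) atTop (𝓝 (if θ ω then 1 else 0))) ∧
        -- so does the GLS pool
        (∀ᵐ ω ∂P, (∀ i, 1 / 2 < ExpertPanel.precision pL pH (types ω i)) →
          Tendsto (fun t => Real.sigmoid (M.glsLogit P θ types y v tauSq t ω)) atTop
            (𝓝 (if θ ω then 1 else 0))) ∧
        -- reputations learn the types
        (∀ᵐ ω ∂P, ∀ i, Tendsto (fun t => ExpertPanel.reputation P types y i t ω) atTop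
          (𝓝 (if types ω i then 1 else 0))) ∧
        (∀ᵐ ω ∂P, ∀ i, Tendsto (fun t => M.scoredReputation θ y S E i t ω) atTop
          (𝓝 (if types ω i then 1 else 0)))) ∧
    -- Gaussian model
    (∀ (N : ℕ), 2 ≤ N → ∀ rhoC : ℝ, rhoC < 1 → ∃ c : ℝ, 0 < c ∧
      ∀ (Ω : Type*) [mΩ : MeasurableSpace Ω] (P : Measure Ω) [IsProbabilityMeasure P]
        (𝓖 : Filtration ℕ mΩ) (G : ExpertPanel.GaussianPanel N Ω)
        (S : ℝ → Measure ℝ → ℝ → ℝ) (E : Set ℕ),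
        G.Assumptions P 𝓖 pL pH rhoC S E →
        -- uniform positive definiteness, with `H_t` the vector resp. diagonal matrix of loadings
        (∀ t ∈ E, ∀ ω, c ≤ G.info t ω) ∧
        (∀ t ∈ E, ∀ ω, ((Matrix.diagonal (G.loading t ω))ᵀ * (G.noiseCov t ω)⁻¹ *
          Matrix.diagonal (G.loading t ω) - c • (1 : Matrix (Fin N) (Fin N) ℝ)).PosSemidef) ∧
        (∀ ω, Antitone (fun t => G.V t ω) ∧ Tendsto (fun t => G.V t ω) atTop (𝓝 0)) ∧
        (∀ᵐ ω ∂P, Tendsto (fun t => G.m t ω) atTop (𝓝 (G.state ω)))) := by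
  constructor
  · have hhalf := ExpertPanel.BinaryPanel.half_lt_leastPrecision hL hLH
    have hpos : 0 < 2 * ExpertPanel.BinaryPanel.leastPrecision pL pH - 1 := by linarith
    refine ⟨(2 * ExpertPanel.BinaryPanel.leastPrecision pL pH - 1) ^ 2 / 2, by positivity, ?_⟩
    intro N hN M Ω _ P _ θ types y v tauSq rhoC S E hM
    have hN0 : 0 < N := by omega
    exact ⟨fun t ht x h hx k => hM.le_klDiv_jointReportLaw hL hLH hH ht x h hx k,
      fun hL' t ht h hh k => hM.le_klDiv_predictive hN0 hL' hLH hH ht h hh k,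
      hM.ae_tendsto_belief hL hLH hH, hM.ae_tendsto_gls hN0 hL hLH hH,
      hM.ae_tendsto_reputation hL hLH hH, hM.ae_tendsto_scoredReputation hL hLH hH⟩
  · intro N hN rhoC hr
    refine ⟨ExpertPanel.GaussianPanel.infoBound N rhoC,
      ExpertPanel.GaussianPanel.infoBound_pos N hr, ?_⟩
    intro Ω _ P _ 𝓖 G S E hG
    exact ⟨fun t ht ω => hG.le_info hL hLH hN hr ht ω,
      fun t ht ω => hG.posSemidef_info hL hLH hN hr ht ω,
      fun ω => ⟨hG.antitone_V ω, hG.tendsto_V hL hLH hN hr ω⟩,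
      hG.ae_tendsto_m hL hLH hN hr⟩
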